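/- Let $s>1$, $C>0$, and let $V\in L^1_{\rm loc}(\mathbb R)$ be real-valued with $V(x)\ge C^{-1}|x|^s$ for almost every $x\in\mathbb R$. Let $h=-\partial_x^2+V$ be the self-adjoint operator on $\mathfrak H=L^2(\mathbb R;\mathbb C)$ associated with the closed quadratic form $u\mapsto\int_{\mathbb R}(|u'|^2+V|u|^2)$ on $\{u\in H^1(\mathbb R):\int V|u|^2<\infty\}$. Then $h$ has a spectral decomposition $h=\sum_{n\ge 0}\lambda_n|u_n\rangle\langle u_n|$ with an orthonormal basis $(u_n)_{n\ge0}$ of $\mathfrak H$ and $\lambda_n>0$. Fix any such decomposition. For $t\in\mathbb R$ let $$\mathfrak H^t=\Big\{u=\sum_{n\ge0}\alpha_nu_n\ :\ \sum_{n\ge0}\lambda_n^t|\alpha_n|^2<\infty\Big\}$$ (a space of formal series, identified with their coefficient sequences; write $\langle u_n,u\rangle=\alpha_n$), let $X=\bigcap_{t<1/2-1/s}\mathfrak H^t$, with the $\sigma$-algebra generated by the coefficients (which is its Borel $\sigma$-algebra), and for $K\ge0$ let $\mu_{0,K}$ be the probability measure on $V_K=\mathrm{span}(u_0,\dots,u_K)$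 given by $$d\mu_{0,K}(u)=\bigotimes_{j=0}^K\frac{\lambda_j}{\pi}e^{-\lambda_j|\alpha_j|^2}\,da_j\,db_j,\qquad \alpha_j=\langle u_j,u\rangle=a_j+ib_j .$$ (1) There is a unique probability measure $\mu_0$ on $X$ whose image under the projection $\sum_n\alpha_nu_n\mapsto\sum_{n\le K}\alpha_nu_n$ is $\mu_{0,K}$ for all $K$. It is a centered Gaussian measure: for every $t<1/2-1/s$ and every $c\in\mathfrak H^{-t}$ the random variable $\mathrm{Re}\,\langle c,u\rangle$ has a centered real Gaussian law (possibly of variance $0$) under $\mu_0$. (2) $h$ has a bounded inverse. For every integer $k\ge0$, let $\mathfrak H_k=L^2_{\rm sym}(\mathbb R^k)$ be the space of permutation-symmetric functions, let $\varphi_1\otimes_{\rm sym}\cdots\otimes_{\rm sym}\varphi_k=(k!)^{-1/2}\sum_{\sigma\in S_k}\varphi_{\sigma(1)}\otimes\cdots\otimes\varphi_{\sigma(k)}$, and let $(h^{-1})^{\otimes k}$ be the bounded operator on $\mathfrak H_k$ with $(h^{-1})^{\otimes k}(\varphi_1\otimes_{\rm sym}\cdots\otimes_{\rm sym}\varphi_k)=h^{-1}\varphi_1\otimes_{\rm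 sym}\cdots\otimes_{\rm sym}h^{-1}\varphi_k$ for all $\varphi_i\in\mathfrak H$. The $k$-particle density matrix of $\mu_0$ is well defined and $$\gamma_0^{(k)}:=\int|u^{\otimes k}\rangle\langle u^{\otimes k}|\,d\mu_0(u)=k!\,(h^{-1})^{\otimes k},$$ where the integral is understood weakly: $\gamma_0^{(k)}$ is the unique bounded operator on $\mathfrak H_k$ such that $\langle\Phi,\gamma_0^{(k)}\Psi\rangle=\int\langle\Phi,u^{\otimes k}\rangle\langle u^{\otimes k},\Psi\rangle\,d\mu_0(u)$, with integrable integrand, for all $\Phi,\Psi$ that are symmetric tensor products of elements of $\mathfrak H\cap\mathfrak H^{-t}$, $t<1/2-1/s$. (3) $\gamma_0^{(k)}$ belongs to the Schatten class $\mathfrak S^p(\mathfrak H_k)$ (it is compact and its singular values are in $\ell^p$) for all $1/s+1/2<p\le\infty$. -/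

import Mathlib

open MeasureTheory ProbabilityTheory Filter Topology
open scoped ENNReal NNReal ComplexConjugate InnerProductSpace

namespace FreeGibbs

noncomputable section

/-- The one-particle space `𝔥 = L²(ℝ; ℂ)`. -/
abbrev L2R : Type := Lp ℂ 2 (volume : Measure ℝ)

/-! ### The Schrödinger operator `h = -∂ₓ² + V` -/

/-- `g ∈ L²` is the weak derivative of `f ∈ L²`. -/
def IsWeakDeriv (f g : L2R) : Prop :=
  ∀ φ : ℝ → ℝ, ContDiff ℝ (⊤ : ℕ∞) φ → HasCompactSupport φ →
    ∫ x, deriv φ x • f x = - ∫ x, φ x • g x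

/-- `f` lies in the form domain `{f ∈ H¹(ℝ) : ∫ V |f|² < ∞}` of `-∂ₓ² + V`,
and `f'` is its derivative. -/
def InFormDomain (V : ℝ → ℝ) (f f' : L2R) : Prop :=
  IsWeakDeriv f f' ∧ Integrable (fun x => V x * ‖f x‖ ^ 2)

/-- The graph of the self-adjoint operator `h = -∂ₓ² + V`, the operator of the closed quadratic form
`f ↦ ∫ |f'|² + V |f|²`: `f` is in the domain of `h` and `h f = g` if and only if `f` is in the form
domain and `⟨v', f'⟩ + ∫ V v̄ f = ⟨v, g⟩` for all `v` in the form domain. -/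
def SchrodingerGraph (V : ℝ → ℝ) (f g : L2R) : Prop :=
  ∃ f' : L2R, InFormDomain V f f' ∧
    ∀ v v' : L2R, InFormDomain V v v' →
      ⟪v', f'⟫_ℂ + ∫ x, (V x : ℂ) * (conj (v x) * f x) = ⟪v, g⟫_ℂ

/-- The spectral decomposition `h = ∑ₙ λₙ |uₙ⟩⟨uₙ|` in an orthonormal basis `(uₙ)` of `L²(ℝ)`, as
an equality of unbounded operators: `f ∈ D(h)` and `h f = g` if and only if `g` has the coefficients
`λₙ ⟨uₙ, f⟩`. -/
def IsSpectralDecomposition (V : ℝ → ℝ) (u : HilbertBasis ℕ ℂ L2R) (lam : ℕ → ℝ) : Prop :=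
  ∀ f g : L2R, SchrodingerGraph V f g ↔ ∀ n, ⟪u n, g⟫_ℂ = (lam n : ℂ) * ⟪u n, f⟫_ℂ

/-- The bounded operator `R` on `L²(ℝ)` is the inverse of `h`. -/
def IsInverse (V : ℝ → ℝ) (R : L2R →L[ℂ] L2R) : Prop :=
  ∀ f g : L2R, SchrodingerGraph V f g ↔ R g = f

/-! ### The spaces `𝔥ᵗ` and the Gaussian measures -/

/-- The space `𝔥ᵗ` of the series `u = ∑ₙ αₙ uₙ` with `∑ₙ λₙᵗ |αₙ|² < ∞`; `u` is identified with its
sequence of coefficients `α`. -/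
def SobolevLike (lam : ℕ → ℝ) (t : ℝ) : Set (ℕ → ℂ) :=
  {α | Summable fun n => lam n ^ t * ‖α n‖ ^ 2}

/-- The space `⋂_{t < t₀} 𝔥ᵗ`. As a subtype of `ℕ → ℂ` it carries the σ-algebra generated by the
coefficients `αₙ`, which is also the Borel σ-algebra of its Fréchet topology. -/
abbrev SobolevInter (lam : ℕ → ℝ) (t₀ : ℝ) : Type :=
  ↥(⋂ t ∈ Set.Iio t₀, SobolevLike lam t)

/-- The measure `⨂_{j ≤ K} (λⱼ/π) exp(-λⱼ |zⱼ|²) daⱼ dbⱼ`, `zⱼ = aⱼ + i bⱼ`, on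
`span(u₀, …, u_K) ≃ ℂ^(K+1)`. -/
def gaussianCyl (lam : ℕ → ℝ) (K : ℕ) : Measure (Fin (K + 1) → ℂ) :=
  Measure.pi fun j : Fin (K + 1) =>
    (volume : Measure ℂ).withDensity fun z =>
      ENNReal.ofReal (lam j / Real.pi * Real.exp (-(lam j * ‖z‖ ^ 2)))

/-- The projection of `⋂_{t < t₀} 𝔥ᵗ` on `span(u₀, …, u_K) ≃ ℂ^(K+1)`. -/
def cylProj {lam : ℕ → ℝ} {t₀ : ℝ} (K : ℕ) (α : SobolevInter lam t₀) : Fin (K + 1) → ℂ :=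
  fun j => α.1 j

/-- `μ` is a probability measure with cylindrical projection `gaussianCyl lam K` for all `K`. -/
def IsFreeGibbs {lam : ℕ → ℝ} {t₀ : ℝ} (μ : Measure (SobolevInter lam t₀)) : Prop :=
  IsProbabilityMeasure μ ∧ ∀ K : ℕ, μ.map (cylProj K) = gaussianCyl lam K

/-- The duality pairing `∑ₙ c̄ₙ αₙ` of two coefficient sequences, an absolutely convergent
series for `c ∈ 𝔥⁻ᵗ` and `α ∈ 𝔥ᵗ`. -/
def pairing (c α : ℕ → ℂ) : ℂ := ∑' n, conj (c n) * α n

/-- `μ` is a centered Gaussian measure: every continuous real linear functional `Re ⟨c, ·⟩` on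
`⋂_{t < t₀} 𝔥ᵗ`, that is, `c ∈ 𝔥⁻ᵗ` for some `t < t₀`, has a centered real Gaussian law. -/
def IsCenteredGaussian {lam : ℕ → ℝ} {t₀ : ℝ} (μ : Measure (SobolevInter lam t₀)) : Prop :=
  ∀ t < t₀, ∀ c ∈ SobolevLike lam (-t), ∃ v : ℝ≥0,
    μ.map (fun α => (pairing c α.1).re) = gaussianReal 0 v

/-! ### The `k`-particle space and its operators -/

/-- `L²(ℝᵏ; ℂ)`. -/
abbrev L2Rk (k : ℕ) : Type := Lp ℂ 2 (volume : Measure (Fin k → ℝ))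

theorem measurePreserving_perm {k : ℕ} (σ : Equiv.Perm (Fin k)) :
    MeasurePreserving (fun x : Fin k → ℝ => x ∘ σ) volume volume := by
  have h := volume_measurePreserving_piCongrLeft (fun _ : Fin k => ℝ) σ.symm
  have e : (⇑(MeasurableEquiv.piCongrLeft (fun _ : Fin k => ℝ) σ.symm)
      : (Fin k → ℝ) → (Fin k → ℝ)) = fun x => x ∘ σ := by
    funext x i
    have := MeasurableEquiv.piCongrLeft_apply_apply (β := fun _ : Fin k => ℝ) σ.symm x (σ i)
    simpa using this
  rw [e] at h
  exact h

/-- The bosonic `k`-particle space `𝔥ₖ = L²_sym(ℝᵏ)`. -/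
def SymL2 (k : ℕ) : Submodule ℂ (L2Rk k) where
  carrier := {Φ | ∀ σ : Equiv.Perm (Fin k), (fun x => Φ (x ∘ σ)) =ᵐ[volume] Φ}
  zero_mem' := by
    intro σ
    have h0 := Lp.coeFn_zero (E := ℂ) (p := 2) (μ := (volume : Measure (Fin k → ℝ)))
    exact ((measurePreserving_perm σ).quasiMeasurePreserving.ae_eq h0).trans h0.symm
  add_mem' := by
    intro Φ Ψ hΦ hΨ σ
    have h0 := Lp.coeFn_add Φ Ψ
    have h1 := (measurePreserving_perm σ).quasiMeasurePreserving.ae_eq h0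
    filter_upwards [h0, h1, hΦ σ, hΨ σ] with x a b c d
    simp only [Function.comp_apply, Pi.add_apply] at a b
    rw [a, b, c, d]
  smul_mem' := by
    intro r Φ hΦ σ
    have h0 := Lp.coeFn_smul r Φ
    have h1 := (measurePreserving_perm σ).quasiMeasurePreserving.ae_eq h0
    filter_upwards [h0, h1, hΦ σ] with x a b c
    simp only [Function.comp_apply, Pi.smul_apply] at a b
    rw [a, b, c]

/-- The function `(x₁, …, xₖ) ↦ (k!)^{-1/2} ∑_σ ∏ᵢ φ_{σ(i)}(xᵢ)`. -/
def symTensorFun {k : ℕ} (φ : Fin k → L2R) (x : Fin k → ℝ) : ℂ :=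
  ((Real.sqrt (k.factorial : ℝ))⁻¹ : ℂ) * ∑ σ : Equiv.Perm (Fin k), ∏ i, φ (σ i) (x i)

theorem memLp_tensor {k : ℕ} (φ : Fin k → L2R) :
    MemLp (fun x : Fin k → ℝ => ∏ i, φ i (x i)) 2 volume := by
  have hm : AEStronglyMeasurable (fun x : Fin k → ℝ => ∏ i, φ i (x i)) volume := by
    refine Finset.aestronglyMeasurable_fun_prod _ fun i _ => ?_
    exact ((Lp.stronglyMeasurable (φ i)).comp_measurable (measurable_pi_apply i)).aestronglyMeasurable
  rw [memLp_two_iff_integrable_sq_norm hm]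
  have h : ∀ i, Integrable (fun y : ℝ => ‖φ i y‖ ^ 2) volume := fun i =>
    (memLp_two_iff_integrable_sq_norm (Lp.aestronglyMeasurable _)).1 (Lp.memLp (φ i))
  have := Integrable.fintype_prod (μ := fun _ : Fin k => (volume : Measure ℝ)) h
  rw [← volume_pi] at this
  simpa only [norm_prod, Finset.prod_pow] using this

theorem memLp_symTensorFun {k : ℕ} (φ : Fin k → L2R) : MemLp (symTensorFun φ) 2 volume := by
  have : MemLp (fun x : Fin k → ℝ =>
      ∑ σ : Equiv.Perm (Fin k), ∏ i, φ (σ i) (x i)) 2 volume :=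
    memLp_finsetSum _ fun σ _ => memLp_tensor fun i => φ (σ i)
  exact this.const_mul _

theorem symTensorFun_comp {k : ℕ} (φ : Fin k → L2R) (τ : Equiv.Perm (Fin k)) (x : Fin k → ℝ) :
    symTensorFun φ (x ∘ τ) = symTensorFun φ x := by
  unfold symTensorFun
  congr 1
  refine Fintype.sum_equiv (Equiv.mulRight τ⁻¹) _ _ fun σ => ?_
  refine Fintype.prod_equiv τ _ _ fun i => ?_
  simp

/-- The symmetric tensor product
`φ₁ ⊗_sym ⋯ ⊗_sym φₖ = (k!)^{-1/2} ∑_σ φ_{σ(1)} ⊗ ⋯ ⊗ φ_{σ(k)}` in `𝔥ₖ`. -/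
def symTensor {k : ℕ} (φ : Fin k → L2R) : SymL2 k :=
  ⟨(memLp_symTensorFun φ).toLp, by
    intro τ
    have h0 := (memLp_symTensorFun φ).coeFn_toLp
    have h1 := (measurePreserving_perm τ).quasiMeasurePreserving.ae_eq h0
    filter_upwards [h0, h1] with x a b
    simp only [Function.comp_apply] at b
    rw [a, b, symTensorFun_comp]⟩

/-- `T = A^{⊗k}`, the bounded operator on `𝔥ₖ` with
`T (φ₁ ⊗_sym ⋯ ⊗_sym φₖ) = A φ₁ ⊗_sym ⋯ ⊗_sym A φₖ`. -/
def IsTensorPower (A : L2R →L[ℂ] L2R) (k : ℕ) (T : SymL2 k →L[ℂ] SymL2 k) : Prop :=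
  ∀ φ : Fin k → L2R, T (symTensor φ) = symTensor fun i => A (φ i)

/-- The pairing `⟨φ₁ ⊗_sym ⋯ ⊗_sym φₖ, u^{⊗k}⟩ = (k!)^{-1/2} ∑_σ ∏ᵢ ⟨φ_{σ(i)}, u⟩` for
`u = ∑ₙ αₙ uₙ`. -/
def symPairing (u : HilbertBasis ℕ ℂ L2R) {k : ℕ} (φ : Fin k → L2R) (α : ℕ → ℂ) : ℂ :=
  ((Real.sqrt (k.factorial : ℝ))⁻¹ : ℂ) *
    ∑ σ : Equiv.Perm (Fin k), ∏ i, pairing (fun n => ⟪u n, φ (σ i)⟫_ℂ) α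

/-- `γ = ∫ |u^{⊗k}⟩⟨u^{⊗k}| dμ(u)` as an operator on `𝔥ₖ`. The integral is meant weakly, because
`u` need not be in `L²`: for all symmetric products `Φ`, `Ψ` of elements of `L² ∩ 𝔥⁻ᵗ`, `t < t₀`,
the function `⟨Φ, u^{⊗k}⟩ ⟨u^{⊗k}, Ψ⟩` of `u` is integrable with integral `⟨Φ, γ Ψ⟩`. -/
def IsDensityMatrix (u : HilbertBasis ℕ ℂ L2R) {lam : ℕ → ℝ} {t₀ : ℝ}
    (μ : Measure (SobolevInter lam t₀)) (k : ℕ) (γ : SymL2 k →L[ℂ] SymL2 k) : Prop :=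
  ∀ t < t₀, ∀ φ ψ : Fin k → L2R,
    (∀ i, (fun n => ⟪u n, φ i⟫_ℂ) ∈ SobolevLike lam (-t)) →
    (∀ i, (fun n => ⟪u n, ψ i⟫_ℂ) ∈ SobolevLike lam (-t)) →
      Integrable (fun α : SobolevInter lam t₀ =>
        symPairing u φ α.1 * conj (symPairing u ψ α.1)) μ ∧
      ∫ α : SobolevInter lam t₀, symPairing u φ α.1 * conj (symPairing u ψ α.1) ∂μ =
        ⟪symTensor φ, γ (symTensor ψ)⟫_ℂ

/-- `T` belongs to the Schatten class `𝔖ᵖ(H)`: it has a singular value decomposition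
`T = ∑ᵢ σᵢ |fᵢ⟩⟨eᵢ|` with `σᵢ → 0` and `σ ∈ ℓᵖ`. For `p = ∞` this is the class of compact
operators. -/
def IsSchatten {H : Type*} [NormedAddCommGroup H] [InnerProductSpace ℂ H]
    (p : ℝ≥0∞) (T : H →L[ℂ] H) : Prop :=
  ∃ (ι : Type) (e f : ι → H) (σ : ι → ℝ), Orthonormal ℂ e ∧ Orthonormal ℂ f ∧
    (∀ i, 0 ≤ σ i) ∧ Tendsto σ cofinite (𝓝 0) ∧ Memℓp σ p ∧
    ∀ x, HasSum (fun i => ((σ i : ℂ) * ⟪e i, x⟫_ℂ) • f i) (T x)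

end

end FreeGibbs

open MeasureTheory ProbabilityTheory Filter Topology
open scoped ENNReal NNReal ComplexConjugate InnerProductSpace

namespace FreeGibbs

noncomputable section

/-! ### Weak derivatives -/

/-! Everything rests on one approximation estimate (`exists_finiteRank_approx`). Cut `(-L, L]` into
`M` cells, replace `f` by its average on each cell and by zero outside. The Poincaré inequality on
cells bounds the inner error by the squared cell length times `‖f'‖²`, and the growth of `V` bounds
the outer error by `C L^(-s)` times the potential energy. Thus, up to `ε` times the energy in
squared norm, the form domain looks like a space of dimension `M`.

Used with `ε → 0`, the estimate makes the embedding `ι` of the form domain into `L²` compact. By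
Riesz representation `(h + 1)⁻¹ = ι ι*`, so the spectral theorem for compact symmetric operators
yields the eigenbasis. Used with `ε = 1/(2E)`, it bounds the number of eigenvalues at most `E` by `1
+ A E^(1/s + 1/2)`: among more than `M` eigenvectors some nonzero combination is orthogonal to all
the cells, which contradicts its energy bound. A dyadic decomposition then gives `∑ λₙ^(-p) < ∞` for
every `p > 1/s + 1/2`, and all remaining claims use only this.

The measure is the infinite product of the complex Gaussians. The expectation of `∑ λₙᵗ |αₙ|²` is `∑
λₙ^(t-1)`, finite exactly in the range provided by the eigenvalue bound, so the product charges only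
the intersection of the spaces `𝔥ᵗ` (`exists_isFreeGibbs`). The cylinder marginals determine it.
Linear functionals are limits of truncated sums, whose characteristic functions are explicit.

For the density matrices, a complex Gaussian pair with covariance `S` has mixed moments `k! Sᵏ`.
This passes from finite sums (`gaussian_moments`) to the full pairing by dominated convergence
(`IsFreeGibbs.integral_pairing_pow`). Polarization by Ryser's formula turns powers into permanents
(`IsFreeGibbs.integral_symPairing`), and these permanents are the inner products of symmetric
tensors. Finally `(h⁻¹)^{⊗k}` is diagonal in the occupation number basis with eigenvalues `∏
λ_{mᵢ}⁻¹`; their `p`-th powers sum to at most `(∑ λₙ^(-p))ᵏ`, which gives the Schatten bound. -/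

theorem exists_support_subset_Ioc {E : Type*} [Zero E] {φ : ℝ → E} (h : HasCompactSupport φ) :
    ∃ a : ℝ, 0 < a ∧ tsupport φ ⊆ Set.Ioo (-a) a := by
  obtain ⟨r, hr⟩ := h.isCompact.isBounded.subset_closedBall 0
  refine ⟨|r| + 1, by positivity, fun x hx => ?_⟩
  have h1 := hr hx
  rw [Metric.mem_closedBall, dist_zero_right, Real.norm_eq_abs] at h1
  have h2 := le_abs_self r
  rw [Set.mem_Ioo, ← abs_lt]
  linarith

/-- Integration by parts for absolutely continuous functions, with Lebesgue differentiation
identifying the derivative of the primitive almost everywhere. The support lies in an open interval,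
so both boundary terms vanish. -/
theorem integral_deriv_mul_primitive {g φ : ℝ → ℝ} (hg : LocallyIntegrable g)
    (hφ : ContDiff ℝ (⊤ : ℕ∞) φ) (hc : HasCompactSupport φ) :
    ∫ x, deriv φ x * ∫ y in (0 : ℝ)..x, g y = - ∫ x, φ x * g x := by
  obtain ⟨a, ha, hsub⟩ := exists_support_subset_Ioc hc
  have hsub' : tsupport (deriv φ) ⊆ Set.Ioo (-a) a :=
    (closure_minimal (support_deriv_subset) (isClosed_tsupport φ)).trans hsub
  have hI : ∀ p q, IntervalIntegrable g volume p q := fun p q =>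
    (hg.integrableOn_isCompact isCompact_uIcc).intervalIntegrable
  have e1 := intervalIntegral.integral_eq_integral_of_support_subset (μ := volume)
    (f := fun x => deriv φ x * ∫ y in (0 : ℝ)..x, g y) (a := -a) (b := a)
    (fun x hx => Set.Ioo_subset_Ioc_self (hsub' (subset_tsupport _ (left_ne_zero_of_mul hx))))
  have e2 := intervalIntegral.integral_eq_integral_of_support_subset (μ := volume)
    (f := fun x => φ x * g x) (a := -a) (b := a)
    (fun x hx => Set.Ioo_subset_Ioc_self (hsub (subset_tsupport _ (left_ne_zero_of_mul hx))))
  rw [← e1, ← e2]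
  have hF : AbsolutelyContinuousOnInterval (fun x => ∫ y in (0 : ℝ)..x, g y) (-a) a :=
    (hI (-a) a).absolutelyContinuousOnInterval_intervalIntegral
      (by rw [Set.mem_uIcc]; left; constructor <;> linarith)
  have hφ' : AbsolutelyContinuousOnInterval φ (-a) a :=
    ContDiffOn.absolutelyContinuousOnInterval (hφ.of_le (by simp)).contDiffOn
  have key := hF.integral_mul_deriv_eq_deriv_mul hφ'
  have z : ∀ x, x ∉ Set.Ioo (-a) a → φ x = 0 := fun x hx =>
    image_eq_zero_of_notMem_tsupport fun h => hx (hsub h)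
  rw [z a (by simp), z (-a) (by simp)] at key
  simp only [mul_zero, sub_zero, zero_sub] at key
  simp only [mul_comm (deriv φ _)]
  rw [key]
  congr 1
  refine intervalIntegral.integral_congr_ae ?_
  filter_upwards [LocallyIntegrable.ae_hasDerivAt_integral hg] with x hx _
  rw [(hx 0).deriv, mul_comm]

theorem integral_deriv_smul_primitive {g : ℝ → ℂ} {φ : ℝ → ℝ} (hg : LocallyIntegrable g)
    (hφ : ContDiff ℝ (⊤ : ℕ∞) φ) (hc : HasCompactSupport φ) :
    ∫ x, deriv φ x • ∫ y in (0 : ℝ)..x, g y = - ∫ x, φ x • g x := by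
  have hI : ∀ p q, IntervalIntegrable g volume p q := fun p q =>
    (hg.integrableOn_isCompact isCompact_uIcc).intervalIntegrable
  have hd : Continuous (deriv φ) := hφ.continuous_deriv (by simp)
  have i1 : Integrable fun x => deriv φ x • ∫ y in (0 : ℝ)..x, g y :=
    (hd.smul (intervalIntegral.continuous_primitive hI 0)).integrable_of_hasCompactSupport
      hc.deriv.smul_right
  have i2 : Integrable fun x => φ x • g x :=
    hg.integrable_smul_left_of_hasCompactSupport hφ.continuous hc
  -- Real and imaginary parts are continuous real functionals that commute with all the integrals,
  -- so the real case suffices.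
  have key : ∀ T : ℂ →L[ℝ] ℝ,
      T (∫ x, deriv φ x • ∫ y in (0 : ℝ)..x, g y) = T (- ∫ x, φ x • g x) := by
    intro T
    rw [map_neg, ← T.integral_comp_comm i1, ← T.integral_comp_comm i2]
    have hT : LocallyIntegrable fun x => T (g x) := by
      intro x
      obtain ⟨s, hs, h⟩ := hg x
      exact ⟨s, hs, T.integrable_comp h⟩
    have := integral_deriv_mul_primitive hT hφ hc
    simp only [map_smul, smul_eq_mul]
    rw [← this]
    congr 1 with x
    rw [T.intervalIntegral_comp_comm (hI 0 x)]
  exact Complex.ext (key Complex.reCLM) (key Complex.imCLM)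

/-- The primitive started to the left of the support is constant to its right, and the vanishing
mean makes that constant zero. -/
theorem exists_primitive_of_integral_eq_zero {χ : ℝ → ℝ} (hχ : ContDiff ℝ (⊤ : ℕ∞) χ)
    (hc : HasCompactSupport χ) (h0 : ∫ x, χ x = 0) :
    ∃ φ : ℝ → ℝ, ContDiff ℝ (⊤ : ℕ∞) φ ∧ HasCompactSupport φ ∧ deriv φ = χ := by
  obtain ⟨a, ha, hsub⟩ := exists_support_subset_Ioc hc
  have z : ∀ x, x ∉ Set.Ioo (-a) a → χ x = 0 := fun x hx =>
    image_eq_zero_of_notMem_tsupport fun h => hx (hsub h)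
  have hd : ∀ x, HasDerivAt (fun x => ∫ y in (-a)..x, χ y) (χ x) x := fun x =>
    intervalIntegral.integral_hasDerivAt_right (hχ.continuous.intervalIntegrable _ _)
      (hχ.continuous.stronglyMeasurableAtFilter _ _) hχ.continuous.continuousAt
  have hde : deriv (fun x => ∫ y in (-a)..x, χ y) = χ := funext fun x => (hd x).deriv
  refine ⟨fun x => ∫ y in (-a)..x, χ y, ?_, ?_, hde⟩
  · rw [contDiff_infty_iff_deriv, hde]
    exact ⟨fun x => (hd x).differentiableAt, hχ⟩
  · refine HasCompactSupport.of_support_subset_isCompact (isCompact_Icc (a := -a) (b := a)) ?_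
    intro x hx
    by_contra hn
    apply hx
    rw [Set.mem_Icc, not_and_or, not_le, not_le] at hn
    rcases hn with hn | hn
    · refine intervalIntegral.integral_zero_ae (ae_of_all _ fun y hy => z y ?_)
      rw [Set.uIoc_of_ge hn.le] at hy
      exact fun h => absurd h.1 (not_lt.2 hy.2)
    · show ∫ y in (-a)..x, χ y = 0
      rw [intervalIntegral.integral_eq_integral_of_support_subset, h0]
      intro y hy
      have := hsub (subset_tsupport _ hy)
      exact ⟨this.1, this.2.le.trans hn.le⟩

/-- The du Bois-Reymond argument: for a bump `ρ` of integral one, `ψ - (∫ ψ) ρ` has mean zero, hence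
is the derivative of a test function. So `D - ∫ ρ D` annihilates every test function `ψ`. -/
theorem exists_ae_eq_const_of_integral_deriv_smul {D : ℝ → ℂ} (hD : LocallyIntegrable D)
    (h : ∀ φ : ℝ → ℝ, ContDiff ℝ (⊤ : ℕ∞) φ → HasCompactSupport φ → ∫ x, deriv φ x • D x = 0) :
    ∃ c : ℂ, ∀ᵐ x, D x = c := by
  let b : ContDiffBump (0 : ℝ) := default
  let ρ := b.normed (volume : Measure ℝ)
  have hρ : ContDiff ℝ (⊤ : ℕ∞) ρ := b.contDiff_normed
  have hρc : HasCompactSupport ρ := b.hasCompactSupport_normed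
  have hρ1 : ∫ x, ρ x = 1 := b.integral_normed
  refine ⟨∫ x, ρ x • D x, ?_⟩
  have : ∀ᵐ x, D x - (∫ x, ρ x • D x) = 0 := by
    refine ae_eq_zero_of_integral_contDiff_smul_eq_zero
      (hD.sub (locallyIntegrable_const _)) fun ψ hψ hψc => ?_
    have i1 : Integrable fun x => ψ x • D x :=
      hD.integrable_smul_left_of_hasCompactSupport hψ.continuous hψc
    have i2 : Integrable fun x => ρ x • D x :=
      hD.integrable_smul_left_of_hasCompactSupport hρ.continuous hρc
    have i3 : Integrable ψ := hψ.continuous.integrable_of_hasCompactSupport hψc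
    have i4 : Integrable ρ := hρ.continuous.integrable_of_hasCompactSupport hρc
    obtain ⟨φ, h1, h2, h3⟩ := exists_primitive_of_integral_eq_zero
      (χ := fun x => ψ x - (∫ x, ψ x) * ρ x) (hψ.sub (contDiff_const.mul hρ))
      (hψc.sub hρc.mul_left) (by
        rw [integral_sub i3 (i4.const_mul _), integral_const_mul, hρ1]; ring)
    have h4 := h φ h1 h2
    rw [h3] at h4
    simp only [sub_smul, mul_smul] at h4
    have i5 : Integrable fun x => (∫ x, ψ x) • ρ x • D x := i2.smul (∫ x, ψ x)
    rw [integral_sub i1 i5, integral_smul] at h4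
    simp only [smul_sub]
    rw [integral_sub i1 (i3.smul_const _), integral_smul_const]
    exact h4
  filter_upwards [this] with x hx
  exact sub_eq_zero.1 hx

theorem locallyIntegrable_L2R (f : L2R) : LocallyIntegrable (f : ℝ → ℂ) :=
  (Lp.memLp f).locallyIntegrable (by norm_num)

theorem IsWeakDeriv.exists_primitive {f g : L2R} (h : IsWeakDeriv f g) :
    ∃ c : ℂ, ∀ᵐ x, f x = c + ∫ y in (0 : ℝ)..x, g y := by
  have hg := locallyIntegrable_L2R g
  have hf := locallyIntegrable_L2R f
  have hI : ∀ p q, IntervalIntegrable g volume p q := fun p q =>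
    (hg.integrableOn_isCompact isCompact_uIcc).intervalIntegrable
  have hF := intervalIntegral.continuous_primitive hI 0
  obtain ⟨c, hc⟩ := exists_ae_eq_const_of_integral_deriv_smul
    (D := fun x => f x - ∫ y in (0 : ℝ)..x, g y)
    (hf.sub hF.locallyIntegrable) (fun φ hφ hc => by
      have hd : Continuous (deriv φ) := hφ.continuous_deriv (by simp)
      have i1 : Integrable fun x => deriv φ x • ∫ y in (0 : ℝ)..x, g y :=
        (hd.smul hF).integrable_of_hasCompactSupport hc.deriv.smul_right
      simp only [smul_sub]
      rw [integral_sub (hf.integrable_smul_left_of_hasCompactSupport hd hc.deriv) i1,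
        integral_deriv_smul_primitive hg hφ hc, h φ hφ hc, sub_self])
  refine ⟨c, ?_⟩
  filter_upwards [hc] with x hx
  rw [← hx]; ring


/-! ### Piecewise constant approximation in the form domain -/

theorem integrable_norm_sq (f : L2R) : Integrable fun x => ‖f x‖ ^ 2 :=
  (memLp_two_iff_integrable_sq_norm (Lp.aestronglyMeasurable _)).1 (Lp.memLp f)

theorem norm_sq_eq_integral (f : L2R) : ‖f‖ ^ 2 = ∫ x, ‖f x‖ ^ 2 := by
  have h : ⟪f, f⟫_ℂ = ((∫ x, ‖f x‖ ^ 2 : ℝ) : ℂ) := by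
    rw [L2.inner_def, ← integral_complex_ofReal]
    congr 1 with x
    rw [inner_self_eq_norm_sq_to_K]
    simp
  apply Complex.ofReal_injective
  rw [← h, inner_self_eq_norm_sq_to_K]
  simp

/-- Cauchy–Schwarz against the constant one, read off from the nonnegativity of the variance `∫ (h -
t)²` with `t` the mean of `h`. -/
theorem sq_setIntegral_le {h : ℝ → ℝ} {a b : ℝ} (hab : a < b)
    (h1 : IntegrableOn h (Set.Ioc a b)) (h2 : IntegrableOn (fun x => h x ^ 2) (Set.Ioc a b)) :
    (∫ x in Set.Ioc a b, h x) ^ 2 ≤ (b - a) * ∫ x in Set.Ioc a b, h x ^ 2 := by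
  set A := ∫ x in Set.Ioc a b, h x with hA
  have hl : 0 < b - a := sub_pos.2 hab
  set t := A / (b - a) with ht
  have h0 : 0 ≤ ∫ x in Set.Ioc a b, (h x - t) ^ 2 := integral_nonneg fun x => sq_nonneg _
  have e : ∫ x in Set.Ioc a b, (h x - t) ^ 2
      = (∫ x in Set.Ioc a b, h x ^ 2) - 2 * t * A + t ^ 2 * (b - a) := by
    have : (fun x => (h x - t) ^ 2) = fun x => (h x ^ 2 - 2 * t * h x) + t ^ 2 := by
      ext x; ring
    have i1 : IntegrableOn (fun x => 2 * t * h x) (Set.Ioc a b) := h1.const_mul _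
    have i2 : IntegrableOn (fun x => h x ^ 2 - 2 * t * h x) (Set.Ioc a b) := h2.sub i1
    rw [this, integral_add i2 (by simp), integral_sub h2 i1, integral_const_mul]
    simp [hab.le, mul_comm, hA]
  rw [e] at h0
  have hAt : A = t * (b - a) := by rw [ht]; field_simp
  rw [hAt] at h0 ⊢
  nlinarith [mul_nonneg hl.le h0]

/-- The oscillation of a primitive over the cell is at most `∫ ‖g‖`; the distance to the average is
at most the oscillation, and Cauchy–Schwarz handles the square. Integrating this over the cell gives
a Poincaré inequality with a non-optimal constant, which is enough. -/
theorem IsWeakDeriv.norm_sub_average_sq_le {f g : L2R} (h : IsWeakDeriv f g) {a b : ℝ}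
    (hab : a < b) :
    ∀ᵐ x, x ∈ Set.Ioc a b → ‖f x - ((b - a : ℝ) : ℂ)⁻¹ * ∫ y in Set.Ioc a b, f y‖ ^ 2 ≤
      (b - a) * ∫ y in Set.Ioc a b, ‖g y‖ ^ 2 := by
  obtain ⟨c, hc⟩ := h.exists_primitive
  have hl : 0 < b - a := sub_pos.2 hab
  have hg := locallyIntegrable_L2R g
  have hI : ∀ p q, IntervalIntegrable g volume p q := fun p q =>
    (hg.integrableOn_isCompact isCompact_uIcc).intervalIntegrable
  have hfI : IntegrableOn f (Set.Ioc a b) :=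
    ((locallyIntegrable_L2R f).integrableOn_isCompact isCompact_Icc).mono_set
      Set.Ioc_subset_Icc_self
  have hgI : IntegrableOn g (Set.Ioc a b) :=
    (hg.integrableOn_isCompact isCompact_Icc).mono_set Set.Ioc_subset_Icc_self
  set G := ∫ y in Set.Ioc a b, ‖g y‖ with hG
  have hG2 : G ^ 2 ≤ (b - a) * ∫ y in Set.Ioc a b, ‖g y‖ ^ 2 :=
    sq_setIntegral_le hab hgI.norm (integrable_norm_sq g).integrableOn
  filter_upwards [hc] with x hx hxI
  have hosc : ∀ᵐ y, y ∈ Set.Ioc a b → ‖f x - f y‖ ≤ G := by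
    filter_upwards [hc] with y hy hyI
    rw [hx, hy, add_sub_add_left_eq_sub, intervalIntegral.integral_interval_sub_left (hI _ _)
      (hI _ _)]
    refine (intervalIntegral.norm_integral_le_integral_norm_uIoc).trans ?_
    refine setIntegral_mono_set hgI.norm (ae_of_all _ fun _ => norm_nonneg _)
      (LE.le.eventuallyLE ?_)
    intro z hz
    rw [Set.mem_uIoc] at hz
    rcases hz with hz | hz
    · exact ⟨hyI.1.trans hz.1, hz.2.trans hxI.2⟩
    · exact ⟨hxI.1.trans hz.1, hz.2.trans hyI.2⟩
  have h3 := norm_setIntegral_le_of_norm_le_const_ae' (by simp) hosc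
  rw [integral_sub (by simp) hfI] at h3
  simp only [setIntegral_const, Real.volume_real_Ioc_of_le hab.le] at h3
  have e : f x - ((b - a : ℝ) : ℂ)⁻¹ * ∫ y in Set.Ioc a b, f y
      = ((b - a : ℝ) : ℂ)⁻¹ * ((b - a) • f x - ∫ y in Set.Ioc a b, f y) := by
    have : ((b - a : ℝ) : ℂ) ≠ 0 := by exact_mod_cast hl.ne'
    rw [Complex.real_smul]
    field_simp
  rw [e, norm_mul, norm_inv, Complex.norm_real, Real.norm_of_nonneg hl.le]
  refine le_trans ?_ hG2
  refine pow_le_pow_left₀ (by positivity) ?_ 2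
  rw [inv_mul_le_iff₀ hl, mul_comm]
  exact h3

theorem IsWeakDeriv.setIntegral_norm_sub_average_sq_le {f g : L2R} (h : IsWeakDeriv f g)
    {a b : ℝ} (hab : a < b) :
    ∫ x in Set.Ioc a b, ‖f x - ((b - a : ℝ) : ℂ)⁻¹ * ∫ y in Set.Ioc a b, f y‖ ^ 2 ≤
      (b - a) ^ 2 * ∫ y in Set.Ioc a b, ‖g y‖ ^ 2 := by
  have h1 : ∀ᵐ x, x ∈ Set.Ioc a b →
      ‖(‖f x - ((b - a : ℝ) : ℂ)⁻¹ * ∫ y in Set.Ioc a b, f y‖ ^ 2 : ℝ)‖ ≤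
      (b - a) * ∫ y in Set.Ioc a b, ‖g y‖ ^ 2 := by
    filter_upwards [h.norm_sub_average_sq_le hab] with x hx hxI
    rw [Real.norm_of_nonneg (by positivity)]
    exact hx hxI
  have h2 := norm_setIntegral_le_of_norm_le_const_ae' (by simp) h1
  refine (Real.le_norm_self _).trans (h2.trans (le_of_eq ?_))
  rw [Real.volume_real_Ioc_of_le hab.le]; ring

/-- The step functions `∑ⱼ cⱼ 1_{(aⱼ, aⱼ₊₁]}`. -/
theorem coeFn_sum_indicator {a : ℕ → ℝ} (ha : Monotone a) {M : ℕ} (c : Fin M → ℂ) :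
    ∀ᵐ x, (∀ j : Fin M, x ∈ Set.Ioc (a j) (a (j + 1)) →
      (∑ i : Fin M, c i • indicatorConstLp 2 (measurableSet_Ioc (a := a i) (b := a (i + 1)))
        (by simp) (1 : ℂ) : L2R) x = c j) ∧
      (x ∉ Set.Ioc (a 0) (a M) →
      (∑ i : Fin M, c i • indicatorConstLp 2 (measurableSet_Ioc (a := a i) (b := a (i + 1)))
        (by simp) (1 : ℂ) : L2R) x = 0) := by
  set w : Fin M → L2R := fun i =>
    indicatorConstLp 2 (measurableSet_Ioc (a := a i) (b := a (i + 1))) (by simp) (1 : ℂ)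
  have h1 := Lp.coeFn_finsetSum Finset.univ (fun i => c i • w i)
  have h2 : ∀ᵐ x, ∀ i : Fin M, (c i • w i) x = c i * w i x := by
    rw [ae_all_iff]; intro i; exact Lp.coeFn_smul _ _
  have h3 : ∀ᵐ x, ∀ i : Fin M, w i x = (Set.Ioc (a i) (a (i + 1))).indicator (fun _ => 1) x := by
    rw [ae_all_iff]; intro i; exact indicatorConstLp_coeFn
  filter_upwards [h1, h2, h3] with x e1 e2 e3
  rw [e1]
  simp only [Finset.sum_apply, e2, e3]
  constructor
  · intro j hj
    rw [Finset.sum_eq_single j]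
    · simp [hj]
    · intro i _ hij
      have hd := ha.pairwise_disjoint_on_Ioc_succ (fun h => hij (Fin.ext h) : (i : ℕ) ≠ j)
      have : x ∉ Set.Ioc (a i) (a (i + 1)) := fun hi => Set.disjoint_left.1 hd hi hj
      simp [this]
    · simp
  · intro hx
    refine Finset.sum_eq_zero fun i _ => ?_
    have : x ∉ Set.Ioc (a i) (a (i + 1)) := fun hi =>
      hx ⟨(ha (Nat.zero_le _)).trans_lt hi.1, hi.2.trans (ha i.2)⟩
    simp [this]

/-- Inside `(-L, L]` the Poincaré inequality costs the squared cell length `(2L/M)²`; outside, `V ≥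
C⁻¹ Lˢ` makes `1 ≤ ε V`. The vectors `w j` and the constant `c` do not depend on `f`, so the
approximation is a linear operator of rank at most `M`. -/
theorem exists_finiteRank_approx {V : ℝ → ℝ} {s C : ℝ} (hs : 1 < s) (hC : 0 < C)
    (hV : ∀ᵐ x : ℝ, C⁻¹ * |x| ^ s ≤ V x) {L ε : ℝ} (hL : 0 < L) {M : ℕ} (hM : 0 < M)
    (h1 : (2 * L / M) ^ 2 ≤ ε) (h2 : C * L ^ (-s) ≤ ε) :
    ∃ (w : Fin M → L2R) (c : ℂ), ∀ f f' : L2R, InFormDomain V f f' →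
      ‖f - ∑ j, (c * ⟪w j, f⟫_ℂ) • w j‖ ^ 2 ≤ ε * (‖f'‖ ^ 2 + ∫ x, V x * ‖f x‖ ^ 2) := by
  have hM' : (0 : ℝ) < M := by exact_mod_cast hM
  set l := 2 * L / M with hl
  have hl0 : 0 < l := by positivity
  set a : ℕ → ℝ := fun j => -L + j * l with ha
  have hamono : Monotone a := by
    intro i j hij
    have : (i : ℝ) ≤ j := by exact_mod_cast hij
    simp only [ha]; gcongr
  have hstep : ∀ i : ℕ, a (i + 1) - a i = l := by intro i; simp only [ha]; push_cast; ring
  have hlt : ∀ i : ℕ, a i < a (i + 1) := fun i => by linarith [hstep i]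
  have ha0 : a 0 = -L := by simp [ha]
  have haM : a M = L := by simp only [ha, hl]; field_simp; ring
  let w : Fin M → L2R := fun i =>
    indicatorConstLp 2 (measurableSet_Ioc (a := a i) (b := a (i + 1))) (by simp) (1 : ℂ)
  refine ⟨w, (l : ℂ)⁻¹, fun f f' hf => ?_⟩
  have hε : 0 ≤ ε := (sq_nonneg _).trans h1
  set P : L2R := ∑ j, ((l : ℂ)⁻¹ * ⟪w j, f⟫_ℂ) • w j with hP
  have hPv := coeFn_sum_indicator hamono (M := M) fun j => (l : ℂ)⁻¹ * ⟪w j, f⟫_ℂ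
  have hw : ∀ j : Fin M, ⟪w j, f⟫_ℂ = ∫ y in Set.Ioc (a j) (a (j + 1)), f y := fun j =>
    L2.inner_indicatorConstLp_one _ _ _
  have hsub := Lp.coeFn_sub f P
  have hint := integrable_norm_sq (f - P)
  have hin := integrable_norm_sq f'
  have hpos : 0 ≤ᵐ[volume] fun x => V x * ‖f x‖ ^ 2 := by
    filter_upwards [hV] with x hx
    have : 0 ≤ V x := le_trans (by positivity) hx
    simp only [Pi.zero_apply]; positivity
  rw [norm_sq_eq_integral, ← integral_add_compl (measurableSet_Ioc (a := -L) (b := L)) hint, mul_add]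
  refine add_le_add ?_ ?_
  · have e1 : ∀ h : ℝ → ℝ, Integrable h → ∫ x in Set.Ioc (-L) L, h x
        = ∑ j : Fin M, ∫ x in Set.Ioc (a j) (a (j + 1)), h x := by
      intro h hh
      rw [← intervalIntegral.integral_of_le (by linarith), ← ha0]
      nth_rw 1 [← haM]
      rw [← intervalIntegral.sum_integral_adjacent_intervals
        (fun k _ => hh.intervalIntegrable), Finset.sum_range]
      exact Finset.sum_congr rfl fun j _ => intervalIntegral.integral_of_le (hlt j).le
    have e2 : ∀ j : Fin M, ∫ x in Set.Ioc (a j) (a (j + 1)), ‖(f - P) x‖ ^ 2 ≤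
        ε * ∫ x in Set.Ioc (a j) (a (j + 1)), ‖f' x‖ ^ 2 := by
      intro j
      have := hf.1.setIntegral_norm_sub_average_sq_le (hlt j)
      rw [hstep j] at this
      refine le_trans (le_of_eq ?_) (this.trans (mul_le_mul_of_nonneg_right h1
        (integral_nonneg fun _ => by positivity)))
      refine setIntegral_congr_ae measurableSet_Ioc ?_
      filter_upwards [hsub, hPv] with x hx1 hx2 hx3
      rw [hx1, Pi.sub_apply, ← hw j, hx2.1 j hx3]
    rw [e1 _ hint]
    refine (Finset.sum_le_sum fun j _ => e2 j).trans ?_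
    rw [← Finset.mul_sum, ← e1 _ hin, norm_sq_eq_integral f']
    exact mul_le_mul_of_nonneg_left
      (setIntegral_le_integral hin (ae_of_all _ fun _ => by positivity)) hε
  · refine le_trans (setIntegral_mono_on_ae (g := fun x => ε * (V x * ‖f x‖ ^ 2))
      hint.integrableOn (hf.2.const_mul ε).integrableOn measurableSet_Ioc.compl ?_) ?_
    · filter_upwards [hsub, hPv, hV] with x hx1 hx2 hx3 hx4
      have hx5 : P x = 0 := hx2.2 (by rw [ha0, haM]; exact hx4)
      rw [hx1, Pi.sub_apply, hx5, sub_zero, ← mul_assoc]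
      refine le_mul_of_one_le_left (by positivity) ?_
      have hxL : L ≤ |x| := by
        by_contra hn
        rw [not_le, abs_lt] at hn
        exact hx4 ⟨hn.1, hn.2.le⟩
      have : L ^ s ≤ |x| ^ s := Real.rpow_le_rpow hL.le hxL (by linarith)
      have h3 : C⁻¹ * L ^ s ≤ V x := le_trans (by gcongr) hx3
      calc (1 : ℝ) = (C * L ^ (-s)) * (C⁻¹ * L ^ s) := by
            rw [Real.rpow_neg hL.le]; field_simp
        _ ≤ ε * V x := by gcongr
    · rw [integral_const_mul]
      exact mul_le_mul_of_nonneg_left (setIntegral_le_integral hf.2 hpos) hε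

/-! ### The eigenvalues -/

/-- The weak equation is tested against `f` itself. -/
theorem SchrodingerGraph.exists_energy {V : ℝ → ℝ} {f g : L2R} (h : SchrodingerGraph V f g) :
    ∃ f' : L2R, InFormDomain V f f' ∧
      ((‖f'‖ ^ 2 + ∫ x, V x * ‖f x‖ ^ 2 : ℝ) : ℂ) = ⟪f, g⟫_ℂ := by
  obtain ⟨f', hf, h⟩ := h
  refine ⟨f', hf, ?_⟩
  rw [← h f f' hf, Complex.ofReal_add, inner_self_eq_norm_sq_to_K, ← integral_complex_ofReal]
  congr 1
  · simp
  · congr 1 with x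
    rw [← Complex.normSq_eq_conj_mul_self, Complex.normSq_eq_norm_sq]
    push_cast; rfl

section Spectral

variable {V : ℝ → ℝ} {s C : ℝ} {u : HilbertBasis ℕ ℂ L2R} {lam : ℕ → ℝ}

theorem IsSpectralDecomposition.graph_sum (h : IsSpectralDecomposition V u lam) (F : Finset ℕ)
    (c : ℕ → ℂ) :
    SchrodingerGraph V (∑ n ∈ F, c n • u n) (∑ n ∈ F, (c n * lam n) • u n) := by
  rw [h]
  intro m
  simp only [inner_sum, inner_smul_right, orthonormal_iff_ite.1 u.orthonormal, mul_ite, mul_one,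
    mul_zero, Finset.sum_ite_eq]
  split_ifs <;> ring

theorem IsSpectralDecomposition.exists_energy_sum (h : IsSpectralDecomposition V u lam)
    (F : Finset ℕ) (c : ℕ → ℂ) :
    ∃ f' : L2R, InFormDomain V (∑ n ∈ F, c n • u n) f' ∧
      ‖f'‖ ^ 2 + ∫ x, V x * ‖(∑ n ∈ F, c n • u n : L2R) x‖ ^ 2 = ∑ n ∈ F, lam n * ‖c n‖ ^ 2 := by
  obtain ⟨f', hf, he⟩ := (h.graph_sum F c).exists_energy
  refine ⟨f', hf, ?_⟩
  apply Complex.ofReal_injective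
  rw [he, u.orthonormal.inner_sum, Complex.ofReal_sum]
  refine Finset.sum_congr rfl fun n _ => ?_
  rw [← mul_assoc, ← Complex.normSq_eq_conj_mul_self, Complex.normSq_eq_norm_sq]
  push_cast; ring

theorem norm_sq_sum_basis (F : Finset ℕ) (c : ℕ → ℂ) :
    ‖∑ n ∈ F, c n • u n‖ ^ 2 = ∑ n ∈ F, ‖c n‖ ^ 2 := by
  apply Complex.ofReal_injective
  have h := u.orthonormal.inner_sum c c F
  rw [inner_self_eq_norm_sq_to_K] at h
  rw [Complex.ofReal_sum]
  refine Eq.trans (by simp) (h.trans (Finset.sum_congr rfl fun n _ => ?_))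
  rw [← Complex.normSq_eq_conj_mul_self, Complex.normSq_eq_norm_sq]

/-- The eigenvalue is the energy of `u n`. If it vanished, so would the potential part, and `V > 0`
almost everywhere would force `u n = 0`. -/
theorem IsSpectralDecomposition.lam_pos (h : IsSpectralDecomposition V u lam) (hC : 0 < C)
    (hV : ∀ᵐ x : ℝ, C⁻¹ * |x| ^ s ≤ V x) (n : ℕ) : 0 < lam n := by
  obtain ⟨f', hf, he⟩ := h.exists_energy_sum {n} fun _ => 1
  simp only [Finset.sum_singleton, one_smul, norm_one, one_pow, mul_one] at he hf
  have hVpos : ∀ᵐ x : ℝ, 0 < V x := by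
    have h0 : ∀ᵐ x : ℝ, x ≠ 0 := by simp [ae_iff]
    filter_upwards [hV, h0] with x hx hx0
    exact lt_of_lt_of_le (by positivity) hx
  have hpos : 0 ≤ᵐ[volume] fun x => V x * ‖u n x‖ ^ 2 := by
    filter_upwards [hVpos] with x hx
    simp only [Pi.zero_apply]; positivity
  have h1 : 0 ≤ ∫ x, V x * ‖u n x‖ ^ 2 := integral_nonneg_of_ae hpos
  refine lt_of_le_of_ne (he ▸ by positivity) fun h0 => ?_
  have h2 : ∫ x, V x * ‖u n x‖ ^ 2 = 0 := by nlinarith [sq_nonneg ‖f'‖]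
  rw [integral_eq_zero_iff_of_nonneg_ae hpos hf.2] at h2
  have h3 : u n = 0 := by
    rw [Lp.eq_zero_iff_ae_eq_zero]
    filter_upwards [h2, hVpos] with x hx hx'
    simpa [hx'.ne'] using hx
  exact u.orthonormal.ne_zero n h3

/-- With more than `M` eigenvectors, the `M` conditions `⟪w j, ·⟫ = 0` leave a nonzero combination
`f` on which the finite-rank part vanishes. Then `‖f‖² ≤ ε · energy ≤ ε E ‖f‖²`, which is impossible
for `ε E < 1`. -/
theorem IsSpectralDecomposition.card_le_of_finiteRank (h : IsSpectralDecomposition V u lam)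
    {M : ℕ} {ε E : ℝ} {w : Fin M → L2R} {c : ℂ}
    (hw : ∀ f f' : L2R, InFormDomain V f f' →
      ‖f - ∑ j, (c * ⟪w j, f⟫_ℂ) • w j‖ ^ 2 ≤ ε * (‖f'‖ ^ 2 + ∫ x, V x * ‖f x‖ ^ 2))
    (hε : 0 ≤ ε) (hE : ε * E < 1) {F : Finset ℕ} (hF : ∀ n ∈ F, lam n ≤ E) : F.card ≤ M := by
  by_contra hcard
  rw [not_le] at hcard
  have hnd : ¬ LinearIndependent ℂ (fun n : F => fun j : Fin M => ⟪w j, u n⟫_ℂ) := by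
    intro hli
    have := hli.fintype_card_le_finrank
    simp only [Fintype.card_coe, Module.finrank_fintype_fun_eq_card, Fintype.card_fin] at this
    omega
  rw [Fintype.not_linearIndependent_iff] at hnd
  obtain ⟨d, hd, n₀, hn₀⟩ := hnd
  let d' : ℕ → ℂ := fun n => if hn : n ∈ F then d ⟨n, hn⟩ else 0
  have hd' : ∀ n : F, d' n = d n := fun n => by simp [d']
  obtain ⟨f', hf, he⟩ := h.exists_energy_sum F d'
  have hz : ∀ j, ⟪w j, ∑ n ∈ F, d' n • u n⟫_ℂ = 0 := by
    intro j
    rw [inner_sum, ← Finset.sum_coe_sort]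
    have := congrFun hd j
    simpa [inner_smul_right, hd'] using this
  have h1 := hw _ _ hf
  simp only [hz, mul_zero, zero_smul, Finset.sum_const_zero, sub_zero] at h1
  rw [he, norm_sq_sum_basis] at h1
  have h2 : ∑ n ∈ F, lam n * ‖d' n‖ ^ 2 ≤ E * ∑ n ∈ F, ‖d' n‖ ^ 2 := by
    rw [Finset.mul_sum]
    exact Finset.sum_le_sum fun n hn => mul_le_mul_of_nonneg_right (hF n hn) (by positivity)
  have h3 : 0 < ∑ n ∈ F, ‖d' n‖ ^ 2 := by
    refine Finset.sum_pos' (fun _ _ => by positivity) ⟨n₀, n₀.2, ?_⟩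
    rw [hd']
    have := norm_pos_iff.2 hn₀
    positivity
  nlinarith [mul_le_mul_of_nonneg_left h2 hε]

theorem IsSpectralDecomposition.card_le (h : IsSpectralDecomposition V u lam) (hs : 1 < s)
    (hC : 0 < C) (hV : ∀ᵐ x : ℝ, C⁻¹ * |x| ^ s ≤ V x) :
    ∃ A : ℝ, 0 ≤ A ∧ ∀ E : ℝ, 0 < E → ∀ F : Finset ℕ, (∀ n ∈ F, lam n ≤ E) →
      (F.card : ℝ) ≤ 1 + A * E ^ (1 / s + 1 / 2) := by
  refine ⟨(2 * (2 * C) ^ (1 / s) * 2 ^ (1 / 2 : ℝ)), by positivity, fun E hE F hF => ?_⟩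
  -- The target is `ε = 1/(2E)`, so that `ε E = 1/2`. This `L` solves `C L^(-s) = ε`, and `B` is the
  -- number of cells of length `√ε` that fill `(-L, L]`. Hence `B` is a constant times `E^(1/s)
  -- E^(1/2)`; the additive `1` in the bound pays for rounding up.
  set L := (2 * C * E) ^ (1 / s) with hL
  have hL0 : 0 < L := by positivity
  set B := 2 * L * (2 * E) ^ (1 / 2 : ℝ) with hB
  have hB0 : 0 < B := by positivity
  have hM : 0 < ⌈B⌉₊ := Nat.ceil_pos.2 hB0
  have hLs : L ^ (-s) = (2 * C * E)⁻¹ := by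
    rw [hL, ← Real.rpow_mul (by positivity), ← Real.rpow_neg_one]
    congr 1; field_simp
  obtain ⟨w, c, hw⟩ := exists_finiteRank_approx hs hC hV hL0 (ε := (2 * E)⁻¹) hM (by
    have hh : ((2 * E) ^ (1 / 2 : ℝ)) ^ 2 = 2 * E := by
      rw [← Real.rpow_natCast, ← Real.rpow_mul (by positivity)]; norm_num
    calc (2 * L / ⌈B⌉₊) ^ 2 ≤ (2 * L / B) ^ 2 := by
          gcongr; exact Nat.le_ceil B
      _ = (((2 * E) ^ (1 / 2 : ℝ)) ^ 2)⁻¹ := by rw [hB]; field_simp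
      _ ≤ _ := by rw [hh]) (by rw [hLs]; apply le_of_eq; field_simp)
  have h1 := h.card_le_of_finiteRank hw (by positivity) (E := E) (by
    rw [mul_inv]; field_simp; norm_num) hF
  calc (F.card : ℝ) ≤ ⌈B⌉₊ := by exact_mod_cast h1
    _ ≤ 1 + B := by linarith [Nat.ceil_lt_add_one hB0.le]
    _ = _ := by
      rw [hB, hL, Real.mul_rpow (by positivity) hE.le, Real.mul_rpow (by positivity) hE.le,
        Real.rpow_add hE]
      ring

end Spectral

/-- A counting bound `#{n : λₙ ≤ E} ≤ 1 + A Eᵃ` makes `∑ₙ λₙ⁻ᵖ` finite for `p > a`. -/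
theorem summable_rpow_neg_of_card_le {lam : ℕ → ℝ} {A a p : ℝ} (hA : 0 ≤ A)
    (ha : 0 ≤ a) (hlam : ∀ n, 0 < lam n)
    (h : ∀ E : ℝ, 0 < E → ∀ F : Finset ℕ, (∀ n ∈ F, lam n ≤ E) → (F.card : ℝ) ≤ 1 + A * E ^ a)
    (hp : a < p) : Summable fun n => lam n ^ (-p) := by
  have hp0 : 0 < p := ha.trans_lt hp
  have hfin : {n | lam n ≤ 1}.Finite := by
    by_contra hinf
    obtain ⟨F, hF, hc⟩ := Set.Infinite.exists_subset_card_eq hinf (⌈1 + A⌉₊ + 1)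
    have h1 := h 1 one_pos F fun n hn => hF hn
    rw [hc] at h1
    push_cast at h1
    simp only [Real.one_rpow, mul_one] at h1
    linarith [Nat.le_ceil (1 + A)]
  -- the geometric majorant
  have hgeo : Summable fun j : ℕ => ((2 : ℝ) ^ (-p)) ^ j + A * ((2 : ℝ) ^ (a - p)) ^ j := by
    refine (summable_geometric_of_lt_one (by positivity) ?_).add
      ((summable_geometric_of_lt_one (by positivity) ?_).mul_left A)
    · exact Real.rpow_lt_one_of_one_lt_of_neg (by norm_num) (by linarith)
    · exact Real.rpow_lt_one_of_one_lt_of_neg (by norm_num) (by linarith)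
  -- Discarding the finitely many values at most `1` leaves shells `λ ≤ 2^j ≤ 2 λ` with natural `j`.
  -- Shell `j` holds at most `1 + A 2^(ja)` indices, each contributing at most `2^p 2^(-jp)`.
  rw [← hfin.summable_compl_iff]
  refine summable_of_sum_le (c := 2 ^ p * ∑' j : ℕ, (((2 : ℝ) ^ (-p)) ^ j +
    A * ((2 : ℝ) ^ (a - p)) ^ j)) (fun n => (Real.rpow_pos_of_pos (hlam n) _).le) fun F => ?_
  -- each large `λ` is at most twice a power of two above it
  have hterm : ∀ n : ↥{n | lam n ≤ 1}ᶜ, ∃ j : ℕ, lam n ≤ 2 ^ j ∧ (2 : ℝ) ^ j ≤ 2 * lam n := by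
    intro n
    have hn : 1 < lam n := not_le.1 n.2
    obtain ⟨j, h1, h2⟩ := exists_nat_pow_near hn.le (by norm_num : (1 : ℝ) < 2)
    exact ⟨j + 1, h2.le, by rw [pow_succ]; linarith⟩
  choose J hJ1 hJ2 using hterm
  classical
  calc ∑ n ∈ F, lam n ^ (-p)
      ≤ ∑ n ∈ F, 2 ^ p * ((2 : ℝ) ^ (-p)) ^ J n := by
        refine Finset.sum_le_sum fun n _ => ?_
        have h0 := hlam n
        rw [← Real.rpow_natCast, ← Real.rpow_mul (by norm_num), mul_comm (-p),
          Real.rpow_mul (by norm_num), Real.rpow_natCast, Real.rpow_neg h0.le,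
          Real.rpow_neg (by positivity)]
        have : ((2 : ℝ) ^ J n) ^ p ≤ 2 ^ p * lam n ^ p := by
          rw [← Real.mul_rpow (by norm_num) h0.le]
          exact Real.rpow_le_rpow (by positivity) (hJ2 n) hp0.le
        rw [← div_eq_mul_inv, inv_le_comm₀ (by positivity) (by positivity), inv_div,
          div_le_iff₀ (by positivity), mul_comm]
        exact this
    _ = 2 ^ p * ∑ n ∈ F, ((2 : ℝ) ^ (-p)) ^ J n := by rw [Finset.mul_sum]
    _ = 2 ^ p * ∑ j ∈ F.image J, ∑ n ∈ F with J n = j, ((2 : ℝ) ^ (-p)) ^ j := by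
        congr 1
        rw [← Finset.sum_fiberwise_of_maps_to (fun n hn => Finset.mem_image_of_mem J hn)]
        refine Finset.sum_congr rfl fun j _ => Finset.sum_congr rfl fun n hn => ?_
        rw [(Finset.mem_filter.1 hn).2]
    _ ≤ 2 ^ p * ∑ j ∈ F.image J, (((2 : ℝ) ^ (-p)) ^ j + A * ((2 : ℝ) ^ (a - p)) ^ j) := by
        gcongr with j _
        rw [Finset.sum_const, nsmul_eq_mul]
        have hc := h (2 ^ j) (by positivity)
          (({n ∈ F | J n = j} : Finset _).map (Function.Embedding.subtype _)) (by
            intro n hn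
            rw [Finset.mem_map] at hn
            obtain ⟨m, hm, rfl⟩ := hn
            rw [← (Finset.mem_filter.1 hm).2]
            exact hJ1 m)
        rw [Finset.card_map] at hc
        refine (mul_le_mul_of_nonneg_right hc (by positivity)).trans (le_of_eq ?_)
        rw [add_mul, one_mul, sub_eq_add_neg, Real.rpow_add (by norm_num), mul_pow, mul_assoc]
        congr 3
        rw [← Real.rpow_natCast, ← Real.rpow_natCast, ← Real.rpow_mul (by norm_num),
          ← Real.rpow_mul (by norm_num), mul_comm]
    _ ≤ _ := by
        gcongr
        exact hgeo.sum_le_tsum _ fun _ _ => by positivity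

/-! ### Compact self-adjoint operators -/

/-- Distinct members lie at distance `√2`, so the balls of radius `1/2` around them are disjoint. -/
theorem countable_of_orthonormal {E ι : Type*} [NormedAddCommGroup E] [InnerProductSpace ℂ E]
    [TopologicalSpace.SeparableSpace E] {v : ι → E} (hv : Orthonormal ℂ v) : Countable ι := by
  refine Pairwise.countable_of_isOpen_disjoint (s := fun i => Metric.ball (v i) (1 / 2)) ?_
    (fun i => Metric.isOpen_ball) (fun i => ⟨v i, Metric.mem_ball_self (by norm_num)⟩)
  intro i j hij
  refine Metric.ball_disjoint_ball ?_
  have h : ‖v i - v j‖ ^ 2 = 2 := by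
    rw [@norm_sub_sq ℂ, hv.1, hv.1, hv.2 hij]; norm_num
  rw [dist_eq_norm]
  nlinarith [norm_nonneg (v i - v j)]

/-- Orthonormal bases of the eigenspaces, the kernel included, combine to a basis of `E` because the
eigenspaces have trivial common orthogonal complement. Separability makes the index set countable
and infinite dimension makes it infinite, so it can be relabelled by `ℕ`. -/
theorem exists_eigenbasis {E : Type*} [NormedAddCommGroup E] [InnerProductSpace ℂ E]
    [CompleteSpace E] [TopologicalSpace.SeparableSpace E] (hE : ¬ FiniteDimensional ℂ E)
    {T : E →L[ℂ] E} (hT : IsCompactOperator T) (hT' : T.IsSymmetric) :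
    ∃ (b : HilbertBasis ℕ ℂ E) (κ : ℕ → ℂ), ∀ n, T (b n) = κ n • b n := by
  have hsp := ContinuousLinearMap.orthogonalComplement_iSup_eigenspaces_eq_bot hT hT'
  let G : ℂ → Submodule ℂ E := fun μ => Module.End.eigenspace (T : Module.End ℂ E) μ
  have hclosed : ∀ μ, CompleteSpace (G μ) := by
    intro μ
    have : (G μ : Set E) = {x | T x = μ • x} := by
      ext x; exact Module.End.mem_eigenspace_iff
    have hc : IsClosed (G μ : Set E) := by
      rw [this]; exact isClosed_eq T.continuous (continuous_const_smul μ)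
    exact hc.completeSpace_coe
  choose w b hb using fun μ => exists_hilbertBasis ℂ (G μ)
  have hG := hT'.orthogonalFamily_eigenspaces
  let v : (Σ μ, w μ) → E := fun a => (b a.1 a.2 : E)
  have hv : Orthonormal ℂ v := hG.orthonormal_sigma_orthonormal fun μ => (b μ).orthonormal
  have hbot : (Submodule.span ℂ (Set.range v))ᗮ = ⊥ := by
    rw [eq_bot_iff, ← hsp]
    intro x hx
    rw [Submodule.mem_orthogonal]
    have : (⨆ μ, G μ) ≤ (Submodule.span ℂ {x})ᗮ := by
      refine iSup_le fun μ y hy => ?_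
      rw [Submodule.mem_orthogonal_singleton_iff_inner_right]
      have hd := (b μ).dense_span
      have hle : (⊤ : Submodule ℂ (G μ)) ≤
          LinearMap.ker ((innerSL ℂ x).comp (G μ).subtypeL).toLinearMap := by
        rw [← hd]
        refine Submodule.topologicalClosure_minimal _ ?_
          (ContinuousLinearMap.isClosed_ker ((innerSL ℂ x).comp (G μ).subtypeL))
        rw [Submodule.span_le]
        rintro _ ⟨i, rfl⟩
        have h1 : ⟪v ⟨μ, i⟩, x⟫_ℂ = 0 :=
          (Submodule.mem_orthogonal _ _).1 hx _ (Submodule.subset_span ⟨⟨μ, i⟩, rfl⟩)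
        exact inner_eq_zero_symm.1 h1
      exact hle (Submodule.mem_top : (⟨y, hy⟩ : G μ) ∈ ⊤)
    intro y hy
    exact inner_eq_zero_symm.1
      ((Submodule.mem_orthogonal_singleton_iff_inner_right).1 (this hy))
  let B := HilbertBasis.mkOfOrthogonalEqBot hv hbot
  have hBv : ⇑B = v := HilbertBasis.coe_mkOfOrthogonalEqBot hv hbot
  have hcount : Countable (Σ μ, w μ) := countable_of_orthonormal hv
  have hinf : Infinite (Σ μ, w μ) := by
    by_contra hfin
    rw [not_infinite_iff_finite] at hfin
    have := Fintype.ofFinite (Σ μ, w μ)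
    exact hE (B.toOrthonormalBasis.toBasis.finiteDimensional_of_finite)
  obtain ⟨e⟩ : Nonempty (ℕ ≃ Σ μ, w μ) := ⟨(nonempty_denumerable _).some.eqv.symm⟩
  have hve : Orthonormal ℂ (v ∘ e) := hv.comp e e.injective
  have hbot' : (Submodule.span ℂ (Set.range (v ∘ e)))ᗮ = ⊥ := by
    rw [e.surjective.range_comp, hbot]
  refine ⟨HilbertBasis.mkOfOrthogonalEqBot hve hbot', fun n => (e n).1, fun n => ?_⟩
  rw [HilbertBasis.coe_mkOfOrthogonalEqBot]
  exact Module.End.mem_eigenspace_iff.1 (b (e n).1 (e n).2).2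

theorem not_finiteDimensional_L2R : ¬ FiniteDimensional ℂ L2R := by
  intro hfin
  let v : ℕ → L2R := fun n =>
    indicatorConstLp 2 (measurableSet_Ioc (a := (n : ℝ)) (b := n + 1)) (by simp) (1 : ℂ)
  have hv : Orthonormal ℂ v := by
    rw [orthonormal_iff_ite]
    intro i j
    have h1 : ⟪v i, v j⟫_ℂ = ∫ x in Set.Ioc (i : ℝ) (i + 1), v j x :=
      L2.inner_indicatorConstLp_one _ _ _
    have h2 : ∫ x in Set.Ioc (i : ℝ) (i + 1), v j x = ∫ x in Set.Ioc (i : ℝ) (i + 1),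
        (Set.Ioc (j : ℝ) (j + 1)).indicator (fun _ => (1 : ℂ)) x :=
      integral_congr_ae (ae_restrict_of_ae indicatorConstLp_coeFn)
    rw [h1, h2, setIntegral_indicator measurableSet_Ioc]
    split_ifs with hij
    · subst hij; simp
    · have hd : Disjoint (Set.Ioc (i : ℝ) (i + 1)) (Set.Ioc (j : ℝ) (j + 1)) := by
        have := (Nat.mono_cast (α := ℝ)).pairwise_disjoint_on_Ioc_succ hij
        simpa using this
      rw [hd.inter_eq]; simp
  exact not_finite_iff_infinite.2 inferInstance hv.linearIndependent.finite

/-! ### The form domain as a Hilbert space and the resolvent -/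

/-- Pairing with a test function is an `L²` inner product. This makes the weak derivative relation a
closed linear condition. -/
theorem continuous_integral_smul {φ : ℝ → ℝ} (hφ : Continuous φ) (hc : HasCompactSupport φ) :
    ∃ ℓ : L2R →L[ℂ] ℂ, ∀ f : L2R, ℓ f = ∫ x, φ x • f x := by
  have hm : MemLp (fun x => (φ x : ℂ)) 2 (volume : Measure ℝ) :=
    (Complex.continuous_ofReal.comp hφ).memLp_of_hasCompactSupport
      (hc.comp_left (g := fun x : ℝ => (x : ℂ)) (by simp))
  refine ⟨innerSL ℂ hm.toLp, fun f => ?_⟩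
  rw [innerSL_apply_apply, L2.inner_def]
  refine integral_congr_ae ?_
  filter_upwards [hm.coeFn_toLp] with x hx
  rw [hx, RCLike.inner_apply, Complex.conj_ofReal, Complex.real_smul, mul_comm]

theorem isWeakDeriv_zero : IsWeakDeriv 0 0 := by
  intro φ _ _
  have h : ∀ ψ : ℝ → ℝ, ∫ x, ψ x • (0 : L2R) x = 0 := fun ψ => by
    rw [← integral_zero ℝ ℂ (μ := volume)]
    refine integral_congr_ae ?_
    filter_upwards [Lp.coeFn_zero ℂ 2 (volume : Measure ℝ)] with x hx
    simp
  rw [h, h, neg_zero]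

theorem isWeakDeriv_iff {f g : L2R} : IsWeakDeriv f g ↔
    ∀ φ : ℝ → ℝ, ContDiff ℝ (⊤ : ℕ∞) φ → HasCompactSupport φ →
      (∫ x, deriv φ x • f x) + ∫ x, φ x • g x = 0 :=
  forall₃_congr fun _ _ _ => eq_neg_iff_add_eq_zero

/-- The triples `(f, f', √V f)` with `f` in the form domain. -/
def formSpace (V : ℝ → ℝ) : Submodule ℂ (PiLp 2 fun _ : Fin 3 => L2R) where
  carrier := {x | IsWeakDeriv (x 0) (x 1) ∧ ∀ᵐ y, x 2 y = (√(V y) : ℂ) * x 0 y}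
  zero_mem' := by
    refine ⟨isWeakDeriv_zero, ?_⟩
    filter_upwards [Lp.coeFn_zero ℂ 2 (volume : Measure ℝ)] with y hy
    simp
  add_mem' := by
    rintro a b ⟨ha, ha'⟩ ⟨hb, hb'⟩
    refine ⟨?_, ?_⟩
    · rw [isWeakDeriv_iff] at ha hb ⊢
      intro φ hφ hc
      obtain ⟨ℓ, hℓ⟩ := continuous_integral_smul hφ.continuous hc
      obtain ⟨ℓ', hℓ'⟩ := continuous_integral_smul (hφ.continuous_deriv (by simp)) hc.deriv
      have h1 := ha φ hφ hc
      have h2 := hb φ hφ hc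
      rw [← hℓ, ← hℓ'] at h1 h2 ⊢
      simp only [PiLp.add_apply, map_add]
      linear_combination h1 + h2
    · filter_upwards [ha', hb', Lp.coeFn_add (a 2) (b 2), Lp.coeFn_add (a 0) (b 0)]
        with y h1 h2 h3 h4
      simp only [PiLp.add_apply, Pi.add_apply] at h3 h4 ⊢
      rw [h3, h4, h1, h2]; ring
  smul_mem' := by
    rintro c a ⟨ha, ha'⟩
    refine ⟨?_, ?_⟩
    · rw [isWeakDeriv_iff] at ha ⊢
      intro φ hφ hc
      obtain ⟨ℓ, hℓ⟩ := continuous_integral_smul hφ.continuous hc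
      obtain ⟨ℓ', hℓ'⟩ := continuous_integral_smul (hφ.continuous_deriv (by simp)) hc.deriv
      have h1 := ha φ hφ hc
      rw [← hℓ, ← hℓ'] at h1 ⊢
      simp only [PiLp.smul_apply, map_smul, smul_eq_mul]
      linear_combination c * h1
    · filter_upwards [ha', Lp.coeFn_smul c (a 2), Lp.coeFn_smul c (a 0)] with y h1 h3 h4
      simp only [PiLp.smul_apply, Pi.smul_apply, smul_eq_mul] at h3 h4 ⊢
      rw [h3, h4, h1]; ring

/-- Even for unbounded `m` the multiplication operator has closed graph: an `L²` convergent sequence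
of pairs has a subsequence converging almost everywhere in both components, extracted one component
after the other. -/
theorem isClosed_ae_eq_mul (m : ℝ → ℂ) :
    IsClosed {x : L2R × L2R | ∀ᵐ y, x.2 y = m y * x.1 y} := by
  refine isClosed_of_closure_subset fun x hx => ?_
  obtain ⟨a, ha, hax⟩ := mem_closure_iff_seq_limit.1 hx
  have h1 : Tendsto (fun n => (a n).1) atTop (𝓝 x.1) := (continuous_fst.tendsto _).comp hax
  have h2 : Tendsto (fun n => (a n).2) atTop (𝓝 x.2) := (continuous_snd.tendsto _).comp hax
  obtain ⟨n₁, hn₁, h3⟩ := (tendstoInMeasure_of_tendsto_Lp h1).exists_seq_tendsto_ae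
  obtain ⟨n₂, hn₂, h4⟩ := (tendstoInMeasure_of_tendsto_Lp
    (h2.comp hn₁.tendsto_atTop)).exists_seq_tendsto_ae
  have h5 : ∀ᵐ y, ∀ n, (a n).2 y = m y * (a n).1 y := ae_all_iff.2 fun n => ha n
  filter_upwards [h3, h4, h5] with y e3 e4 e5
  have e6 := (e3.comp hn₂.tendsto_atTop).const_mul (m y)
  refine tendsto_nhds_unique e4 (e6.congr fun n => ?_)
  simp [e5]

theorem isClosed_formSpace (V : ℝ → ℝ) : IsClosed (formSpace V : Set (PiLp 2 fun _ : Fin 3 => L2R)) := by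
  have hp : ∀ i : Fin 3, Continuous fun x : PiLp 2 fun _ : Fin 3 => L2R => x i := fun i =>
    PiLp.continuous_apply 2 _ i
  have : (formSpace V : Set (PiLp 2 fun _ : Fin 3 => L2R)) =
      {x | IsWeakDeriv (x 0) (x 1)} ∩
      (fun x : PiLp 2 fun _ : Fin 3 => L2R => (x 0, x 2)) ⁻¹'
        {x : L2R × L2R | ∀ᵐ y, x.2 y = (√(V y) : ℂ) * x.1 y} := rfl
  rw [this]
  refine IsClosed.inter ?_ ((isClosed_ae_eq_mul _).preimage ((hp 0).prodMk (hp 2)))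
  simp only [isWeakDeriv_iff, Set.ofPred_forall]
  refine isClosed_iInter fun φ => isClosed_iInter fun hφ => isClosed_iInter fun hc => ?_
  obtain ⟨ℓ, hℓ⟩ := continuous_integral_smul hφ.continuous hc
  obtain ⟨ℓ', hℓ'⟩ := continuous_integral_smul (hφ.continuous_deriv (by simp)) hc.deriv
  simp only [← hℓ, ← hℓ']
  exact isClosed_eq ((ℓ'.continuous.comp (hp 0)).add (ℓ.continuous.comp (hp 1))) continuous_const

instance (V : ℝ → ℝ) : CompleteSpace (formSpace V) := (isClosed_formSpace V).completeSpace_coe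

/-- The embedding of the form domain in `L²`. -/
def formEmbedding (V : ℝ → ℝ) : formSpace V →L[ℂ] L2R :=
  (PiLp.proj 2 (fun _ : Fin 3 => L2R) 0 : _ →L[ℂ] L2R).comp (formSpace V).subtypeL

theorem formEmbedding_apply (V : ℝ → ℝ) (x : formSpace V) : formEmbedding V x = x.1 0 := rfl

section

variable {V : ℝ → ℝ} (hVm : AEStronglyMeasurable V volume) (hV0 : ∀ᵐ x, 0 ≤ V x)

theorem formSpace_inFormDomain (hV0 : ∀ᵐ x, 0 ≤ V x) (x : formSpace V) :
    InFormDomain V (x.1 0) (x.1 1) := by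
  refine ⟨x.2.1, ?_⟩
  refine (integrable_norm_sq (x.1 2)).congr ?_
  filter_upwards [x.2.2, hV0] with y hy h0
  rw [hy, norm_mul, mul_pow, Complex.norm_real, Real.norm_of_nonneg (Real.sqrt_nonneg _),
    Real.sq_sqrt h0]

include hVm hV0 in
theorem InFormDomain.exists_formSpace {f f' : L2R} (h : InFormDomain V f f') :
    ∃ x : formSpace V, x.1 0 = f ∧ x.1 1 = f' := by
  have hm : MemLp (fun y => (√(V y) : ℂ) * f y) 2 (volume : Measure ℝ) := by
    rw [memLp_two_iff_integrable_sq_norm]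
    · refine h.2.congr ?_
      filter_upwards [hV0] with y h0
      rw [norm_mul, mul_pow, Complex.norm_real, Real.norm_of_nonneg (Real.sqrt_nonneg _),
        Real.sq_sqrt h0]
    · exact (Complex.continuous_ofReal.comp_aestronglyMeasurable
        (Real.continuous_sqrt.comp_aestronglyMeasurable hVm)).mul (Lp.aestronglyMeasurable f)
  exact ⟨⟨WithLp.toLp 2 ![f, f', hm.toLp], h.1, hm.coeFn_toLp⟩, rfl, rfl⟩

/-- The coordinates of `formSpace` are chosen so that its inherited inner product is the form of `h
+ 1`. -/
theorem formSpace_inner (hV0 : ∀ᵐ x, 0 ≤ V x) (x y : formSpace V) :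
    ⟪x, y⟫_ℂ = ⟪x.1 0, y.1 0⟫_ℂ +
      (⟪x.1 1, y.1 1⟫_ℂ + ∫ t, (V t : ℂ) * (conj (x.1 0 t) * y.1 0 t)) := by
  rw [Submodule.coe_inner, PiLp.inner_apply, Fin.sum_univ_three, add_assoc]
  congr 2
  rw [L2.inner_def]
  refine integral_congr_ae ?_
  filter_upwards [x.2.2, y.2.2, hV0] with t h1 h2 h0
  rw [h1, h2, RCLike.inner_apply, map_mul, Complex.conj_ofReal]
  have : ((√(V t) : ℝ) : ℂ) * (√(V t) : ℝ) = V t := by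
    rw [← Complex.ofReal_mul, Real.mul_self_sqrt h0]
  linear_combination (conj (x.1 0 t) * y.1 0 t) * this

theorem formSpace_norm_sq (hV0 : ∀ᵐ x, 0 ≤ V x) (x : formSpace V) :
    ‖x‖ ^ 2 = ‖x.1 0‖ ^ 2 + (‖x.1 1‖ ^ 2 + ∫ t, V t * ‖x.1 0 t‖ ^ 2) := by
  have h := formSpace_inner hV0 x x
  simp only [inner_self_eq_norm_sq_to_K] at h
  apply Complex.ofReal_injective
  rw [Complex.ofReal_add, Complex.ofReal_add, ← integral_complex_ofReal]
  have e : ∀ t, (V t : ℂ) * (conj (x.1 0 t) * x.1 0 t) = ((V t * ‖x.1 0 t‖ ^ 2 : ℝ) : ℂ) := by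
    intro t
    rw [← Complex.normSq_eq_conj_mul_self, Complex.normSq_eq_norm_sq]
    push_cast; rfl
  simp only [e] at h
  simpa using h

/-- The operator `(h + 1)⁻¹`. -/
def resolvent (V : ℝ → ℝ) : L2R →L[ℂ] L2R :=
  (formEmbedding V).comp (ContinuousLinearMap.adjoint (formEmbedding V))

theorem resolvent_isSymmetric : (resolvent V).IsSymmetric := by
  intro f g
  simp only [resolvent, ContinuousLinearMap.coe_coe, ContinuousLinearMap.comp_apply]
  rw [← ContinuousLinearMap.adjoint_inner_right, ContinuousLinearMap.adjoint_inner_left]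

include hVm hV0 in
-- The adjoint of the embedding sends `k` to the Riesz representative of `v ↦ ⟪v, k⟫` in the form
-- domain, that is, to the weak solution of `(h + 1) f = k`. The equation `h f = g` is the case `k =
-- f + g`.
theorem schrodingerGraph_iff {f g : L2R} :
    SchrodingerGraph V f g ↔ resolvent V (f + g) = f := by
  set ι := formEmbedding V
  have hadj : ∀ (v : formSpace V) (k : L2R),
      ⟪v, ContinuousLinearMap.adjoint ι k⟫_ℂ = ⟪v.1 0, k⟫_ℂ := fun v k => by
    rw [ContinuousLinearMap.adjoint_inner_right]; rfl
  constructor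
  · rintro ⟨f', hf, h⟩
    obtain ⟨x, hx0, hx1⟩ := hf.exists_formSpace hVm hV0
    have : x = ContinuousLinearMap.adjoint ι (f + g) := by
      refine ext_inner_left ℂ fun v => ?_
      rw [hadj, formSpace_inner hV0, hx0, hx1, h _ _ (formSpace_inFormDomain hV0 v),
        inner_add_right]
    show ι (ContinuousLinearMap.adjoint ι (f + g)) = f
    rw [← this]; exact hx0
  · intro h
    set x := ContinuousLinearMap.adjoint ι (f + g) with hx
    have hx0 : x.1 0 = f := h
    refine ⟨x.1 1, hx0 ▸ formSpace_inFormDomain hV0 x, fun v v' hv => ?_⟩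
    obtain ⟨y, hy0, hy1⟩ := hv.exists_formSpace hVm hV0
    have h1 := hadj y (f + g)
    rw [← hx, formSpace_inner hV0, inner_add_right, hx0, hy0, hy1] at h1
    exact add_left_cancel h1

end

/-- From `ι ι* g = 0` follows `ι* g = 0`, so `g` is orthogonal to the form domain. Local
integrability of `V` puts all test functions there, hence `g = 0`. -/
theorem resolvent_injective {V : ℝ → ℝ} (hVloc : LocallyIntegrable V) (hV0 : ∀ᵐ x, 0 ≤ V x)
    {g : L2R} (hg : resolvent V g = 0) : g = 0 := by
  have h1 : ContinuousLinearMap.adjoint (formEmbedding V) g = 0 := by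
    rw [← inner_self_eq_zero (𝕜 := ℂ), ContinuousLinearMap.adjoint_inner_left]
    have : formEmbedding V (ContinuousLinearMap.adjoint (formEmbedding V) g) = 0 := hg
    rw [this, inner_zero_right]
  rw [Lp.eq_zero_iff_ae_eq_zero]
  refine ae_eq_zero_of_integral_contDiff_smul_eq_zero (locallyIntegrable_L2R g)
    fun φ hφ hc => ?_
  have hm : ∀ ψ : ℝ → ℝ, Continuous ψ → HasCompactSupport ψ →
      MemLp (fun x => (ψ x : ℂ)) 2 (volume : Measure ℝ) := fun ψ hψ hψc =>
    (Complex.continuous_ofReal.comp hψ).memLp_of_hasCompactSupport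
      (hψc.comp_left (g := fun x : ℝ => (x : ℂ)) (by simp))
  have hd : Continuous (deriv φ) := hφ.continuous_deriv (by simp)
  have h0 := hm φ hφ.continuous hc
  have h0' := hm (deriv φ) hd hc.deriv
  have hdom : InFormDomain V h0.toLp h0'.toLp := by
    constructor
    · intro ψ hψ hψc
      have e1 : ∫ x, deriv ψ x • (h0.toLp : L2R) x = ((∫ x, deriv ψ x * φ x : ℝ) : ℂ) := by
        rw [← integral_complex_ofReal]
        refine integral_congr_ae ?_
        filter_upwards [h0.coeFn_toLp] with x hx
        rw [hx, Complex.real_smul, Complex.ofReal_mul]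
      have e2 : ∫ x, ψ x • (h0'.toLp : L2R) x = ((∫ x, ψ x * deriv φ x : ℝ) : ℂ) := by
        rw [← integral_complex_ofReal]
        refine integral_congr_ae ?_
        filter_upwards [h0'.coeFn_toLp] with x hx
        rw [hx, Complex.real_smul, Complex.ofReal_mul]
      have hdψ : Continuous (deriv ψ) := hψ.continuous_deriv (by simp)
      rw [e1, e2, ← Complex.ofReal_neg]
      congr 1
      rw [eq_neg_iff_add_eq_zero, ← neg_eq_iff_add_eq_zero]
      refine (integral_mul_deriv_eq_deriv_mul_of_integrable
        (fun x _ => ((hψ.differentiable (by simp)) x).hasDerivAt)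
        (fun x _ => ((hφ.differentiable (by simp)) x).hasDerivAt) ?_ ?_ ?_).symm
      · exact (hψ.continuous.mul hd).integrable_of_hasCompactSupport hψc.mul_right
      · exact (hdψ.mul hφ.continuous).integrable_of_hasCompactSupport hc.mul_left
      · exact (hψ.continuous.mul hφ.continuous).integrable_of_hasCompactSupport hψc.mul_right
    · have : Integrable fun x => φ x ^ 2 * V x := by
        have hc2 : HasCompactSupport fun x => φ x ^ 2 :=
          hc.comp_left (g := fun x : ℝ => x ^ 2) (by simp)
        simpa using hVloc.integrable_smul_left_of_hasCompactSupport (hφ.continuous.pow 2) hc2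
      refine this.congr ?_
      filter_upwards [h0.coeFn_toLp] with x hx
      rw [hx, Complex.norm_real, Real.norm_eq_abs, sq_abs, mul_comm]
  obtain ⟨x, hx0, -⟩ := hdom.exists_formSpace hVloc.aestronglyMeasurable hV0
  have h2 : ⟪(h0.toLp : L2R), g⟫_ℂ = 0 := by
    rw [← hx0, ← formEmbedding_apply, ← ContinuousLinearMap.adjoint_inner_right, h1,
      inner_zero_right]
  rw [← h2, L2.inner_def]
  refine integral_congr_ae ?_
  filter_upwards [h0.coeFn_toLp] with x hx
  rw [hx, RCLike.inner_apply, Complex.conj_ofReal, Complex.real_smul, mul_comm]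

/-- The cell-average operators have finite rank and approximate the embedding within `1/(n+1)` in
operator norm, because the energy is dominated by the squared norm of the form space. -/
theorem isCompactOperator_formEmbedding {V : ℝ → ℝ} {s C : ℝ} (hs : 1 < s) (hC : 0 < C)
    (hV : ∀ᵐ x : ℝ, C⁻¹ * |x| ^ s ≤ V x) : IsCompactOperator (formEmbedding V) := by
  have hV0 : ∀ᵐ x, 0 ≤ V x := by
    filter_upwards [hV] with x hx using le_trans (by positivity) hx
  have happ : ∀ n : ℕ, ∃ P : L2R →L[ℂ] L2R, IsCompactOperator P ∧
      ∀ f f', InFormDomain V f f' →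
        ‖f - P f‖ ^ 2 ≤ (1 / ((n : ℝ) + 1)) ^ 2 * (‖f'‖ ^ 2 + ∫ x, V x * ‖f x‖ ^ 2) := by
    intro n
    set ε : ℝ := (1 / ((n : ℝ) + 1)) ^ 2 with hε
    have hε0 : 0 < ε := by positivity
    set L : ℝ := (C / ε) ^ (1 / s) with hL
    have hL0 : 0 < L := by positivity
    have hLs : C * L ^ (-s) ≤ ε := by
      rw [hL, ← Real.rpow_mul (by positivity)]
      have : 1 / s * -s = -1 := by field_simp
      rw [this, Real.rpow_neg_one]
      apply le_of_eq; field_simp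
    obtain ⟨M, hM⟩ := exists_nat_gt (2 * L * (n + 1))
    have hM0 : (0 : ℝ) < M := lt_trans (by positivity) hM
    obtain ⟨w, c, hw⟩ := exists_finiteRank_approx hs hC hV hL0 (ε := ε) (M := M)
      (by exact_mod_cast hM0) (by
        rw [hε]
        refine pow_le_pow_left₀ (by positivity) ?_ 2
        rw [div_le_div_iff₀ hM0 (by positivity)]
        linarith) hLs
    refine ⟨∑ j, (c • innerSL ℂ (w j)).smulRight (w j), ?_, fun f f' hf => ?_⟩
    · refine Submodule.sum_mem (compactOperator (RingHom.id ℂ) L2R L2R) fun j _ => ?_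
      have h1 : IsCompactOperator (c • innerSL ℂ (w j) : L2R →L[ℂ] ℂ) :=
        isCompactOperator_of_locallyCompactSpace_dom (c • innerSL ℂ (w j))
      exact h1.clm_comp (ContinuousLinearMap.toSpanSingleton ℂ (w j))
    · simpa [sum_apply] using hw f f' hf
  choose P hP hPf using happ
  refine isCompactOperator_of_tendsto (l := atTop)
    (F := fun n => (P n).comp (formEmbedding V)) ?_
    (Eventually.of_forall fun n => (hP n).comp_clm (formEmbedding V))
  refine (tendsto_iff_norm_sub_tendsto_zero (E := formSpace V →L[ℂ] L2R)).2 ?_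
  refine squeeze_zero (fun _ => norm_nonneg (E := formSpace V →L[ℂ] L2R) _)
    (fun n => ?_) tendsto_one_div_add_atTop_nhds_zero_nat
  refine ContinuousLinearMap.opNorm_le_bound _ (by positivity) fun x => ?_
  have h1 := hPf n _ _ (formSpace_inFormDomain hV0 x)
  have h2 := formSpace_norm_sq hV0 x
  rw [sub_apply, norm_sub_rev]
  refine le_of_sq_le_sq ?_ (by positivity)
  rw [mul_pow]
  refine h1.trans (mul_le_mul_of_nonneg_left ?_ (by positivity))
  rw [h2]
  linarith [sq_nonneg ‖x.1 0‖]

theorem exists_isSpectralDecomposition {V : ℝ → ℝ} {s C : ℝ} (hs : 1 < s) (hC : 0 < C)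
    (hVloc : LocallyIntegrable V) (hV : ∀ᵐ x : ℝ, C⁻¹ * |x| ^ s ≤ V x) :
    ∃ (u : HilbertBasis ℕ ℂ L2R) (lam : ℕ → ℝ), IsSpectralDecomposition V u lam := by
  have hV0 : ∀ᵐ x, 0 ≤ V x := by
    filter_upwards [hV] with x hx using le_trans (by positivity) hx
  have : Fact ((2 : ℝ≥0∞) ≠ ∞) := ⟨by simp⟩
  obtain ⟨u, κ, hκ⟩ := exists_eigenbasis not_finiteDimensional_L2R
    ((isCompactOperator_formEmbedding hs hC hV).comp_clm
      (ContinuousLinearMap.adjoint (formEmbedding V)) : IsCompactOperator (resolvent V))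
    resolvent_isSymmetric
  have hsym : ∀ f n, ⟪u n, resolvent V f⟫_ℂ = conj (κ n) * ⟪u n, f⟫_ℂ := fun f n => by
    have := resolvent_isSymmetric (V := V) (u n) f
    simp only [ContinuousLinearMap.coe_coe] at this
    rw [← this, hκ, inner_smul_left]
  have hreal : ∀ n, conj (κ n) = κ n := fun n => by
    have := hsym (u n) n
    rw [hκ, inner_smul_right, inner_self_eq_norm_sq_to_K, u.orthonormal.1 n] at this
    simpa using this.symm
  have hne : ∀ n, κ n ≠ 0 := fun n h0 =>
    u.orthonormal.ne_zero n (resolvent_injective hVloc hV0 (by rw [hκ, h0, zero_smul]))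
  -- An eigenvalue `κ` of `(h + 1)⁻¹` corresponds to `1/κ - 1` for `h`. It is already real; the real
  -- part only changes its type.
  refine ⟨u, fun n => (1 / κ n - 1).re, fun f g => ?_⟩
  rw [schrodingerGraph_iff hVloc.aestronglyMeasurable hV0, ← u.repr.injective.eq_iff, lp.ext_iff,
    funext_iff]
  refine forall_congr' fun n => ?_
  have hre : (((1 / κ n - 1).re : ℝ) : ℂ) = 1 / κ n - 1 := by
    rw [← Complex.conj_eq_iff_re]
    simp [hreal n]
  rw [u.repr_apply_apply, u.repr_apply_apply, hsym, hreal, inner_add_right, hre]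
  have := hne n
  field_simp
  constructor <;> intro h <;> linear_combination h

/-! ### Complex Gaussian variables -/

/-- The complex Gaussian measure `(l/π) exp(-l |z|²) da db`. -/
def complexGaussian (l : ℝ) : Measure ℂ :=
  (volume : Measure ℂ).withDensity fun z =>
    ENNReal.ofReal (l / Real.pi * Real.exp (-(l * ‖z‖ ^ 2)))

section ComplexGaussian

variable {l : ℝ}

theorem measurable_complexGaussian_density :
    Measurable fun z : ℂ => ENNReal.ofReal (l / Real.pi * Real.exp (-(l * ‖z‖ ^ 2))) := by
  fun_prop

theorem integral_complexGaussian (hl : 0 < l) (f : ℂ → ℂ) :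
    ∫ z, f z ∂complexGaussian l =
      ∫ z, ((l / Real.pi * Real.exp (-(l * ‖z‖ ^ 2)) : ℝ) : ℂ) * f z := by
  rw [complexGaussian, integral_withDensity_eq_integral_toReal_smul
    measurable_complexGaussian_density (by simp)]
  congr 1 with z
  rw [ENNReal.toReal_ofReal (by have := Real.pi_pos; positivity), Complex.real_smul]

theorem integrable_norm_pow_mul_exp (hl : 0 < l) (q : ℕ) :
    Integrable fun z : ℂ => ‖z‖ ^ q * Real.exp (-(l * ‖z‖ ^ 2)) := by
  have h := Complex.integral_rpow_mul_exp_neg_mul_rpow (p := 2) (q := q) (by norm_num)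
    (by have : (0 : ℝ) ≤ q := by positivity
        linarith) hl
  have hpos : 0 < Real.Gamma (((q : ℝ) + 2) / 2) := Real.Gamma_pos_of_pos (by positivity)
  have hπ := Real.pi_pos
  have h0 : ∫ x : ℂ, ‖x‖ ^ (q : ℝ) * Real.exp (-l * ‖x‖ ^ (2 : ℝ)) ≠ 0 := by
    rw [h]; positivity
  have h1 := not_imp_comm.1 integral_undef h0
  refine h1.congr (ae_of_all _ fun z => ?_)
  simp only [Real.rpow_natCast, Real.rpow_ofNat, neg_mul]

theorem integral_norm_pow_mul_exp (hl : 0 < l) (a : ℕ) :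
    ∫ z : ℂ, (l / Real.pi * Real.exp (-(l * ‖z‖ ^ 2))) * (‖z‖ ^ 2) ^ a = a.factorial / l ^ a := by
  have h := Complex.integral_rpow_mul_exp_neg_mul_rpow (p := 2) (q := 2 * a) (by norm_num)
    (by have : (0 : ℝ) ≤ a := by positivity
        linarith) hl
  have e1 : ((2 * a : ℝ) + 2) / 2 = a + 1 := by ring
  have e2 : (-(2 * a + 2) / 2 : ℝ) = -((a + 1 : ℕ) : ℝ) := by push_cast; ring
  rw [e1, e2, Real.Gamma_nat_eq_factorial, Real.rpow_neg hl.le, Real.rpow_natCast] at h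
  have hπ := Real.pi_pos
  calc ∫ z : ℂ, (l / Real.pi * Real.exp (-(l * ‖z‖ ^ 2))) * (‖z‖ ^ 2) ^ a
      = (l / Real.pi) * ∫ z : ℂ, ‖z‖ ^ (2 * a : ℝ) * Real.exp (-l * ‖z‖ ^ (2 : ℝ)) := by
        rw [← integral_const_mul]
        congr 1 with z
        have : ‖z‖ ^ (2 * a : ℝ) = (‖z‖ ^ 2) ^ a := by
          rw [← pow_mul, ← Real.rpow_natCast]; norm_cast
        rw [this, Real.rpow_ofNat, neg_mul]; ring
    _ = _ := by rw [h, pow_succ]; field_simp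

theorem integrable_complexGaussian (hl : 0 < l) {f : ℂ → ℂ} (hf : Continuous f) (q : ℕ)
    (h : ∀ z, ‖f z‖ ≤ ‖z‖ ^ q) : Integrable f (complexGaussian l) := by
  rw [complexGaussian, integrable_withDensity_iff_integrable_smul'
    measurable_complexGaussian_density (by simp)]
  have hπ := Real.pi_pos
  refine ((integrable_norm_pow_mul_exp hl q).const_mul (l / Real.pi)).mono' ?_
    (ae_of_all _ fun z => ?_)
  · exact (measurable_complexGaussian_density.ennreal_toReal.smul
      hf.measurable).aestronglyMeasurable
  · rw [norm_smul, ENNReal.toReal_ofReal (by positivity), Real.norm_of_nonneg (by positivity)]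
    calc _ ≤ l / Real.pi * Real.exp (-(l * ‖z‖ ^ 2)) * ‖z‖ ^ q := by
          gcongr; exact h z
      _ = _ := by ring

theorem integrable_complexGaussian_moment (hl : 0 < l) (a b : ℕ) :
    Integrable (fun z => z ^ a * (conj z) ^ b) (complexGaussian l) := by
  refine integrable_complexGaussian hl (by fun_prop) (a + b) fun z => ?_
  simp [pow_add]

theorem integral_complexGaussian_moment_self (hl : 0 < l) (a : ℕ) :
    ∫ z, z ^ a * (conj z) ^ a ∂complexGaussian l = a.factorial / (l : ℂ) ^ a := by
  rw [integral_complexGaussian hl]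
  have : ∀ z : ℂ, ((l / Real.pi * Real.exp (-(l * ‖z‖ ^ 2)) : ℝ) : ℂ) * (z ^ a * (conj z) ^ a) =
      (((l / Real.pi * Real.exp (-(l * ‖z‖ ^ 2))) * (‖z‖ ^ 2) ^ a : ℝ) : ℂ) := by
    intro z
    rw [← mul_pow, Complex.mul_conj, Complex.normSq_eq_norm_sq]
    push_cast; ring
  simp only [this]
  rw [integral_complex_ofReal, integral_norm_pow_mul_exp hl]
  push_cast; rfl

theorem integral_complexGaussian_moment_ne (hl : 0 < l) {a b : ℕ} (hab : a ≠ b) :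
    ∫ z, z ^ a * (conj z) ^ b ∂complexGaussian l = 0 := by
  rw [integral_complexGaussian hl]
  have hd : ((a : ℝ) - b) ≠ 0 := sub_ne_zero.2 (by exact_mod_cast hab)
  -- The angle is chosen so that rotation by `c` multiplies `z^a z̄^b` by `-1`. The Gaussian is
  -- rotation invariant, so the integral equals its own negative.
  set c : Circle := Circle.exp (Real.pi / ((a : ℝ) - b)) with hc
  have hc1 : (c : ℂ) ^ a * (conj (c : ℂ)) ^ b = -1 := by
    have h1 : conj (c : ℂ) = Complex.exp (-(Real.pi / ((a : ℝ) - b) * Complex.I)) := by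
      rw [hc, Circle.coe_exp, ← Complex.exp_conj]
      congr 1
      simp
    rw [h1, hc, Circle.coe_exp, ← Complex.exp_nat_mul, ← Complex.exp_nat_mul, ← Complex.exp_add,
      ← Complex.exp_pi_mul_I]
    congr 1
    have hd' : ((a : ℂ) - b) ≠ 0 := by exact_mod_cast hd
    push_cast
    field_simp
    ring
  set F : ℂ → ℂ := fun z =>
    ((l / Real.pi * Real.exp (-(l * ‖z‖ ^ 2)) : ℝ) : ℂ) * (z ^ a * (conj z) ^ b)
  have h1 : ∫ z, F (rotation c z) = ∫ z, F z :=
    (rotation c).measurePreserving.integral_comp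
      (rotation c).toHomeomorph.measurableEmbedding F
  have h2 : ∀ z, F (rotation c z) = - F z := by
    intro z
    have hn : ‖rotation c z‖ = ‖z‖ := LinearIsometryEquiv.norm_map _ _
    simp only [F, hn]
    simp only [rotation_apply, mul_pow, map_mul]
    linear_combination ((l / Real.pi * Real.exp (-(l * ‖z‖ ^ 2)) : ℝ) : ℂ) *
      (z ^ a * (conj z) ^ b) * hc1
  simp only [h2] at h1
  rw [integral_neg] at h1
  have h3 : (2 : ℂ) * ∫ z, F z = 0 := by linear_combination -h1
  simpa using h3

theorem isProbabilityMeasure_complexGaussian (hl : 0 < l) :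
    IsProbabilityMeasure (complexGaussian l) := by
  have h := integral_norm_pow_mul_exp hl 0
  have hi := (integrable_norm_pow_mul_exp hl 0).const_mul (l / Real.pi)
  simp only [pow_zero, mul_one, one_mul, Nat.factorial_zero, Nat.cast_one, div_one] at h hi
  have hπ := Real.pi_pos
  constructor
  rw [complexGaussian, withDensity_apply _ MeasurableSet.univ, Measure.restrict_univ,
    ← ofReal_integral_eq_lintegral_ofReal hi (ae_of_all _ fun z => by simp only [Pi.zero_apply]; positivity), h]
  simp

/-- This is the characteristic function of a real Gaussian of variance `‖c‖² / (2l)`. -/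
theorem integral_complexGaussian_exp (hl : 0 < l) (c : ℂ) (ξ : ℝ) :
    ∫ z, Complex.exp (ξ * (conj c * z).re * Complex.I) ∂complexGaussian l =
      Complex.exp (-(ξ ^ 2 * ‖c‖ ^ 2 / (4 * l))) := by
  have hπ : (Real.pi : ℂ) ≠ 0 := by exact_mod_cast Real.pi_ne_zero
  have hl' : (l : ℂ) ≠ 0 := by exact_mod_cast hl.ne'
  rw [integral_complexGaussian hl]
  have h := GaussianFourier.integral_cexp_neg_mul_sq_norm_add (V := ℂ) (b := (l : ℂ))
    (by simpa using hl) (ξ * Complex.I) c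
  have e : ∀ z : ℂ, ((l / Real.pi * Real.exp (-(l * ‖z‖ ^ 2)) : ℝ) : ℂ) *
      Complex.exp (ξ * (conj c * z).re * Complex.I) =
      (l / Real.pi : ℂ) * Complex.exp (-l * ‖z‖ ^ 2 + ξ * Complex.I * (⟪c, z⟫_ℝ : ℝ)) := by
    intro z
    rw [Complex.exp_add, Complex.inner]
    push_cast
    rw [mul_assoc, neg_mul]
    congr 3
    ring_nf
  simp only [e]
  rw [integral_const_mul]
  refine (congrArg _ h).trans ?_
  rw [Complex.finrank_real_complex, mul_pow, Complex.I_sq]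
  norm_num
  rw [← mul_assoc, div_mul_div_cancel₀ hπ, div_self hl', one_mul]
  congr 1
  ring

end ComplexGaussian

/-! ### Moments of finite Gaussian sums -/

/-- Since `C(a,i)² i! (a-i)! = a! C(a,i)`, moments of the form `a! Sᵃ` are stable under addition of
independent variables. -/
theorem sum_choose_mul_moment (a : ℕ) (X Y : ℂ) :
    ∑ i ∈ Finset.range (a + 1), (a.choose i : ℂ) * (a.choose i : ℂ) *
      ((i.factorial : ℂ) * X ^ i) * (((a - i).factorial : ℂ) * Y ^ (a - i)) =
      a.factorial * (X + Y) ^ a := by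
  rw [add_pow, Finset.mul_sum]
  refine Finset.sum_congr rfl fun i hi => ?_
  have h := Nat.choose_mul_factorial_mul_factorial (Nat.lt_succ_iff.1 (Finset.mem_range.1 hi))
  have h' : (a.choose i : ℂ) * i.factorial * (a - i).factorial = a.factorial := by
    exact_mod_cast h
  linear_combination ((a.choose i : ℂ) * X ^ i * Y ^ (a - i)) * h'

/-- Covariances of independent pairs add. In the double binomial expansion a term survives only if
`i = j` and `a - i = b - j`, which leaves nothing unless `a = b`. -/
theorem gaussian_moment_step {α β : Type*} [MeasurableSpace α] [MeasurableSpace β]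
    {μ : Measure α} {ν : Measure β} [IsProbabilityMeasure μ] [IsProbabilityMeasure ν]
    {X Y : α → ℂ} {X' Y' : β → ℂ} {S S' : ℂ}
    (h : ∀ a b : ℕ, Integrable (fun z => X z ^ a * conj (Y z) ^ b) μ ∧
      ∫ z, X z ^ a * conj (Y z) ^ b ∂μ = if a = b then a.factorial * S ^ a else 0)
    (h' : ∀ a b : ℕ, Integrable (fun z => X' z ^ a * conj (Y' z) ^ b) ν ∧
      ∫ z, X' z ^ a * conj (Y' z) ^ b ∂ν = if a = b then a.factorial * S' ^ a else 0)
    (a b : ℕ) :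
    Integrable (fun z : α × β => (X z.1 + X' z.2) ^ a * conj (Y z.1 + Y' z.2) ^ b) (μ.prod ν) ∧
      ∫ z : α × β, (X z.1 + X' z.2) ^ a * conj (Y z.1 + Y' z.2) ^ b ∂(μ.prod ν) =
        if a = b then a.factorial * (S + S') ^ a else 0 := by
  have hexp : ∀ z : α × β, (X z.1 + X' z.2) ^ a * conj (Y z.1 + Y' z.2) ^ b =
      ∑ i ∈ Finset.range (a + 1), ∑ j ∈ Finset.range (b + 1), (a.choose i * b.choose j : ℂ) *
        ((X z.1 ^ i * conj (Y z.1) ^ j) * (X' z.2 ^ (a - i) * conj (Y' z.2) ^ (b - j))) := by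
    intro z
    rw [map_add, add_pow, add_pow, Finset.sum_mul_sum]
    refine Finset.sum_congr rfl fun i _ => Finset.sum_congr rfl fun j _ => by ring
  have hint : ∀ i j, Integrable (fun z : α × β => (a.choose i * b.choose j : ℂ) *
        ((X z.1 ^ i * conj (Y z.1) ^ j) * (X' z.2 ^ (a - i) * conj (Y' z.2) ^ (b - j))))
        (μ.prod ν) := fun i j =>
    ((h i j).1.mul_prod (h' (a - i) (b - j)).1).const_mul _
  simp only [hexp]
  refine ⟨integrable_finsetSum _ fun i _ => integrable_finsetSum _ fun j _ => hint i j, ?_⟩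
  rw [integral_finsetSum _ fun i _ => integrable_finsetSum _ fun j _ => hint i j]
  have h1 : ∀ i ∈ Finset.range (a + 1), ∫ z : α × β, ∑ j ∈ Finset.range (b + 1),
      (a.choose i * b.choose j : ℂ) *
        ((X z.1 ^ i * conj (Y z.1) ^ j) * (X' z.2 ^ (a - i) * conj (Y' z.2) ^ (b - j))) ∂μ.prod ν
      = if a = b then (a.choose i : ℂ) * (a.choose i : ℂ) *
      ((i.factorial : ℂ) * S ^ i) * (((a - i).factorial : ℂ) * S' ^ (a - i)) else 0 := by
    intro i hi
    have hi' := Nat.lt_succ_iff.1 (Finset.mem_range.1 hi)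
    rw [integral_finsetSum _ fun j _ => hint i j]
    have h2 : ∀ j ∈ Finset.range (b + 1), ∫ z : α × β, (a.choose i * b.choose j : ℂ) *
        ((X z.1 ^ i * conj (Y z.1) ^ j) * (X' z.2 ^ (a - i) * conj (Y' z.2) ^ (b - j))) ∂μ.prod ν
        = if j = i then (if a = b then (a.choose i : ℂ) * (a.choose i : ℂ) *
      ((i.factorial : ℂ) * S ^ i) * (((a - i).factorial : ℂ) * S' ^ (a - i)) else 0) else 0 := by
      intro j hj
      have hj' := Nat.lt_succ_iff.1 (Finset.mem_range.1 hj)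
      rw [integral_const_mul, integral_prod_mul (fun z => X z ^ i * conj (Y z) ^ j)
        (fun z => X' z ^ (a - i) * conj (Y' z) ^ (b - j)), (h i j).2, (h' _ _).2]
      by_cases hij : j = i
      · subst hij
        by_cases hab : a = b
        · subst hab; simp only [if_true]; ring
        · have : ¬ a - j = b - j := by omega
          simp [hab, this]
      · simp [hij, Ne.symm hij]
    rw [Finset.sum_congr rfl h2, Finset.sum_ite_eq']
    split_ifs with hm hab hab
    · rfl
    · rfl
    · exact absurd (Finset.mem_range.2 (by omega)) hm
    · rfl
  rw [Finset.sum_congr rfl h1]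
  split_ifs with hab
  · exact sum_choose_mul_moment a S S'
  · simp

theorem gaussian_moments {n : ℕ} {l : Fin n → ℝ} (hl : ∀ i, 0 < l i) (x y : Fin n → ℂ)
    (a b : ℕ) :
    Integrable (fun z : Fin n → ℂ => (∑ i, x i * z i) ^ a * conj (∑ i, y i * z i) ^ b)
      (Measure.pi fun i => complexGaussian (l i)) ∧
      ∫ z : Fin n → ℂ, (∑ i, x i * z i) ^ a * conj (∑ i, y i * z i) ^ b
        ∂(Measure.pi fun i => complexGaussian (l i)) =
        if a = b then a.factorial * (∑ i, x i * conj (y i) / l i) ^ a else 0 := by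
  induction n generalizing a b with
  | zero =>
    have : IsProbabilityMeasure (Measure.pi fun i : Fin 0 => complexGaussian (l i)) := by
      constructor; simp
    simp only [Finset.univ_eq_empty, Finset.sum_empty, map_zero]
    refine ⟨integrable_const _, ?_⟩
    rw [integral_const]
    rcases a with - | a <;> rcases b with - | b <;> simp
  | succ n ih =>
    have hp : ∀ i, IsProbabilityMeasure (complexGaussian (l i)) := fun i =>
      isProbabilityMeasure_complexGaussian (hl i)
    have hmp := measurePreserving_piFinSuccAbove (fun i => complexGaussian (l i)) 0
    have h0 : ∀ a b : ℕ, Integrable (fun z => (x 0 * z) ^ a * conj (y 0 * z) ^ b)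
        (complexGaussian (l 0)) ∧ ∫ z, (x 0 * z) ^ a * conj (y 0 * z) ^ b ∂complexGaussian (l 0) =
        if a = b then a.factorial * (x 0 * conj (y 0) / l 0) ^ a else 0 := by
      intro a b
      have e : ∀ z, (x 0 * z) ^ a * conj (y 0 * z) ^ b =
          (x 0 ^ a * conj (y 0) ^ b) * (z ^ a * conj z ^ b) := by
        intro z; rw [map_mul]; ring
      simp only [e]
      refine ⟨(integrable_complexGaussian_moment (hl 0) a b).const_mul _, ?_⟩
      rw [integral_const_mul]
      split_ifs with hab
      · subst hab
        rw [integral_complexGaussian_moment_self (hl 0)]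
        ring
      · rw [integral_complexGaussian_moment_ne (hl 0) hab, mul_zero]
    have key := gaussian_moment_step h0
      (fun a b => ih (fun i => hl i.succ) (fun i => x i.succ) (fun i => y i.succ) a b) a b
    have e : ∀ z : Fin (n + 1) → ℂ, (∑ i, x i * z i) ^ a * conj (∑ i, y i * z i) ^ b =
        (fun w : ℂ × (Fin n → ℂ) => (x 0 * w.1 + ∑ i : Fin n, x i.succ * w.2 i) ^ a *
          conj (y 0 * w.1 + ∑ i : Fin n, y i.succ * w.2 i) ^ b)
          (MeasurableEquiv.piFinSuccAbove (fun _ => ℂ) 0 z) := by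
      intro z
      simp [Fin.sum_univ_succ, MeasurableEquiv.piFinSuccAbove, Fin.tail]
    simp only [e]
    rw [hmp.integral_comp' (g := fun w : ℂ × (Fin n → ℂ) =>
      (x 0 * w.1 + ∑ i : Fin n, x i.succ * w.2 i) ^ a *
          conj (y 0 * w.1 + ∑ i : Fin n, y i.succ * w.2 i) ^ b)]
    rw [Fin.sum_univ_succ]
    exact ⟨hmp.integrable_comp_of_integrable key.1, key.2⟩

/-! ### The infinite-dimensional Gaussian measure -/

section SobolevSpaces

variable {lam : ℕ → ℝ} {t₀ : ℝ}

/-- Each `λₙ^q` is at most the whole sum, and `q < 0` reverses the inequality. The lower bound makes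
the spaces `𝔥ᵗ` nested and `h⁻¹` bounded. -/
theorem exists_lower_bound (hlam : ∀ n, 0 < lam n) {q : ℝ} (hq : q < 0)
    (hsum : Summable fun n => lam n ^ q) : ∃ δ : ℝ, 0 < δ ∧ ∀ n, δ ≤ lam n := by
  set B := 1 + ∑' n, lam n ^ q with hB
  have hB1 : 1 ≤ B := by
    have : 0 ≤ ∑' n, lam n ^ q := tsum_nonneg fun n => (Real.rpow_pos_of_pos (hlam n) q).le
    linarith
  have hB0 : 0 < B := by linarith
  refine ⟨B ^ q⁻¹, by positivity, fun n => ?_⟩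
  have h1 : lam n ^ q ≤ B := by
    have := hsum.le_tsum n fun m _ => (Real.rpow_pos_of_pos (hlam m) q).le
    linarith
  have h2 := Real.rpow_le_rpow_of_nonpos (Real.rpow_pos_of_pos (hlam n) q) h1
    (inv_nonpos.2 hq.le)
  rwa [← Real.rpow_mul (hlam n).le, mul_inv_cancel₀ hq.ne, Real.rpow_one] at h2

theorem SobolevLike.anti (hlam : ∀ n, 0 < lam n) {δ : ℝ} (hδ : 0 < δ) (h : ∀ n, δ ≤ lam n)
    {t t' : ℝ} (ht : t' ≤ t) : SobolevLike lam t ⊆ SobolevLike lam t' := by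
  intro α hα
  refine Summable.of_nonneg_of_le (fun n => by have := hlam n; positivity) (fun n => ?_)
    (hα.mul_left (δ ^ (t' - t)))
  have h1 : lam n ^ t' = lam n ^ (t' - t) * lam n ^ t := by
    rw [← Real.rpow_add (hlam n)]; congr 1; ring
  have h2 : lam n ^ (t' - t) ≤ δ ^ (t' - t) :=
    Real.rpow_le_rpow_of_nonpos hδ (h n) (by linarith)
  have h3 := Real.rpow_pos_of_pos (hlam n) t
  rw [h1, ← mul_assoc]
  gcongr

theorem mem_sobolevLike_iff (hlam : ∀ n, 0 < lam n) (t : ℝ) (α : ℕ → ℂ) :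
    α ∈ SobolevLike lam t ↔ ∑' n, ENNReal.ofReal (lam n ^ t * ‖α n‖ ^ 2) ≠ ∞ := by
  have h0 : ∀ n, 0 ≤ lam n ^ t * ‖α n‖ ^ 2 := fun n => by have := hlam n; positivity
  constructor
  · intro h
    exact ENNReal.ofReal_tsum_of_nonneg h0 h ▸ ENNReal.ofReal_ne_top
  · intro h
    refine (ENNReal.summable_toReal h).congr fun n => ?_
    rw [ENNReal.toReal_ofReal (h0 n)]

theorem measurable_sobolev_sum (t : ℝ) :
    Measurable fun α : ℕ → ℂ => ∑' n, ENNReal.ofReal (lam n ^ t * ‖α n‖ ^ 2) := by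
  fun_prop

theorem measurableSet_sobolevLike (hlam : ∀ n, 0 < lam n) (t : ℝ) :
    MeasurableSet (SobolevLike lam t) := by
  have : SobolevLike lam t =
      (fun α : ℕ → ℂ => ∑' n, ENNReal.ofReal (lam n ^ t * ‖α n‖ ^ 2)) ⁻¹' {∞}ᶜ := by
    ext α; exact mem_sobolevLike_iff hlam t α
  rw [this]
  exact measurable_sobolev_sum t (measurableSet_singleton _).compl

/-- Nesting reduces the intersection to a countable one, so that measurability and almost sure
membership can be checked exponent by exponent. -/
theorem sobolevInter_eq_iInter (hlam : ∀ n, 0 < lam n) {δ : ℝ} (hδ : 0 < δ)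
    (h : ∀ n, δ ≤ lam n) : (⋂ t ∈ Set.Iio t₀, SobolevLike lam t) =
      ⋂ j : ℕ, SobolevLike lam (t₀ - 1 / ((j : ℝ) + 1)) := by
  apply Set.Subset.antisymm
  · refine Set.subset_iInter fun j => Set.biInter_subset_of_mem ?_
    have : (0 : ℝ) < 1 / ((j : ℝ) + 1) := by positivity
    simp only [Set.mem_Iio]; linarith
  · refine Set.subset_iInter₂ fun t ht => ?_
    obtain ⟨j, hj⟩ := exists_nat_one_div_lt (K := ℝ) (sub_pos.2 (Set.mem_Iio.1 ht))
    exact (Set.iInter_subset _ j).trans (SobolevLike.anti hlam hδ h (by linarith))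

theorem measurableSet_sobolevInter (hlam : ∀ n, 0 < lam n) {δ : ℝ} (hδ : 0 < δ)
    (h : ∀ n, δ ≤ lam n) : MeasurableSet (⋂ t ∈ Set.Iio t₀, SobolevLike lam t) := by
  rw [sobolevInter_eq_iInter hlam hδ h]
  exact MeasurableSet.iInter fun j => measurableSet_sobolevLike hlam _

theorem lintegral_complexGaussian_norm_sq {l : ℝ} (hl : 0 < l) {r : ℝ} (hr : 0 ≤ r) :
    ∫⁻ z, ENNReal.ofReal (r * ‖z‖ ^ 2) ∂complexGaussian l = ENNReal.ofReal (r / l) := by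
  rw [complexGaussian, lintegral_withDensity_eq_lintegral_mul _ measurable_complexGaussian_density
    (by fun_prop)]
  have hπ := Real.pi_pos
  have e : ∀ z : ℂ, ENNReal.ofReal (l / Real.pi * Real.exp (-(l * ‖z‖ ^ 2))) *
      ENNReal.ofReal (r * ‖z‖ ^ 2) =
      ENNReal.ofReal (r * ((l / Real.pi * Real.exp (-(l * ‖z‖ ^ 2))) * (‖z‖ ^ 2) ^ 1)) := by
    intro z
    rw [← ENNReal.ofReal_mul (by positivity)]
    congr 1; ring
  simp only [Pi.mul_apply, e]
  rw [← ofReal_integral_eq_lintegral_ofReal, integral_const_mul, integral_norm_pow_mul_exp hl]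
  · simp [div_eq_mul_inv]
  · refine (((integrable_norm_pow_mul_exp hl 2).const_mul (l / Real.pi)).const_mul r).congr
      (ae_of_all _ fun z => ?_)
    simp only; ring
  · exact ae_of_all _ fun z => by simp only [Pi.zero_apply]; positivity

/-- The expectation of `‖αₙ‖²` is `1/λₙ`, so the squared `𝔥ᵗ` norm has expectation `∑ λₙ^(t-1)` and
is finite almost surely. -/
theorem ae_mem_sobolevLike (hlam : ∀ n, 0 < lam n)
    [∀ n, IsProbabilityMeasure (complexGaussian (lam n))] {t : ℝ}
    (hsum : Summable fun n => lam n ^ (t - 1)) :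
    ∀ᵐ α ∂(Measure.infinitePi fun n => complexGaussian (lam n)), α ∈ SobolevLike lam t := by
  have h : ∫⁻ α, ∑' n, ENNReal.ofReal (lam n ^ t * ‖α n‖ ^ 2)
      ∂(Measure.infinitePi fun n => complexGaussian (lam n)) ≠ ∞ := by
    rw [lintegral_tsum fun n => Measurable.aemeasurable (by fun_prop)]
    have e : ∀ n, ∫⁻ α, ENNReal.ofReal (lam n ^ t * ‖α n‖ ^ 2)
        ∂(Measure.infinitePi fun n => complexGaussian (lam n)) =
        ENNReal.ofReal (lam n ^ (t - 1)) := by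
      intro n
      have h1 := (measurePreserving_eval_infinitePi (fun n => complexGaussian (lam n)) n).lintegral_comp
        (f := fun z => ENNReal.ofReal (lam n ^ t * ‖z‖ ^ 2)) (by fun_prop)
      rw [lintegral_complexGaussian_norm_sq (hlam n) (by have := hlam n; positivity)] at h1
      rw [Real.rpow_sub_one (hlam n).ne']
      exact h1
    simp only [e]
    rw [← ENNReal.ofReal_tsum_of_nonneg (fun n => (Real.rpow_pos_of_pos (hlam n) _).le) hsum]
    exact ENNReal.ofReal_ne_top
  filter_upwards [ae_lt_top (measurable_sobolev_sum t) h] with α hα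
  exact (mem_sobolevLike_iff hlam t α).2 hα.ne

theorem measurable_cylProj (K : ℕ) : Measurable (cylProj K : SobolevInter lam t₀ → _) :=
  measurable_pi_iff.2 fun j => (measurable_pi_apply (j : ℕ)).comp measurable_subtype_coe

theorem gaussianCyl_eq (lam : ℕ → ℝ) (K : ℕ) :
    gaussianCyl lam K = Measure.pi fun j : Fin (K + 1) => complexGaussian (lam j) := rfl

/-- The marginals on the first `K + 1` coordinates fix the measure of every finite box, since any
finite set of coordinates lies among them. This yields uniqueness. -/
theorem IsFreeGibbs.map_val
    [∀ n, IsProbabilityMeasure (complexGaussian (lam n))]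
    {ν : Measure (SobolevInter lam t₀)} (hν : IsFreeGibbs ν) :
    ν.map Subtype.val = Measure.infinitePi fun n => complexGaussian (lam n) := by
  classical
  refine Measure.eq_infinitePi _ fun S T hT => ?_
  set K := S.sup id
  have hSK : ∀ i ∈ S, i < K + 1 := fun i hi => Nat.lt_succ_of_le (Finset.le_sup (f := id) hi)
  let T' : ℕ → Set ℂ := fun i => if i ∈ S then T i else Set.univ
  have hT' : ∀ i, MeasurableSet (T' i) := fun i => by
    simp only [T']; split_ifs; exacts [hT i, MeasurableSet.univ]
  have h1 : (Subtype.val : SobolevInter lam t₀ → ℕ → ℂ) ⁻¹' (Set.pi S T) =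
      cylProj K ⁻¹' (Set.pi Set.univ fun j : Fin (K + 1) => T' j) := by
    ext α
    simp only [Set.mem_preimage, Set.mem_pi, Finset.mem_coe, Set.mem_univ, true_imp_iff, cylProj]
    constructor
    · intro h j
      by_cases hj : (j : ℕ) ∈ S
      · simp only [T', hj, if_true]; exact h _ hj
      · simp [T', hj]
    · intro h i hi
      have := h ⟨i, hSK i hi⟩
      simpa only [T', hi, if_true] using this
  rw [Measure.map_apply measurable_subtype_coe (MeasurableSet.pi (Finset.countable_toSet S)
    fun i _ => hT i), h1, ← Measure.map_apply (measurable_cylProj K)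
    (MeasurableSet.univ_pi fun j => hT' j), hν.2 K, gaussianCyl_eq, Measure.pi_pi,
    ← Finset.prod_range (fun i => complexGaussian (lam i) (T' i)),
    ← Finset.prod_subset (s₁ := S) (fun i hi => Finset.mem_range.2 (hSK i hi))]
  · refine Finset.prod_congr rfl fun i hi => ?_
    simp only [T', hi, if_true]
  · intro i _ hi
    simp [T', hi]

/-- The product measure gives full mass to the measurable set `⋂ 𝔥ᵗ`, so pulling it back to this
subtype loses nothing. -/
theorem exists_isFreeGibbs (hlam : ∀ n, 0 < lam n) {δ : ℝ} (hδ : 0 < δ) (h : ∀ n, δ ≤ lam n)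
    (hsum : ∀ t < t₀, Summable fun n => lam n ^ (t - 1)) :
    ∃ μ : Measure (SobolevInter lam t₀), IsFreeGibbs μ ∧
      ∀ ν : Measure (SobolevInter lam t₀), IsFreeGibbs ν → ν = μ := by
  have hp : ∀ n, IsProbabilityMeasure (complexGaussian (lam n)) := fun n =>
    isProbabilityMeasure_complexGaussian (hlam n)
  set P := Measure.infinitePi fun n => complexGaussian (lam n) with hP
  have hemb : MeasurableEmbedding (Subtype.val : SobolevInter lam t₀ → ℕ → ℂ) :=
    MeasurableEmbedding.subtype_coe (measurableSet_sobolevInter hlam hδ h)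
  have hae : ∀ᵐ α ∂P, α ∈ ⋂ t ∈ Set.Iio t₀, SobolevLike lam t := by
    rw [sobolevInter_eq_iInter hlam hδ h]
    simp only [Set.mem_iInter]
    refine ae_all_iff.2 fun j => ae_mem_sobolevLike hlam (hsum _ ?_)
    have : (0 : ℝ) < 1 / ((j : ℝ) + 1) := by positivity
    linarith
  have hmap : (P.comap Subtype.val : Measure (SobolevInter lam t₀)).map Subtype.val = P := by
    rw [hemb.map_comap, Subtype.range_coe]
    exact Measure.restrict_eq_self_of_ae_mem hae
  refine ⟨P.comap Subtype.val, ⟨?_, fun K => ?_⟩, fun ν hν => ?_⟩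
  · have : IsProbabilityMeasure ((P.comap Subtype.val : Measure (SobolevInter lam t₀)).map
        Subtype.val) := by rw [hmap]; infer_instance
    exact Measure.isProbabilityMeasure_of_map Subtype.val
  · have e : (cylProj K : SobolevInter lam t₀ → _) =
        (fun (α : ℕ → ℂ) (j : Fin (K + 1)) => α j) ∘ Subtype.val := rfl
    have hm : Measurable fun (α : ℕ → ℂ) (j : Fin (K + 1)) => α j := by fun_prop
    rw [e, ← Measure.map_map hm measurable_subtype_coe, hmap, gaussianCyl_eq]
    refine (Measure.pi_eq fun T hT => ?_).symm
    let T' : ℕ → Set ℂ := fun i => if hi : i < K + 1 then T ⟨i, hi⟩ else Set.univ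
    have hT' : ∀ j : Fin (K + 1), T' j = T j := fun j => dif_pos j.2
    have hpre : (fun (α : ℕ → ℂ) (j : Fin (K + 1)) => α j) ⁻¹' Set.pi Set.univ T =
        Set.pi (Finset.range (K + 1)) T' := by
      ext α
      simp only [Set.mem_preimage, Set.mem_pi, Set.mem_univ, true_imp_iff, Finset.mem_coe,
        Finset.mem_range]
      constructor
      · intro h i hi
        have := h ⟨i, hi⟩
        rwa [← hT'] at this
      · intro h j
        rw [← hT']; exact h j j.2
    rw [Measure.map_apply hm (MeasurableSet.univ_pi hT), hpre, hP, Measure.infinitePi_pi,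
      Finset.prod_range]
    · simp only [hT']
    · intro i hi
      simp only [Finset.mem_range] at hi
      rw [← Fin.val_mk hi, hT']; exact hT _
  · rw [hP, ← hν.map_val, hemb.comap_map]

end SobolevSpaces

/-! ### Gaussian linear functionals and their moments -/

section Pairing

variable {lam : ℕ → ℝ} {t₀ t : ℝ} {c d : ℕ → ℂ}

theorem summable_norm_mul_norm (hlam : ∀ n, 0 < lam n) (hc : c ∈ SobolevLike lam (-t))
    {α : ℕ → ℂ} (hα : α ∈ SobolevLike lam t) : Summable fun n => ‖c n‖ * ‖α n‖ := by
  refine Summable.of_nonneg_of_le (fun n => by positivity) (fun n => ?_) (hc.add hα)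
  have h1 : lam n ^ (-t) * lam n ^ t = 1 := by
    rw [← Real.rpow_add (hlam n)]; simp
  have h2 := Real.rpow_pos_of_pos (hlam n) t
  have h3 := Real.rpow_pos_of_pos (hlam n) (-t)
  have h4 : (‖c n‖ * ‖α n‖) ^ 2 = (lam n ^ (-t) * ‖c n‖ ^ 2) * (lam n ^ t * ‖α n‖ ^ 2) := by
    linear_combination (-(‖c n‖ * ‖α n‖) ^ 2) * h1
  have h5 : 0 ≤ lam n ^ (-t) * ‖c n‖ ^ 2 := by positivity
  have h6 : 0 ≤ lam n ^ t * ‖α n‖ ^ 2 := by positivity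
  refine le_of_sq_le_sq ?_ (by positivity)
  nlinarith

/-- The sequence `λₙ^(-1/2)`, the root mean square size of the coefficients, belongs to `𝔥ᵗ` because
`∑ λₙ^(t-1)` converges. -/
theorem summable_norm_mul_rpow (hlam : ∀ n, 0 < lam n) (hc : c ∈ SobolevLike lam (-t))
    (hsum : Summable fun n => lam n ^ (t - 1)) :
    Summable fun n => ‖c n‖ * lam n ^ (-(1 / 2) : ℝ) := by
  have h : (fun n => ((lam n ^ (-(1 / 2) : ℝ) : ℝ) : ℂ)) ∈ SobolevLike lam t := by
    refine hsum.congr fun n => ?_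
    have h0 := hlam n
    rw [Complex.norm_real, Real.norm_of_nonneg (by positivity), ← Real.rpow_natCast,
      ← Real.rpow_mul h0.le, ← Real.rpow_add h0]
    congr 1; norm_num; ring
  refine (summable_norm_mul_norm hlam hc h).congr fun n => ?_
  have h0 := hlam n
  rw [Complex.norm_real, Real.norm_of_nonneg (by positivity)]

theorem SobolevInter.mem {α : SobolevInter lam t₀} (ht : t < t₀) : α.1 ∈ SobolevLike lam t :=
  Set.mem_iInter₂.1 α.2 t ht

theorem measurable_coeff (n : ℕ) : Measurable fun α : SobolevInter lam t₀ => α.1 n :=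
  (measurable_pi_apply n).comp measurable_subtype_coe

theorem tendsto_pairing (hlam : ∀ n, 0 < lam n) (ht : t < t₀) (hc : c ∈ SobolevLike lam (-t))
    (α : SobolevInter lam t₀) :
    Tendsto (fun K : ℕ => ∑ j : Fin (K + 1), conj (c j) * cylProj K α j) atTop
      (𝓝 (pairing c α.1)) := by
  have h : Summable fun n => conj (c n) * α.1 n := by
    refine Summable.of_norm ?_
    simpa using summable_norm_mul_norm hlam hc (SobolevInter.mem ht)
  have h1 := h.hasSum.tendsto_sum_nat.comp (tendsto_add_atTop_nat 1)
  refine h1.congr fun K => ?_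
  simp only [Function.comp_apply, Finset.sum_range]
  rfl

theorem measurable_trunc (K : ℕ) :
    Measurable fun α : SobolevInter lam t₀ =>
      ∑ j : Fin (K + 1), conj (c j) * cylProj K α j :=
  Finset.measurable_sum _ fun j _ => (measurable_coeff (j : ℕ)).const_mul _

theorem measurable_pairing (hlam : ∀ n, 0 < lam n) (ht : t < t₀)
    (hc : c ∈ SobolevLike lam (-t)) :
    Measurable fun α : SobolevInter lam t₀ => pairing c α.1 :=
  measurable_of_tendsto_metrizable (fun K => measurable_trunc K)
    (tendsto_pi_nhds.2 fun α => tendsto_pairing hlam ht hc α)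

theorem IsFreeGibbs.integral_cylProj {μ : Measure (SobolevInter lam t₀)} (hμ : IsFreeGibbs μ)
    (K : ℕ) {F : (Fin (K + 1) → ℂ) → ℂ} (hF : Continuous F) :
    ∫ α, F (cylProj K α) ∂μ =
      ∫ z, F z ∂(Measure.pi fun j : Fin (K + 1) => complexGaussian (lam j)) := by
  rw [← gaussianCyl_eq, ← hμ.2 K, integral_map (measurable_cylProj K).aemeasurable
    hF.aestronglyMeasurable]

/-- Truncated pairings are sums of independent Gaussians, so their characteristic functions are
products. Dominated convergence with bound `1` passes to the limit, and the limiting variance is `∑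
‖cₙ‖² / (2 λₙ)`. -/
theorem IsFreeGibbs.isCenteredGaussian (hlam : ∀ n, 0 < lam n)
    (hsum : ∀ t < t₀, Summable fun n => lam n ^ (t - 1))
    {μ : Measure (SobolevInter lam t₀)} (hμ : IsFreeGibbs μ) : IsCenteredGaussian μ := by
  intro t ht c hc
  have hp : ∀ n, IsProbabilityMeasure (complexGaussian (lam n)) := fun n =>
    isProbabilityMeasure_complexGaussian (hlam n)
  have := hμ.1
  have hs : Summable fun n => ‖c n‖ ^ 2 / (2 * lam n) := by
    have h1 := summable_norm_mul_rpow hlam hc (hsum t ht)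
    have h2 := h1.mul_of_nonneg h1 (fun n => by have := hlam n; positivity)
      (fun n => by have := hlam n; positivity)
    have h3 := h2.comp_injective (i := fun n : ℕ => (n, n)) fun a b h => (Prod.mk.inj h).1
    refine (h3.mul_left (1 / 2)).congr fun n => ?_
    have h0 := hlam n
    have h4 : lam n ^ (-(1 / 2) : ℝ) * lam n ^ (-(1 / 2) : ℝ) = (lam n)⁻¹ := by
      rw [← Real.rpow_add h0, ← Real.rpow_neg_one]; norm_num
    simp only [Function.comp_apply]
    have h5 : ‖c n‖ ^ 2 / (2 * lam n) = 1 / 2 * ‖c n‖ ^ 2 * (lam n)⁻¹ := by field_simp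
    rw [h5, ← h4]; ring
  have hm : Measurable fun α : SobolevInter lam t₀ => (pairing c α.1).re :=
    Complex.measurable_re.comp (measurable_pairing hlam ht hc)
  have hv0 : 0 ≤ ∑' n, ‖c n‖ ^ 2 / (2 * lam n) := tsum_nonneg fun n => by
    have := hlam n; positivity
  obtain ⟨v, hv⟩ : ∃ v : ℝ≥0, (v : ℝ) = ∑' n, ‖c n‖ ^ 2 / (2 * lam n) := ⟨⟨_, hv0⟩, rfl⟩
  refine ⟨v, ?_⟩
  have := Measure.isProbabilityMeasure_map (μ := μ) hm.aemeasurable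
  refine Measure.ext_of_charFun ?_
  ext ξ
  rw [charFun_gaussianReal, charFun_apply_real, integral_map hm.aemeasurable
    (by fun_prop)]
  have hlim : Tendsto (fun K : ℕ => ∫ α, Complex.exp (ξ *
      (∑ j : Fin (K + 1), conj (c j) * cylProj K α j).re * Complex.I) ∂μ) atTop
      (𝓝 (∫ α, Complex.exp (ξ * ((pairing c α.1).re : ℝ) * Complex.I) ∂μ)) := by
    refine tendsto_integral_of_dominated_convergence (fun _ => 1) (fun K => ?_)
      (integrable_const _) (fun K => ae_of_all _ fun α => ?_) (ae_of_all _ fun α => ?_)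
    · exact (Measurable.aestronglyMeasurable (by have := measurable_trunc (c := c) (lam := lam) (t₀ := t₀) K; fun_prop))
    · rw [← Complex.ofReal_mul, Complex.norm_exp_ofReal_mul_I]
    · have h1 := tendsto_pairing hlam ht hc α
      have h2 : Continuous fun z : ℂ => Complex.exp (ξ * (z.re : ℝ) * Complex.I) := by fun_prop
      exact (h2.tendsto _).comp h1
  have hval : ∀ K : ℕ, ∫ α, Complex.exp (ξ *
      (∑ j : Fin (K + 1), conj (c j) * cylProj K α j).re * Complex.I) ∂μ =
      Complex.exp (-(((∑ n ∈ Finset.range (K + 1), ‖c n‖ ^ 2 / (2 * lam n) : ℝ) : ℂ) * ξ ^ 2 / 2)) := by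
    intro K
    rw [hμ.integral_cylProj K (F := fun z => Complex.exp (ξ *
      (∑ j : Fin (K + 1), conj (c j) * z j).re * Complex.I)) (by fun_prop)]
    have e : ∀ z : Fin (K + 1) → ℂ, Complex.exp (ξ *
        (∑ j : Fin (K + 1), conj (c j) * z j).re * Complex.I) =
        ∏ j : Fin (K + 1), Complex.exp (ξ * (conj (c j) * z j).re * Complex.I) := by
      intro z
      rw [← Complex.exp_sum, Complex.re_sum, Complex.ofReal_sum, Finset.mul_sum, Finset.sum_mul]
    simp only [e]
    rw [integral_fintype_prod_eq_prod
      (fun (j : Fin (K + 1)) z => Complex.exp (ξ * (conj (c j) * z).re * Complex.I))]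
    simp only [integral_complexGaussian_exp (hlam _)]
    rw [← Complex.exp_sum, Finset.sum_range]
    congr 1
    push_cast
    rw [Finset.sum_mul, Finset.sum_div, ← Finset.sum_neg_distrib]
    refine Finset.sum_congr rfl fun j _ => ?_
    have : (lam j : ℂ) ≠ 0 := by exact_mod_cast (hlam j).ne'
    field_simp
    ring
  have hlim2 : Tendsto (fun K : ℕ => Complex.exp
      (-(((∑ n ∈ Finset.range (K + 1), ‖c n‖ ^ 2 / (2 * lam n) : ℝ) : ℂ) * ξ ^ 2 / 2))) atTop
      (𝓝 (Complex.exp (-(((∑' n, ‖c n‖ ^ 2 / (2 * lam n) : ℝ) : ℂ) * ξ ^ 2 / 2)))) := by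
    have h1 := hs.hasSum.tendsto_sum_nat.comp (tendsto_add_atTop_nat 1)
    have h2 : Continuous fun x : ℝ => Complex.exp (-((x : ℂ) * ξ ^ 2 / 2)) := by fun_prop
    exact (h2.tendsto _).comp h1
  simp only [hval] at hlim
  rw [tendsto_nhds_unique hlim hlim2, ← hv]
  congr 1
  simp

theorem IsFreeGibbs.integral_norm_coeff_pow [∀ n, IsProbabilityMeasure (complexGaussian (lam n))]
    (hlam : ∀ n, 0 < lam n) {μ : Measure (SobolevInter lam t₀)} (hμ : IsFreeGibbs μ)
    (n k : ℕ) :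
    Integrable (fun α : SobolevInter lam t₀ => ‖α.1 n‖ ^ (2 * k)) μ ∧
      ∫ α : SobolevInter lam t₀, ‖α.1 n‖ ^ (2 * k) ∂μ = k.factorial / lam n ^ k := by
  have hmap : μ.map (fun α : SobolevInter lam t₀ => α.1 n) = complexGaussian (lam n) := by
    have := Measure.map_map (μ := μ) (measurable_pi_apply n) measurable_subtype_coe
    rw [hμ.map_val, Measure.infinitePi_map_eval] at this
    exact this.symm
  have hc : Continuous fun z : ℂ => ‖z‖ ^ (2 * k) := by fun_prop
  have e : ∀ z : ℂ, ((‖z‖ ^ (2 * k) : ℝ) : ℂ) = z ^ k * conj z ^ k := by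
    intro z
    rw [← mul_pow, Complex.mul_conj, Complex.normSq_eq_norm_sq, pow_mul]
    push_cast; rfl
  have hi : Integrable (fun z : ℂ => ‖z‖ ^ (2 * k)) (complexGaussian (lam n)) := by
    have := (integrable_complexGaussian_moment (hlam n) k k).norm
    refine this.congr (ae_of_all _ fun z => ?_)
    simp only [← e, Complex.norm_real]
    exact Real.norm_of_nonneg (by positivity)
  constructor
  · rw [← hmap] at hi
    exact hi.comp_measurable (measurable_coeff n)
  · have h1 : ∫ α : SobolevInter lam t₀, ‖α.1 n‖ ^ (2 * k) ∂μ =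
        ∫ z, ‖z‖ ^ (2 * k) ∂complexGaussian (lam n) := by
      rw [← hmap, integral_map (measurable_coeff n).aemeasurable hc.aestronglyMeasurable]
    rw [h1]
    apply Complex.ofReal_injective
    rw [← integral_complex_ofReal]
    simp only [e]
    rw [integral_complexGaussian_moment_self (hlam n)]
    push_cast; rfl

/-- The `L^{2k}` norm of `αₙ` is `(k!)^(1/2k) λₙ^(-1/2)`. Minkowski's inequality bounds the partial
sums uniformly and Fatou's lemma carries the bound to the series. This supplies the dominating
function for the moments. -/
theorem IsFreeGibbs.integrable_tsum_norm_pow (hlam : ∀ n, 0 < lam n)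
    (hsum : ∀ t < t₀, Summable fun n => lam n ^ (t - 1))
    {μ : Measure (SobolevInter lam t₀)} (hμ : IsFreeGibbs μ) (ht : t < t₀)
    (hc : c ∈ SobolevLike lam (-t)) (k : ℕ) :
    Integrable (fun α : SobolevInter lam t₀ => (∑' n, ‖c n‖ * ‖α.1 n‖) ^ (2 * k)) μ := by
  have hp : ∀ n, IsProbabilityMeasure (complexGaussian (lam n)) := fun n =>
    isProbabilityMeasure_complexGaussian (hlam n)
  have := hμ.1
  rcases Nat.eq_zero_or_pos k with rfl | hk
  · simp
  let f : ℕ → SobolevInter lam t₀ → ℝ := fun n α => ‖c n‖ * ‖α.1 n‖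
  have hfm : ∀ n, Measurable (f n) := fun n => (measurable_coeff n).norm.const_mul _
  have hf0 : ∀ n α, 0 ≤ f n α := fun n α => by positivity
  set p : ℝ≥0∞ := ((2 * k : ℕ) : ℝ≥0∞) with hp'
  have hp0 : p ≠ 0 := by simp [hp']; omega
  have hp1 : 1 ≤ p := by rw [hp']; exact_mod_cast (by omega : 1 ≤ 2 * k)
  have hpt : p ≠ ∞ := by rw [hp']; exact ENNReal.natCast_ne_top _
  have hpr : p.toReal = (2 * k : ℕ) := by simp [hp']
  have hk' : (k : ℝ) ≠ 0 := by exact_mod_cast hk.ne'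
  set A : ℝ := (k.factorial : ℝ) ^ (1 / (2 * k : ℝ)) with hA
  have hLp : ∀ n, eLpNorm (f n) p μ = ENNReal.ofReal (A * (‖c n‖ * lam n ^ (-(1 / 2) : ℝ))) := by
    intro n
    have h0 := hlam n
    obtain ⟨hi, hv⟩ := hμ.integral_norm_coeff_pow hlam n k
    have e : ∀ α, ‖f n α‖ ^ p.toReal = ‖c n‖ ^ (2 * k) * ‖α.1 n‖ ^ (2 * k) := by
      intro α
      rw [hpr, Real.rpow_natCast, Real.norm_of_nonneg (hf0 n α), mul_pow]
    have hmem : MemLp (f n) p μ := by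
      rw [← integrable_norm_rpow_iff (hfm n).aestronglyMeasurable hp0 hpt]
      simp only [e]
      exact hi.const_mul _
    rw [hmem.eLpNorm_eq_integral_rpow_norm hp0 hpt]
    congr 1
    simp only [e]
    rw [integral_const_mul, hv, hpr]
    have h2k : ((2 * k : ℕ) : ℝ)⁻¹ = 1 / (2 * k : ℝ) := by push_cast; simp
    rw [h2k, Real.mul_rpow (by positivity) (by positivity), Real.div_rpow (by positivity)
      (by positivity), ← Real.rpow_natCast, ← Real.rpow_mul (norm_nonneg _), ← Real.rpow_natCast,
      ← Real.rpow_mul h0.le]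
    have e1 : ((2 * k : ℕ) : ℝ) * (1 / (2 * k : ℝ)) = 1 := by push_cast; field_simp
    have e2 : (k : ℝ) * (1 / (2 * k : ℝ)) = 1 / 2 := by field_simp
    rw [e1, e2, Real.rpow_one, Real.rpow_neg h0.le, hA]
    ring
  have hw := (summable_norm_mul_rpow hlam hc (hsum t ht)).mul_left A
  have hw0 : ∀ n, 0 ≤ A * (‖c n‖ * lam n ^ (-(1 / 2) : ℝ)) := fun n => by
    have := hlam n; positivity
  have hlim : ∀ α : SobolevInter lam t₀,
      Tendsto (fun N => (∑ n ∈ Finset.range N, f n) α) atTop (𝓝 (∑' n, f n α)) := by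
    intro α
    simpa [Finset.sum_apply] using
      (summable_norm_mul_norm hlam hc (SobolevInter.mem (α := α) ht)).hasSum.tendsto_sum_nat
  have hmeasN : ∀ N, Measurable (∑ n ∈ Finset.range N, f n) := fun N => by
    simpa only [← Finset.sum_apply] using! Finset.measurable_sum _ fun n _ => hfm n
  have hGm : Measurable fun α : SobolevInter lam t₀ => ∑' n, f n α :=
    measurable_of_tendsto_metrizable hmeasN (tendsto_pi_nhds.2 hlim)
  have hbound : ∀ N, eLpNorm (∑ n ∈ Finset.range N, f n) p μ ≤
      ENNReal.ofReal (∑' n, A * (‖c n‖ * lam n ^ (-(1 / 2) : ℝ))) := by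
    intro N
    refine (eLpNorm_sum_le (fun n _ => (hfm n).aestronglyMeasurable) hp1).trans ?_
    simp only [hLp]
    rw [← ENNReal.ofReal_sum_of_nonneg fun n _ => hw0 n]
    exact ENNReal.ofReal_le_ofReal (hw.sum_le_tsum _ fun n _ => hw0 n)
  have hmem : MemLp (fun α : SobolevInter lam t₀ => ∑' n, f n α) p μ := by
    refine ⟨hGm.aestronglyMeasurable, ?_⟩
    refine (Lp.eLpNorm_lim_le_liminf_eLpNorm (fun N => (hmeasN N).aestronglyMeasurable) _
      (ae_of_all _ hlim)).trans_lt (lt_of_le_of_lt ?_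
        (ENNReal.ofReal_lt_top (r := ∑' n, A * (‖c n‖ * lam n ^ (-(1 / 2) : ℝ)))))
    exact liminf_le_of_le (by isBoundedDefault) fun b hb => by
      obtain ⟨N, hN⟩ := hb.exists
      exact hN.trans (hbound N)
  have h1 := hmem.integrable_norm_pow (by omega)
  refine h1.congr (ae_of_all _ fun α => ?_)
  simp only
  rw [Real.norm_of_nonneg (tsum_nonneg fun n => hf0 n α)]

theorem IsFreeGibbs.integral_pairing_pow (hlam : ∀ n, 0 < lam n)
    (hsum : ∀ t < t₀, Summable fun n => lam n ^ (t - 1))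
    {μ : Measure (SobolevInter lam t₀)} (hμ : IsFreeGibbs μ) (ht : t < t₀)
    (hc : c ∈ SobolevLike lam (-t)) (hd : d ∈ SobolevLike lam (-t)) {S : ℂ}
    (hS : HasSum (fun n => conj (c n) * d n / lam n) S) (k : ℕ) :
    Integrable (fun α : SobolevInter lam t₀ => pairing c α.1 ^ k * conj (pairing d α.1) ^ k) μ ∧
      ∫ α : SobolevInter lam t₀, pairing c α.1 ^ k * conj (pairing d α.1) ^ k ∂μ =
        k.factorial * S ^ k := by
  have := hμ.1
  let G : (ℕ → ℂ) → SobolevInter lam t₀ → ℝ := fun c α => ∑' n, ‖c n‖ * ‖α.1 n‖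
  have hG0 : ∀ c α, 0 ≤ G c α := fun c α => tsum_nonneg fun n => by positivity
  have htr : ∀ c ∈ SobolevLike lam (-t), ∀ (α : SobolevInter lam t₀) K,
      ‖∑ j : Fin (K + 1), conj (c j) * cylProj K α j‖ ≤ G c α := by
    intro c hc α K
    refine (norm_sum_le _ _).trans ?_
    have hs := summable_norm_mul_norm hlam hc (SobolevInter.mem (α := α) ht)
    refine le_trans (le_of_eq ?_) (hs.sum_le_tsum (Finset.range (K + 1)) fun n _ => by positivity)
    rw [Finset.sum_range]
    refine Finset.sum_congr rfl fun j _ => ?_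
    simp [cylProj]
  -- One majorant serves all truncations and the limit: the product of two `k`-th powers is at most
  -- the sum of their squares.
  have hGi : Integrable (fun α => (G c α) ^ (2 * k) + (G d α) ^ (2 * k)) μ :=
    (hμ.integrable_tsum_norm_pow hlam hsum ht hc k).add
      (hμ.integrable_tsum_norm_pow hlam hsum ht hd k)
  have hprod : ∀ (α : SobolevInter lam t₀) (x y : ℂ), ‖x‖ ≤ G c α → ‖y‖ ≤ G d α →
      ‖x ^ k * conj y ^ k‖ ≤ (G c α) ^ (2 * k) + (G d α) ^ (2 * k) := by
    intro α x y hx hy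
    rw [norm_mul, norm_pow, norm_pow, Complex.norm_conj]
    have h1 : ‖x‖ ^ k ≤ G c α ^ k := pow_le_pow_left₀ (norm_nonneg _) hx k
    have h2 : ‖y‖ ^ k ≤ G d α ^ k := pow_le_pow_left₀ (norm_nonneg _) hy k
    have h3 : ‖x‖ ^ k * ‖y‖ ^ k ≤ G c α ^ k * G d α ^ k :=
      mul_le_mul h1 h2 (by positivity) (pow_nonneg (hG0 c α) k)
    rw [mul_comm 2 k, pow_mul, pow_mul]
    nlinarith [sq_nonneg (G c α ^ k - G d α ^ k), sq_nonneg (G c α ^ k + G d α ^ k)]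
  have hpt : ∀ α, Tendsto (fun K : ℕ => (∑ j : Fin (K + 1), conj (c j) * cylProj K α j) ^ k *
      conj (∑ j : Fin (K + 1), conj (d j) * cylProj K α j) ^ k) atTop
      (𝓝 (pairing c α.1 ^ k * conj (pairing d α.1) ^ k)) := fun α =>
    ((tendsto_pairing hlam ht hc α).pow k).mul
      (((Complex.continuous_conj.tendsto _).comp (tendsto_pairing hlam ht hd α)).pow k)
  have hmc := measurable_pairing hlam ht hc
  have hmd := measurable_pairing hlam ht hd
  refine ⟨hGi.mono' (Measurable.aestronglyMeasurable ((hmc.pow_const k).mul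
    ((Complex.continuous_conj.measurable.comp hmd).pow_const k))) (ae_of_all _ fun α => ?_), ?_⟩
  · exact hprod α _ _
      (le_of_tendsto ((tendsto_pairing hlam ht hc α).norm) (Eventually.of_forall (htr c hc α)))
      (le_of_tendsto ((tendsto_pairing hlam ht hd α).norm) (Eventually.of_forall (htr d hd α)))
  have hlim : Tendsto (fun K : ℕ => ∫ α, (∑ j : Fin (K + 1), conj (c j) * cylProj K α j) ^ k *
      conj (∑ j : Fin (K + 1), conj (d j) * cylProj K α j) ^ k ∂μ) atTop
      (𝓝 (∫ α : SobolevInter lam t₀, pairing c α.1 ^ k * conj (pairing d α.1) ^ k ∂μ)) :=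
    tendsto_integral_of_dominated_convergence _ (fun K => Measurable.aestronglyMeasurable
      (((measurable_trunc K).pow_const k).mul
        ((Complex.continuous_conj.measurable.comp (measurable_trunc K)).pow_const k))) hGi
      (fun K => ae_of_all _ fun α => hprod α _ _ (htr c hc α K) (htr d hd α K))
      (ae_of_all _ hpt)
  have hval : ∀ K : ℕ, ∫ α, (∑ j : Fin (K + 1), conj (c j) * cylProj K α j) ^ k *
      conj (∑ j : Fin (K + 1), conj (d j) * cylProj K α j) ^ k ∂μ =
      k.factorial * (∑ n ∈ Finset.range (K + 1), conj (c n) * d n / lam n) ^ k := by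
    intro K
    rw [hμ.integral_cylProj K (F := fun z => (∑ j : Fin (K + 1), conj (c j) * z j) ^ k *
      conj (∑ j : Fin (K + 1), conj (d j) * z j) ^ k) (by fun_prop),
      (gaussian_moments (fun j : Fin (K + 1) => hlam j) (fun j => conj (c j))
        (fun j => conj (d j)) k k).2, if_pos rfl, Finset.sum_range]
    simp
  simp only [hval] at hlim
  have h1 := hS.tendsto_sum_nat.comp (tendsto_add_atTop_nat 1)
  exact tendsto_nhds_unique hlim ((h1.pow k).const_mul _)

end Pairing

/-! ### Polarization -/

/-- Ryser's formula for the permanent. -/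
theorem sum_neg_one_pow_prod_sum_compl {ι : Type*} [Fintype ι] [DecidableEq ι] (C : ι → ι → ℂ) :
    ∑ U : Finset ι, (-1 : ℂ) ^ U.card * ∏ i, ∑ j ∈ Uᶜ, C i j =
      ∑ σ : Equiv.Perm ι, ∏ i, C i (σ i) := by
  have h1 : ∀ U : Finset ι, (-1 : ℂ) ^ U.card * ∏ i, ∑ j ∈ Uᶜ, C i j =
      ∑ f : ι → ι, if U ⊆ (Finset.univ.image f)ᶜ then (-1 : ℂ) ^ U.card * ∏ i, C i (f i)
        else 0 := by
    intro U
    rw [Finset.prod_univ_sum, Finset.mul_sum, ← Finset.sum_filter]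
    refine Finset.sum_congr ?_ fun _ _ => rfl
    ext f
    simp only [Fintype.mem_piFinset, Finset.mem_compl, Finset.mem_filter, Finset.mem_univ,
      true_and, Finset.subset_iff, Finset.mem_image, not_exists]
    exact ⟨fun h x hx i hi => h i (hi ▸ hx), fun h i hi => h hi i rfl⟩
  simp only [h1]
  rw [Finset.sum_comm]
  -- The product has been expanded over all maps `f` whose range avoids `U`. The alternating sum
  -- over such `U` vanishes unless the complement of the range is empty, so only permutations
  -- remain.
  have h2 : ∀ f : ι → ι, (∑ U : Finset ι, if U ⊆ (Finset.univ.image f)ᶜ then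
      (-1 : ℂ) ^ U.card * ∏ i, C i (f i) else 0) =
      if Finset.univ.image f = Finset.univ then ∏ i, C i (f i) else 0 := by
    intro f
    rw [← Finset.sum_filter, ← Finset.sum_mul]
    have h3 : (Finset.univ.filter fun U : Finset ι => U ⊆ (Finset.univ.image f)ᶜ) =
        ((Finset.univ.image f)ᶜ).powerset := by ext U; simp
    have h4 : ∑ U ∈ ((Finset.univ.image f)ᶜ).powerset, (-1 : ℂ) ^ U.card =
        if (Finset.univ.image f)ᶜ = ∅ then 1 else 0 := by
      have := Finset.sum_powerset_neg_one_pow_card (x := (Finset.univ.image f)ᶜ)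
      exact_mod_cast congrArg (Int.cast : ℤ → ℂ) this
    rw [h3, h4]
    simp only [Finset.compl_eq_empty_iff, ite_mul, one_mul, zero_mul]
  simp only [h2]
  symm
  refine Finset.sum_of_injOn (fun σ : Equiv.Perm ι => (σ : ι → ι)) ?_ ?_ ?_ ?_
  · exact fun σ _ τ _ h => Equiv.coe_fn_injective h
  · exact fun _ _ => Finset.mem_coe.2 (Finset.mem_univ _)
  · intro f _ hf
    rw [if_neg]
    intro h
    apply hf
    have hs : Function.Surjective f := fun y => by
      have : y ∈ Finset.univ.image f := by rw [h]; exact Finset.mem_univ y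
      simpa using this
    exact ⟨Equiv.ofBijective f (Finite.surjective_iff_bijective.1 hs), by simp, rfl⟩
  · intro σ _
    rw [if_pos (Finset.image_univ_of_surjective σ.surjective)]

theorem sum_perm_prod_comp {ι : Type*} [Fintype ι] [DecidableEq ι] (x : ι → ℂ) :
    ∑ σ : Equiv.Perm ι, ∏ i, x (σ i) = (Fintype.card ι).factorial * ∏ i, x i := by
  simp only [Equiv.prod_comp, Finset.sum_const, Finset.card_univ, Fintype.card_perm,
    nsmul_eq_mul]

theorem sum_neg_one_pow_sum_compl_pow {ι : Type*} [Fintype ι] [DecidableEq ι] (x : ι → ℂ) :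
    ∑ U : Finset ι, (-1 : ℂ) ^ U.card * (∑ j ∈ Uᶜ, x j) ^ Fintype.card ι =
      ∑ σ : Equiv.Perm ι, ∏ i, x (σ i) := by
  rw [← sum_neg_one_pow_prod_sum_compl fun _ j => x j]
  simp

/-- Polarization in both arguments: for fixed `W` the sum over `U` turns the power into a product of
row sums, and Ryser's formula then evaluates the sum over `W`. -/
theorem sum_sum_neg_one_pow_sum_sum_compl_pow {ι : Type*} [Fintype ι] [DecidableEq ι]
    (C : ι → ι → ℂ) :
    ∑ U : Finset ι, ∑ W : Finset ι, (-1 : ℂ) ^ U.card * (-1 : ℂ) ^ W.card *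
      (∑ i ∈ Uᶜ, ∑ j ∈ Wᶜ, C i j) ^ Fintype.card ι =
      (Fintype.card ι).factorial * ∑ σ : Equiv.Perm ι, ∏ i, C i (σ i) := by
  rw [Finset.sum_comm]
  have h : ∀ W : Finset ι, ∑ U : Finset ι, (-1 : ℂ) ^ U.card * (-1 : ℂ) ^ W.card *
      (∑ i ∈ Uᶜ, ∑ j ∈ Wᶜ, C i j) ^ Fintype.card ι =
      (Fintype.card ι).factorial * ((-1 : ℂ) ^ W.card * ∏ i, ∑ j ∈ Wᶜ, C i j) := by
    intro W
    have h1 := sum_neg_one_pow_sum_compl_pow fun i => ∑ j ∈ Wᶜ, C i j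
    rw [sum_perm_prod_comp fun i => ∑ j ∈ Wᶜ, C i j] at h1
    have h2 : ∀ U : Finset ι, (-1 : ℂ) ^ U.card * (-1 : ℂ) ^ W.card *
        (∑ i ∈ Uᶜ, ∑ j ∈ Wᶜ, C i j) ^ Fintype.card ι = (-1 : ℂ) ^ W.card *
        ((-1 : ℂ) ^ U.card * (∑ i ∈ Uᶜ, ∑ j ∈ Wᶜ, C i j) ^ Fintype.card ι) := fun U => by ring
    simp only [h2]
    rw [← Finset.mul_sum, h1]; ring
  simp only [h]
  rw [← Finset.mul_sum, sum_neg_one_pow_prod_sum_compl]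

/-! ### Moments of symmetric products -/

section Wick

variable {lam : ℕ → ℝ} {t₀ t : ℝ}

theorem SobolevLike.sum_mem (hlam : ∀ n, 0 < lam n) {ι : Type*} (F : Finset ι) {c : ι → ℕ → ℂ}
    (h : ∀ i, c i ∈ SobolevLike lam t) : (fun n => ∑ i ∈ F, c i n) ∈ SobolevLike lam t := by
  have hs : Summable fun n => (F.card : ℝ) * ∑ i ∈ F, lam n ^ t * ‖c i n‖ ^ 2 :=
    (summable_sum fun i _ => h i).mul_left _
  refine Summable.of_nonneg_of_le (fun n => by have := hlam n; positivity) (fun n => ?_) hs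
  have h0 := Real.rpow_pos_of_pos (hlam n) t
  rw [← Finset.mul_sum, mul_left_comm]
  refine mul_le_mul_of_nonneg_left ?_ h0.le
  refine (pow_le_pow_left₀ (norm_nonneg _) (norm_sum_le F _) 2).trans ?_
  exact sq_sum_le_card_mul_sum_sq

theorem pairing_sum (hlam : ∀ n, 0 < lam n) {ι : Type*} (F : Finset ι) {c : ι → ℕ → ℂ}
    (h : ∀ i, c i ∈ SobolevLike lam (-t)) {α : ℕ → ℂ} (hα : α ∈ SobolevLike lam t) :
    pairing (fun n => ∑ i ∈ F, c i n) α = ∑ i ∈ F, pairing (c i) α := by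
  unfold pairing
  rw [← Summable.tsum_finsetSum]
  · refine tsum_congr fun n => ?_
    rw [map_sum, Finset.sum_mul]
  · intro i _
    refine Summable.of_norm ?_
    simpa using summable_norm_mul_norm hlam (h i) hα

/-- By polarization a symmetric pairing is a signed combination of `k`-th powers of pairings with
partial sums of the `φ i`. Parseval's identity gives the covariance of two such partial sums as a
double sum of `⟪φ i, R (ψ j)⟫`, and double polarization reassembles the permanent. -/
theorem IsFreeGibbs.integral_symPairing (hlam : ∀ n, 0 < lam n)
    (hsum : ∀ t < t₀, Summable fun n => lam n ^ (t - 1))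
    {μ : Measure (SobolevInter lam t₀)} (hμ : IsFreeGibbs μ) {u : HilbertBasis ℕ ℂ L2R}
    {R : L2R →L[ℂ] L2R} (hR : ∀ f n, ⟪u n, R f⟫_ℂ = ((lam n)⁻¹ : ℝ) * ⟪u n, f⟫_ℂ)
    (ht : t < t₀) {k : ℕ} {φ ψ : Fin k → L2R}
    (hφ : ∀ i, (fun n => ⟪u n, φ i⟫_ℂ) ∈ SobolevLike lam (-t))
    (hψ : ∀ i, (fun n => ⟪u n, ψ i⟫_ℂ) ∈ SobolevLike lam (-t)) :
    Integrable (fun α : SobolevInter lam t₀ =>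
        symPairing u φ α.1 * conj (symPairing u ψ α.1)) μ ∧
      ∫ α : SobolevInter lam t₀, symPairing u φ α.1 * conj (symPairing u ψ α.1) ∂μ =
        k.factorial * ∑ σ : Equiv.Perm (Fin k), ∏ i, ⟪φ i, R (ψ (σ i))⟫_ℂ := by
  have hfac : ((Real.sqrt (k.factorial : ℝ) : ℂ))⁻¹ * ((Real.sqrt (k.factorial : ℝ) : ℂ))⁻¹ =
      (k.factorial : ℂ)⁻¹ := by
    rw [← mul_inv, ← Complex.ofReal_mul, Real.mul_self_sqrt (by positivity)]
    simp
  have hkf : (k.factorial : ℂ) ≠ 0 := by exact_mod_cast k.factorial_ne_zero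
  let c : (Fin k → L2R) → Finset (Fin k) → ℕ → ℂ := fun φ U n => ∑ i ∈ Uᶜ, ⟪u n, φ i⟫_ℂ
  have hcm : ∀ φ : Fin k → L2R, (∀ i, (fun n => ⟪u n, φ i⟫_ℂ) ∈ SobolevLike lam (-t)) →
      ∀ U, c φ U ∈ SobolevLike lam (-t) := fun φ hφ U => SobolevLike.sum_mem hlam _ hφ
  have hsym : ∀ φ : Fin k → L2R, (∀ i, (fun n => ⟪u n, φ i⟫_ℂ) ∈ SobolevLike lam (-t)) →
      ∀ α : SobolevInter lam t₀, symPairing u φ α.1 = ((Real.sqrt (k.factorial : ℝ))⁻¹ : ℂ) *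
        ∑ U : Finset (Fin k), (-1 : ℂ) ^ U.card * pairing (c φ U) α.1 ^ k := by
    intro φ hφ α
    have h1 := sum_neg_one_pow_sum_compl_pow fun i => pairing (fun n => ⟪u n, φ i⟫_ℂ) α.1
    rw [Fintype.card_fin] at h1
    rw [symPairing, ← h1]
    congr 1
    refine Finset.sum_congr rfl fun U _ => ?_
    rw [← pairing_sum hlam _ hφ (SobolevInter.mem ht)]
  have hS : ∀ U W : Finset (Fin k), HasSum (fun n => conj (c φ U n) * c ψ W n / lam n)
      (∑ i ∈ Uᶜ, ∑ j ∈ Wᶜ, ⟪φ i, R (ψ j)⟫_ℂ) := by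
    intro U W
    have h1 := u.hasSum_inner_mul_inner (∑ i ∈ Uᶜ, φ i) (R (∑ j ∈ Wᶜ, ψ j))
    rw [sum_inner] at h1
    simp only [map_sum, inner_sum] at h1
    refine h1.congr_fun fun n => ?_
    rw [sum_inner]
    simp only [hR, c, map_sum, inner_conj_symm]
    rw [← Finset.mul_sum]
    push_cast
    ring
  have hm := fun U W => hμ.integral_pairing_pow hlam hsum ht (hcm φ hφ U) (hcm ψ hψ W) (hS U W) k
  have hexp : ∀ α : SobolevInter lam t₀, symPairing u φ α.1 * conj (symPairing u ψ α.1) =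
      ∑ U : Finset (Fin k), ∑ W : Finset (Fin k), ((k.factorial : ℂ)⁻¹ * ((-1 : ℂ) ^ U.card *
        (-1 : ℂ) ^ W.card)) * (pairing (c φ U) α.1 ^ k * conj (pairing (c ψ W) α.1) ^ k) := by
    intro α
    rw [hsym φ hφ, hsym ψ hψ, map_mul, map_inv₀, Complex.conj_ofReal, map_sum, mul_mul_mul_comm,
      hfac, Finset.sum_mul_sum, Finset.mul_sum]
    refine Finset.sum_congr rfl fun U _ => ?_
    rw [Finset.mul_sum]
    refine Finset.sum_congr rfl fun W _ => ?_
    simp only [map_mul, map_pow, map_neg, map_one]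
    ring
  have hint : ∀ U W : Finset (Fin k), Integrable (fun α : SobolevInter lam t₀ =>
      ((k.factorial : ℂ)⁻¹ * ((-1 : ℂ) ^ U.card * (-1 : ℂ) ^ W.card)) *
        (pairing (c φ U) α.1 ^ k * conj (pairing (c ψ W) α.1) ^ k)) μ := fun U W =>
    (hm U W).1.const_mul _
  simp only [hexp]
  refine ⟨integrable_finsetSum _ fun U _ => integrable_finsetSum _ fun W _ => hint U W, ?_⟩
  rw [integral_finsetSum _ fun U _ => integrable_finsetSum _ fun W _ => hint U W]
  have h1 := sum_sum_neg_one_pow_sum_sum_compl_pow fun i j => ⟪φ i, R (ψ j)⟫_ℂ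
  rw [Fintype.card_fin] at h1
  rw [← h1]
  refine Finset.sum_congr rfl fun U _ => ?_
  rw [integral_finsetSum _ fun W _ => hint U W]
  refine Finset.sum_congr rfl fun W _ => ?_
  rw [integral_const_mul, (hm U W).2]
  field_simp

end Wick

/-! ### Tensor products -/

/-- The tensor product `φ₁ ⊗ ⋯ ⊗ φₖ`. -/
def tensor {k : ℕ} (φ : Fin k → L2R) : L2Rk k := (memLp_tensor φ).toLp

theorem coeFn_tensor {k : ℕ} (φ : Fin k → L2R) :
    ∀ᵐ x : Fin k → ℝ, tensor φ x = ∏ i, φ i (x i) := (memLp_tensor φ).coeFn_toLp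

theorem inner_tensor {k : ℕ} (φ ψ : Fin k → L2R) :
    ⟪tensor φ, tensor ψ⟫_ℂ = ∏ i, ⟪φ i, ψ i⟫_ℂ := by
  simp only [L2.inner_def]
  rw [← integral_fintype_prod_volume_eq_prod (fun i x => ⟪φ i x, ψ i x⟫_ℂ)]
  refine integral_congr_ae ?_
  filter_upwards [coeFn_tensor φ, coeFn_tensor ψ] with x h1 h2
  rw [h1, h2]
  simp only [RCLike.inner_apply, map_prod, Finset.prod_mul_distrib]

theorem norm_tensor {k : ℕ} (φ : Fin k → L2R) : ‖tensor φ‖ = ∏ i, ‖φ i‖ := by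
  have h := inner_tensor φ φ
  simp only [inner_self_eq_norm_sq_to_K] at h
  have h2 : ‖tensor φ‖ ^ 2 = (∏ i, ‖φ i‖) ^ 2 := by
    apply Complex.ofReal_injective
    rw [← Finset.prod_pow, Complex.ofReal_prod]
    simpa using h
  exact (pow_left_inj₀ (norm_nonneg _) (Finset.prod_nonneg fun i _ => norm_nonneg _)
    two_ne_zero).1 h2

theorem ae_comp_eval {k : ℕ} (i : Fin k) {P : ℝ → Prop} (h : ∀ᵐ y, P y) :
    ∀ᵐ x : Fin k → ℝ, P (x i) :=
  (Measure.quasiMeasurePreserving_eval (fun _ : Fin k => (volume : Measure ℝ)) i).ae h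

theorem tensor_update_prod {k : ℕ} (φ : Fin k → L2R) (i : Fin k) (v : L2R) (x : Fin k → ℝ) :
    ∏ j, (Function.update φ i v) j (x j) = v (x i) * ∏ j ∈ Finset.univ.erase i, φ j (x j) := by
  rw [← Finset.mul_prod_erase _ _ (Finset.mem_univ i), Function.update_self]
  congr 1
  refine Finset.prod_congr rfl fun j hj => ?_
  rw [Function.update_of_ne (Finset.ne_of_mem_erase hj)]

theorem exists_tensor_update_functional {k : ℕ} (Φ : L2Rk k) (φ : Fin k → L2R) (i : Fin k) :
    ∃ ℓ : L2R →L[ℂ] ℂ, ∀ v, ℓ v = ⟪Φ, tensor (Function.update φ i v)⟫_ℂ := by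
  have hadd : ∀ v w, tensor (Function.update φ i (v + w)) =
      tensor (Function.update φ i v) + tensor (Function.update φ i w) := by
    intro v w
    refine Lp.ext ?_
    filter_upwards [coeFn_tensor (Function.update φ i (v + w)),
      coeFn_tensor (Function.update φ i v), coeFn_tensor (Function.update φ i w),
      Lp.coeFn_add (tensor (Function.update φ i v)) (tensor (Function.update φ i w)),
      ae_comp_eval i (Lp.coeFn_add v w)] with x h1 h2 h3 h4 h5
    rw [h1, h4, Pi.add_apply, h2, h3, tensor_update_prod, tensor_update_prod, tensor_update_prod,
      h5, Pi.add_apply, add_mul]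
  have hsmul : ∀ (c : ℂ) v, tensor (Function.update φ i (c • v)) =
      c • tensor (Function.update φ i v) := by
    intro c v
    refine Lp.ext ?_
    filter_upwards [coeFn_tensor (Function.update φ i (c • v)),
      coeFn_tensor (Function.update φ i v), Lp.coeFn_smul c (tensor (Function.update φ i v)),
      ae_comp_eval i (Lp.coeFn_smul c v)] with x h1 h2 h4 h5
    rw [h1, h4, Pi.smul_apply, h2, tensor_update_prod, tensor_update_prod, h5, Pi.smul_apply,
      smul_eq_mul, smul_eq_mul, mul_assoc]
  let T : L2R →ₗ[ℂ] L2Rk k :=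
    { toFun := fun v => tensor (Function.update φ i v)
      map_add' := hadd
      map_smul' := hsmul }
  have hT : ∀ v, ‖T v‖ ≤ (∏ j ∈ Finset.univ.erase i, ‖φ j‖) * ‖v‖ := by
    intro v
    show ‖tensor (Function.update φ i v)‖ ≤ _
    rw [norm_tensor, ← Finset.mul_prod_erase _ _ (Finset.mem_univ i), Function.update_self,
      mul_comm]
    refine le_of_eq ?_
    congr 1
    refine Finset.prod_congr rfl fun j hj => ?_
    rw [Function.update_of_ne (Finset.ne_of_mem_erase hj)]
  exact ⟨(innerSL ℂ Φ).comp (T.mkContinuous _ hT), fun v => rfl⟩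

theorem eq_zero_of_basis_apply_eq_zero {ι E : Type*} [NormedAddCommGroup E]
    [InnerProductSpace ℂ E] (u : HilbertBasis ι ℂ E) {ℓ : E →L[ℂ] ℂ} (h : ∀ n, ℓ (u n) = 0)
    (v : E) : ℓ v = 0 := by
  have h1 : (⊤ : Submodule ℂ E) ≤ LinearMap.ker ℓ.toLinearMap := by
    rw [← u.dense_span]
    refine Submodule.topologicalClosure_minimal _ ?_ (ContinuousLinearMap.isClosed_ker ℓ)
    rw [Submodule.span_le]
    rintro _ ⟨n, rfl⟩
    exact h n
  exact h1 (Submodule.mem_top (x := v))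

/-- Induction on the set of slots no longer restricted to basis vectors: freeing one slot uses that
the pairing is linear and continuous in that slot. -/
theorem inner_tensor_eq_zero {ι : Type*} (u : HilbertBasis ι ℂ L2R) {k : ℕ} {Φ : L2Rk k}
    (h : ∀ m : Fin k → ι, ⟪Φ, tensor fun i => u (m i)⟫_ℂ = 0) (φ : Fin k → L2R) :
    ⟪Φ, tensor φ⟫_ℂ = 0 := by
  classical
  have key : ∀ S : Finset (Fin k), ∀ φ : Fin k → L2R, (∀ i ∉ S, ∃ n, φ i = u n) →
      ⟪Φ, tensor φ⟫_ℂ = 0 := by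
    intro S
    induction S using Finset.induction_on with
    | empty =>
      intro φ hφ
      choose m hm using fun i => hφ i (Finset.notMem_empty i)
      rw [funext hm]; exact h m
    | insert i S _ ih =>
      intro φ hφ
      obtain ⟨ℓ, hℓ⟩ := exists_tensor_update_functional Φ φ i
      have h1 := eq_zero_of_basis_apply_eq_zero u (ℓ := ℓ) (fun n => by
        rw [hℓ]
        refine ih _ fun j hj => ?_
        by_cases hij : j = i
        · subst hij; exact ⟨n, by simp⟩
        · rw [Function.update_of_ne hij]
          exact hφ j (by simp [hij, hj])) (φ i)
      rwa [hℓ, Function.update_eq_self] at h1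
  exact key Finset.univ φ fun i hi => absurd (Finset.mem_univ i) hi

/-- Balls of the sup norm are cubes, whose indicators are tensor products. So all averages of `Φ`
over balls vanish, and Lebesgue differentiation gives `Φ = 0`. -/
theorem eq_zero_of_inner_tensor_eq_zero {k : ℕ} {Φ : L2Rk k}
    (h : ∀ φ : Fin k → L2R, ⟪Φ, tensor φ⟫_ℂ = 0) : Φ = 0 := by
  have hball : ∀ (x : Fin k → ℝ) (r : ℝ), 0 ≤ r → ∫ y in Metric.closedBall x r, Φ y = 0 := by
    intro x r hr
    let φ : Fin k → L2R := fun i =>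
      indicatorConstLp 2 (measurableSet_Icc (a := x i - r) (b := x i + r)) (by simp) (1 : ℂ)
    have h1 : ⟪tensor φ, Φ⟫_ℂ = 0 := inner_eq_zero_symm.1 (h φ)
    have h2 : ∀ᵐ y : Fin k → ℝ, ∀ i, φ i (y i) =
        (Set.Icc (x i - r) (x i + r)).indicator (fun _ => (1 : ℂ)) (y i) :=
      ae_all_iff.2 fun i => ae_comp_eval i indicatorConstLp_coeFn
    rw [← h1, L2.inner_def, ← integral_indicator Metric.isClosed_closedBall.measurableSet]
    refine integral_congr_ae ?_
    filter_upwards [coeFn_tensor φ, h2] with y e1 e2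
    rw [e1, RCLike.inner_apply, map_prod]
    simp only [e2]
    by_cases hy : y ∈ Metric.closedBall x r
    · rw [Set.indicator_of_mem hy, Finset.prod_eq_one, mul_one]
      intro i _
      have := (dist_pi_le_iff hr).1 (Metric.mem_closedBall.1 hy) i
      rw [Real.dist_eq, abs_le] at this
      rw [Set.indicator_of_mem (Set.mem_Icc.2 ⟨by linarith, by linarith⟩), map_one]
    · rw [Set.indicator_of_notMem hy]
      rw [Metric.mem_closedBall, dist_pi_le_iff hr] at hy
      push Not at hy
      obtain ⟨i, hi⟩ := hy
      rw [Finset.prod_eq_zero (Finset.mem_univ i), mul_zero]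
      rw [Set.indicator_of_notMem, map_zero]
      intro hm
      rw [Real.dist_eq, lt_abs] at hi
      rcases hi with hi | hi
      · linarith [hm.2]
      · linarith [hm.1]
  rw [Lp.eq_zero_iff_ae_eq_zero]
  have hloc : LocallyIntegrable (Φ : (Fin k → ℝ) → ℂ) :=
    (Lp.memLp Φ).locallyIntegrable (by norm_num)
  filter_upwards [IsUnifLocDoublingMeasure.ae_tendsto_average (μ := volume) hloc 1] with x hx
  have h1 := hx (l := 𝓝[>] (0 : ℝ)) (fun _ => x) id tendsto_id (by
    filter_upwards [self_mem_nhdsWithin] with r hr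
    exact Metric.mem_closedBall_self (by rw [one_mul]; exact le_of_lt hr))
  refine tendsto_nhds_unique h1 (tendsto_const_nhds.congr' ?_)
  filter_upwards [self_mem_nhdsWithin] with r hr
  rw [setAverage_eq, id_eq, hball x r (le_of_lt hr), smul_zero]
  rfl

theorem isClosed_symL2 (k : ℕ) : IsClosed (SymL2 k : Set (L2Rk k)) := by
  have : (SymL2 k : Set (L2Rk k)) = ⋂ σ : Equiv.Perm (Fin k),
      {Φ | Lp.compMeasurePreserving _ (measurePreserving_perm σ) Φ = Φ} := by
    ext Φ
    simp only [Set.mem_iInter]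
    refine forall_congr' fun σ => ?_
    have h := Lp.coeFn_compMeasurePreserving Φ (measurePreserving_perm σ)
    exact ⟨fun hΦ => Lp.ext (h.trans hΦ), fun hΦ => h.symm.trans (by
      rw [show Lp.compMeasurePreserving _ (measurePreserving_perm σ) Φ = Φ from hΦ])⟩
  rw [this]
  exact isClosed_iInter fun σ =>
    isClosed_eq (Lp.isometry_compMeasurePreserving (measurePreserving_perm σ)).continuous
      continuous_id

instance (k : ℕ) : CompleteSpace (SymL2 k) := (isClosed_symL2 k).completeSpace_coe

theorem inner_tensor_comp_perm {k : ℕ} (Φ : SymL2 k) (φ : Fin k → L2R)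
    (σ : Equiv.Perm (Fin k)) :
    ⟪(Φ : L2Rk k), tensor fun i => φ (σ i)⟫_ℂ = ⟪(Φ : L2Rk k), tensor φ⟫_ℂ := by
  have hmp := measurePreserving_perm (k := k) σ
  have h1 : Lp.compMeasurePreserving _ hmp (Φ : L2Rk k) = Φ :=
    Lp.ext ((Lp.coeFn_compMeasurePreserving _ hmp).trans (Φ.2 σ))
  have h2 : Lp.compMeasurePreserving _ hmp (tensor fun i => φ (σ i)) = tensor φ := by
    refine Lp.ext ?_
    filter_upwards [Lp.coeFn_compMeasurePreserving (tensor fun i => φ (σ i)) hmp,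
      hmp.quasiMeasurePreserving.ae (coeFn_tensor fun i => φ (σ i)), coeFn_tensor φ]
      with x e1 e2 e3
    rw [e1, Function.comp_apply, e2, e3]
    exact Equiv.prod_comp σ fun i => φ i (x i)
  have h3 := (Lp.compMeasurePreservingₗᵢ ℂ _ hmp).inner_map_map (Φ : L2Rk k)
    (tensor fun i => φ (σ i))
  rw [← h3]
  show ⟪Lp.compMeasurePreserving _ hmp (Φ : L2Rk k),
    Lp.compMeasurePreserving _ hmp (tensor fun i => φ (σ i))⟫_ℂ = _
  rw [h1, h2]

theorem coe_symTensor {k : ℕ} (φ : Fin k → L2R) :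
    (symTensor φ : L2Rk k) = ((Real.sqrt (k.factorial : ℝ))⁻¹ : ℂ) •
      ∑ σ : Equiv.Perm (Fin k), tensor fun i => φ (σ i) := by
  refine Lp.ext ?_
  have h1 : ∀ᵐ x, ∀ σ : Equiv.Perm (Fin k), tensor (fun i => φ (σ i)) x = ∏ i, φ (σ i) (x i) :=
    ae_all_iff.2 fun σ => coeFn_tensor _
  filter_upwards [(memLp_symTensorFun φ).coeFn_toLp, h1,
    Lp.coeFn_smul ((Real.sqrt (k.factorial : ℝ))⁻¹ : ℂ)
      (∑ σ : Equiv.Perm (Fin k), tensor fun i => φ (σ i)),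
    Lp.coeFn_finsetSum Finset.univ fun σ : Equiv.Perm (Fin k) => tensor fun i => φ (σ i)]
    with x e1 e2 e3 e4
  rw [e3, Pi.smul_apply, e4, Finset.sum_apply]
  simp only [e2]
  exact e1

theorem inner_symTensor_right {k : ℕ} (Φ : SymL2 k) (φ : Fin k → L2R) :
    ⟪Φ, symTensor φ⟫_ℂ = ((Real.sqrt (k.factorial : ℝ))⁻¹ : ℂ) * k.factorial *
      ⟪(Φ : L2Rk k), tensor φ⟫_ℂ := by
  rw [Submodule.coe_inner, coe_symTensor, inner_smul_right, inner_sum]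
  simp only [inner_tensor_comp_perm]
  rw [Finset.sum_const, Finset.card_univ, Fintype.card_perm, Fintype.card_fin, nsmul_eq_mul,
    mul_assoc]

theorem inner_symTensor {k : ℕ} (φ ψ : Fin k → L2R) :
    ⟪symTensor φ, symTensor ψ⟫_ℂ = ∑ σ : Equiv.Perm (Fin k), ∏ i, ⟪φ i, ψ (σ i)⟫_ℂ := by
  have hk : (k.factorial : ℂ) ≠ 0 := by exact_mod_cast k.factorial_ne_zero
  have hfac : ((Real.sqrt (k.factorial : ℝ) : ℂ))⁻¹ * ((Real.sqrt (k.factorial : ℝ) : ℂ))⁻¹ =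
      (k.factorial : ℂ)⁻¹ := by
    rw [← mul_inv, ← Complex.ofReal_mul, Real.mul_self_sqrt (by positivity)]
    simp
  rw [inner_symTensor_right, coe_symTensor, inner_smul_left, sum_inner, map_inv₀,
    Complex.conj_ofReal]
  simp only [inner_tensor]
  have h1 : ∑ σ : Equiv.Perm (Fin k), ∏ i, ⟪φ (σ i), ψ i⟫_ℂ =
      ∑ σ : Equiv.Perm (Fin k), ∏ i, ⟪φ i, ψ (σ i)⟫_ℂ := by
    refine Fintype.sum_equiv (Equiv.inv _) _ _ fun σ => ?_
    refine Fintype.prod_equiv σ _ _ fun i => ?_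
    simp
  rw [h1]
  linear_combination (k.factorial : ℂ) *
    (∑ σ : Equiv.Perm (Fin k), ∏ i, ⟪φ i, ψ (σ i)⟫_ℂ) * hfac +
    (∑ σ : Equiv.Perm (Fin k), ∏ i, ⟪φ i, ψ (σ i)⟫_ℂ) * (mul_inv_cancel₀ hk)

/-! ### Diagonal operators -/

theorem exists_diagonal_operator {ι H : Type*} [NormedAddCommGroup H] [InnerProductSpace ℂ H]
    (b : HilbertBasis ι ℂ H) (a : ι → ℝ) {B : ℝ} (hB : ∀ i, |a i| ≤ B) :
    ∃ T : H →L[ℂ] H, ∀ x i, ⟪b i, T x⟫_ℂ = (a i : ℂ) * ⟪b i, x⟫_ℂ := by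
  -- The bound `B` may be negative when the index type is empty.
  let B' : ℝ := max B 0
  have hB'0 : 0 ≤ B' := le_max_right _ _
  have hle : ∀ i (z : ℂ), ‖(a i : ℂ) * z‖ ≤ ‖(B' : ℂ) * z‖ := fun i z => by
    rw [norm_mul, norm_mul, Complex.norm_real, Complex.norm_real, Real.norm_of_nonneg hB'0,
      Real.norm_eq_abs]
    exact mul_le_mul_of_nonneg_right ((hB i).trans (le_max_left _ _)) (norm_nonneg _)
  have hmem : ∀ x : lp (fun _ : ι => ℂ) 2, Memℓp (fun i => (a i : ℂ) * x i) 2 := by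
    intro x
    refine memℓp_gen ?_
    refine Summable.of_nonneg_of_le (fun i => by positivity) (fun i => ?_)
      ((lp.memℓp ((B' : ℂ) • x)).summable (by norm_num))
    refine Real.rpow_le_rpow (norm_nonneg _) ?_ (by norm_num)
    rw [lp.coeFn_smul, Pi.smul_apply, smul_eq_mul]
    exact hle i _
  let M : lp (fun _ : ι => ℂ) 2 →ₗ[ℂ] lp (fun _ : ι => ℂ) 2 :=
    { toFun := fun x => ⟨fun i => (a i : ℂ) * x i, hmem x⟩
      map_add' := fun x y => by
        ext i
        simp only [lp.coeFn_add, Pi.add_apply, mul_add]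
      map_smul' := fun c x => by
        ext i
        simp only [lp.coeFn_smul, Pi.smul_apply, smul_eq_mul, RingHom.id_apply]
        ring }
  have hM : ∀ x, ‖M x‖ ≤ B' * ‖x‖ := by
    intro x
    have h1 : ‖M x‖ ≤ ‖(B' : ℂ) • x‖ := by
      refine lp.norm_mono (by norm_num) fun i => ?_
      rw [lp.coeFn_smul, Pi.smul_apply, smul_eq_mul]
      exact hle i _
    rwa [norm_smul, Complex.norm_real, Real.norm_of_nonneg hB'0] at h1
  refine ⟨(b.repr.symm.toContinuousLinearEquiv : _ →L[ℂ] H).comp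
    ((M.mkContinuous B' hM).comp (b.repr.toContinuousLinearEquiv : H →L[ℂ] _)), fun x i => ?_⟩
  rw [← b.repr_apply_apply, ← b.repr_apply_apply]
  show b.repr (b.repr.symm (M (b.repr x))) i = _
  rw [LinearIsometryEquiv.apply_symm_apply]
  rfl

theorem ext_inner_basis {ι H : Type*} [NormedAddCommGroup H] [InnerProductSpace ℂ H]
    (b : HilbertBasis ι ℂ H) {x y : H} (h : ∀ i, ⟪b i, x⟫_ℂ = ⟪b i, y⟫_ℂ) : x = y := by
  apply b.repr.injective
  ext i
  rw [b.repr_apply_apply, b.repr_apply_apply, h]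

theorem clm_ext_basis {ι H : Type*} [NormedAddCommGroup H] [InnerProductSpace ℂ H]
    (b : HilbertBasis ι ℂ H) {S T : H →L[ℂ] H}
    (h : ∀ i j, ⟪b i, S (b j)⟫_ℂ = ⟪b i, T (b j)⟫_ℂ) : S = T := by
  refine ContinuousLinearMap.ext_on (s := Set.range b) ?_ ?_
  · have := b.dense_span
    rwa [← Submodule.dense_iff_topologicalClosure_eq_top] at this
  · rintro _ ⟨j, rfl⟩
    exact ext_inner_basis b fun i => h i j

/-! ### A basis of the bosonic space -/

section SymBasis

variable (u : HilbertBasis ℕ ℂ L2R) (k : ℕ)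

theorem inner_symTensor_basis {m m' : Fin k → ℕ} :
    ⟪symTensor fun i => u (m i), symTensor fun i => u (m' i)⟫_ℂ =
      ((Finset.univ.filter fun σ : Equiv.Perm (Fin k) => m = m' ∘ σ).card : ℂ) := by
  rw [inner_symTensor, Finset.card_filter, Nat.cast_sum]
  refine Finset.sum_congr rfl fun σ _ => ?_
  simp only [orthonormal_iff_ite.1 u.orthonormal, funext_iff, Function.comp_apply]
  rw [Finset.prod_ite_zero]
  simp

theorem symTensor_basis_ne_zero (m : Fin k → ℕ) : (symTensor fun i => u (m i)) ≠ 0 := by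
  intro h
  have h1 := inner_symTensor_basis u k (m := m) (m' := m)
  rw [h, inner_zero_left] at h1
  have h2 : (Finset.univ.filter fun σ : Equiv.Perm (Fin k) => m = m ∘ σ).card = 0 := by
    exact_mod_cast h1.symm
  rw [Finset.card_eq_zero, Finset.filter_eq_empty_iff] at h2
  exact h2 (Finset.mem_univ 1) rfl

/-- The occupation number states: normalized symmetric products of basis vectors. -/
def occupationState (m : {m : Fin k → ℕ // Monotone m}) : SymL2 k :=
  ((‖symTensor fun i => u (m.1 i)‖⁻¹ : ℝ) : ℂ) • symTensor fun i => u (m.1 i)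

theorem orthonormal_occupationState : Orthonormal ℂ (occupationState u k) := by
  refine ⟨fun m => ?_, fun m m' hmm => ?_⟩
  · have h0 := norm_ne_zero_iff.2 (symTensor_basis_ne_zero u k m.1)
    rw [occupationState, norm_smul, Complex.norm_real, norm_inv, norm_norm, inv_mul_cancel₀ h0]
  · have h0 := inner_symTensor_basis u k (m := m.1) (m' := m'.1)
    rw [Finset.card_eq_zero.2, Nat.cast_zero] at h0
    · have h1 := inner_smul_right (𝕜 := ℂ) (symTensor fun i => u (m.1 i))
        (symTensor fun i => u (m'.1 i)) ((‖symTensor fun i => u (m'.1 i)‖⁻¹ : ℝ) : ℂ)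
      have h2 := inner_smul_left (𝕜 := ℂ) (symTensor fun i => u (m.1 i))
        (occupationState u k m') ((‖symTensor fun i => u (m.1 i)‖⁻¹ : ℝ) : ℂ)
      exact h2.trans (mul_eq_zero_of_right _ (h1.trans (mul_eq_zero_of_right _ h0)))
    rw [Finset.filter_eq_empty_iff]
    intro σ _ h
    apply hmm
    ext1
    rw [h]
    -- Two monotone rearrangements of the same tuple coincide, so distinct monotone multi-indices
    -- are never related by a permutation.
    have := Tuple.unique_monotone (f := m'.1) (σ := σ) (τ := 1) (h ▸ m.2)
      (by simpa using m'.2)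
    simpa using this

/-- Pairing a symmetric `Φ` with a basis tensor does not see the order of the indices, so sorting
reduces every multi-index to a monotone one. Orthogonality to all basis tensors then forces `Φ = 0`.
-/
theorem span_occupationState_orthogonal :
    (Submodule.span ℂ (Set.range (occupationState u k)))ᗮ = ⊥ := by
  rw [eq_bot_iff]
  intro Φ hΦ
  have hk : ((Real.sqrt (k.factorial : ℝ))⁻¹ : ℂ) * k.factorial ≠ 0 := by
    have h1 : (k.factorial : ℂ) ≠ 0 := by exact_mod_cast k.factorial_ne_zero
    have h2 : (Real.sqrt (k.factorial : ℝ) : ℂ) ≠ 0 := by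
      have : 0 < Real.sqrt (k.factorial : ℝ) := Real.sqrt_pos.2 (by positivity)
      exact_mod_cast this.ne'
    exact mul_ne_zero (inv_ne_zero h2) h1
  have hmono : ∀ m : Fin k → ℕ, Monotone m → ⟪(Φ : L2Rk k), tensor fun i => u (m i)⟫_ℂ = 0 := by
    intro m hm
    have h1 := inner_eq_zero_symm.1 ((Submodule.mem_orthogonal _ _).1 hΦ
      (occupationState u k ⟨m, hm⟩) (Submodule.subset_span ⟨_, rfl⟩))
    have h2 := (inner_smul_right (𝕜 := ℂ) Φ (symTensor fun i => u (m i)) _).symm.trans h1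
    have h0 : ((‖symTensor fun i => u (m i)‖⁻¹ : ℝ) : ℂ) ≠ 0 := by
      exact_mod_cast inv_ne_zero (norm_ne_zero_iff.2 (symTensor_basis_ne_zero u k m))
    have h3 := (inner_symTensor_right Φ fun i => u (m i)).symm.trans
      ((mul_eq_zero.1 h2).resolve_left h0)
    exact (mul_eq_zero.1 h3).resolve_left hk
  have hall : ∀ m : Fin k → ℕ, ⟪(Φ : L2Rk k), tensor fun i => u (m i)⟫_ℂ = 0 := by
    intro m
    rw [← inner_tensor_comp_perm Φ (fun i => u (m i)) (Tuple.sort m)]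
    exact hmono (m ∘ Tuple.sort m) (Tuple.monotone_sort m)
  rw [Submodule.mem_bot]
  ext1
  exact eq_zero_of_inner_tensor_eq_zero (inner_tensor_eq_zero u hall)

/-- The basis of occupation number states. -/
def symBasis : HilbertBasis {m : Fin k → ℕ // Monotone m} ℂ (SymL2 k) :=
  HilbertBasis.mkOfOrthogonalEqBot (orthonormal_occupationState u k)
    (span_occupationState_orthogonal u k)

theorem symBasis_apply (m : {m : Fin k → ℕ // Monotone m}) :
    symBasis u k m = ((‖symTensor fun i => u (m.1 i)‖⁻¹ : ℝ) : ℂ) •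
      symTensor fun i => u (m.1 i) :=
  congrFun (HilbertBasis.coe_mkOfOrthogonalEqBot (orthonormal_occupationState u k)
    (span_occupationState_orthogonal u k)) m

end SymBasis

/-! ### Sums over multi-indices and Schatten classes of diagonal operators. -/

theorem summable_prod_comp {k : ℕ} {f : ℕ → ℝ} (hf0 : ∀ n, 0 ≤ f n) (hf : Summable f) :
    Summable fun m : Fin k → ℕ => ∏ i, f (m i) := by
  classical
  refine summable_of_sum_le (c := (∑' n, f n) ^ k)
    (fun m => Finset.prod_nonneg fun i _ => hf0 _) fun F => ?_
  let S : Finset ℕ := F.biUnion fun m => Finset.univ.image m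
  -- A finite set of multi-indices sits in a cube `Sᵏ`, over which the sum factorizes into a `k`-th
  -- power.
  have hF : F ⊆ Fintype.piFinset fun _ : Fin k => S := by
    intro m hm
    rw [Fintype.mem_piFinset]
    intro i
    exact Finset.mem_biUnion.2 ⟨m, hm, Finset.mem_image_of_mem m (Finset.mem_univ i)⟩
  calc ∑ m ∈ F, ∏ i, f (m i) ≤ ∑ m ∈ Fintype.piFinset fun _ : Fin k => S, ∏ i, f (m i) :=
        Finset.sum_le_sum_of_subset_of_nonneg hF fun m _ _ =>
          Finset.prod_nonneg fun i _ => hf0 _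
    _ = (∑ n ∈ S, f n) ^ k := by
        rw [← Finset.prod_univ_sum]; simp
    _ ≤ _ := pow_le_pow_left₀ (Finset.sum_nonneg fun n _ => hf0 n)
        (hf.sum_le_tsum S fun n _ => hf0 n) k

theorem isSchatten_of_diagonal {ι : Type} {H : Type*} [NormedAddCommGroup H]
    [InnerProductSpace ℂ H] (b : HilbertBasis ι ℂ H) {T : H →L[ℂ] H} {a : ι → ℝ}
    (ha : ∀ i, 0 ≤ a i) (hT : ∀ x i, ⟪b i, T x⟫_ℂ = (a i : ℂ) * ⟪b i, x⟫_ℂ) {q : ℝ}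
    (hq : 0 ≤ q) (hsum : ∀ r : ℝ, q < r → Summable fun i => a i ^ r) {p : ℝ≥0∞}
    (hp : ENNReal.ofReal q < p) : IsSchatten p T := by
  have hr0 : 0 < q + 1 := by linarith
  -- Compactness comes from summability of one power beyond `q`; it also settles the case `p = ∞`.
  have htend : Tendsto a cofinite (𝓝 0) := by
    have h1 := (hsum (q + 1) (by linarith)).tendsto_cofinite_zero
    have h2 := h1.rpow_const (p := (q + 1)⁻¹) (Or.inr (by positivity))
    rw [Real.zero_rpow (by positivity)] at h2
    refine h2.congr fun i => ?_
    rw [← Real.rpow_mul (ha i), mul_inv_cancel₀ hr0.ne', Real.rpow_one]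
  refine ⟨ι, b, b, a, b.orthonormal, b.orthonormal, ha, htend, ?_, fun x => ?_⟩
  · rcases eq_or_ne p ∞ with rfl | hpt
    · refine memℓp_infty ?_
      have hfin : {i | 1 ≤ a i}.Finite := by
        have := htend.eventually (gt_mem_nhds (zero_lt_one' ℝ))
        rw [Filter.eventually_cofinite] at this
        simpa using this
      obtain ⟨B, hB⟩ := (hfin.image a).bddAbove
      refine ⟨max B 1, ?_⟩
      rintro _ ⟨i, rfl⟩
      show ‖a i‖ ≤ _
      rw [Real.norm_of_nonneg (ha i)]
      by_cases hi : 1 ≤ a i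
      · exact (hB ⟨i, hi, rfl⟩).trans (le_max_left _ _)
      · exact (not_le.1 hi).le.trans (le_max_right _ _)
    · refine memℓp_gen ?_
      have hlt : q < p.toReal := by
        rwa [← ENNReal.ofReal_lt_ofReal_iff_of_nonneg hq, ENNReal.ofReal_toReal hpt]
      refine (hsum _ hlt).congr fun i => ?_
      rw [Real.norm_of_nonneg (ha i)]
  · refine (b.hasSum_repr (T x)).congr_fun fun i => ?_
    rw [b.repr_apply_apply, hT]

/-! ### The inverse operator and its tensor powers -/

theorem IsSpectralDecomposition.isInverse {V : ℝ → ℝ} {u : HilbertBasis ℕ ℂ L2R} {lam : ℕ → ℝ}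
    (h : IsSpectralDecomposition V u lam) (hlam : ∀ n, 0 < lam n) {R : L2R →L[ℂ] L2R}
    (hR : ∀ f n, ⟪u n, R f⟫_ℂ = ((lam n)⁻¹ : ℝ) * ⟪u n, f⟫_ℂ) : IsInverse V R := by
  intro f g
  have hne : ∀ n, (lam n : ℂ) ≠ 0 := fun n => by exact_mod_cast (hlam n).ne'
  rw [h f g]
  constructor
  · intro hfg
    refine ext_inner_basis u fun n => ?_
    rw [hR, hfg, Complex.ofReal_inv, inv_mul_cancel_left₀ (hne n)]
  · rintro rfl n
    rw [hR, Complex.ofReal_inv, mul_inv_cancel_left₀ (hne n)]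

section TensorPower

variable {u : HilbertBasis ℕ ℂ L2R} {lam : ℕ → ℝ} {k : ℕ}

theorem inner_symBasis_left (m : {m : Fin k → ℕ // Monotone m}) (Φ : SymL2 k) :
    ⟪symBasis u k m, Φ⟫_ℂ =
      ((‖symTensor fun i => u (m.1 i)‖⁻¹ : ℝ) : ℂ) * ⟪symTensor fun i => u (m.1 i), Φ⟫_ℂ := by
  rw [symBasis_apply]
  have h := inner_smul_left (𝕜 := ℂ) (symTensor fun i => u (m.1 i)) Φ
    ((‖symTensor fun i => u (m.1 i)‖⁻¹ : ℝ) : ℂ)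
  rw [Complex.conj_ofReal] at h
  exact h

/-- In the permanent expressing the coefficient at `m`, every permutation picks up the same factor
`∏ λ_{mᵢ}⁻¹`, which therefore comes out of the sum. -/
theorem isTensorPower_of_diagonal {R : L2R →L[ℂ] L2R}
    (hR : ∀ f n, ⟪u n, R f⟫_ℂ = ((lam n)⁻¹ : ℝ) * ⟪u n, f⟫_ℂ) {T : SymL2 k →L[ℂ] SymL2 k}
    (hT : ∀ Φ m, ⟪symBasis u k m, T Φ⟫_ℂ =
      ((∏ i, (lam (m.1 i))⁻¹ : ℝ) : ℂ) * ⟪symBasis u k m, Φ⟫_ℂ) : IsTensorPower R k T := by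
  intro φ
  refine ext_inner_basis (symBasis u k) fun m => ?_
  refine (hT _ m).trans ?_
  refine Eq.trans ?_ (inner_symBasis_left m _).symm
  rw [inner_symBasis_left, inner_symTensor, inner_symTensor, mul_left_comm, Finset.mul_sum]
  congr 1
  refine Finset.sum_congr rfl fun σ _ => ?_
  simp only [hR]
  rw [Finset.prod_mul_distrib, Complex.ofReal_prod]

theorem basis_mem_sobolevLike (u : HilbertBasis ℕ ℂ L2R) (lam : ℕ → ℝ) (t : ℝ) (j : ℕ) :
    (fun n => ⟪u n, u j⟫_ℂ) ∈ SobolevLike lam t := by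
  refine summable_of_ne_finset_zero (s := {j}) fun n hn => ?_
  rw [Finset.mem_singleton] at hn
  beta_reduce
  rw [u.orthonormal.2 hn, norm_zero, zero_pow two_ne_zero, mul_zero]

/-- Products of basis vectors are admissible test vectors, having only finitely many nonzero
coefficients in each factor, and they determine a bounded operator. Any `t < t₀` would serve; `t₀ -
1` is one. -/
theorem IsDensityMatrix.unique {t₀ : ℝ} {μ : Measure (SobolevInter lam t₀)}
    {γ γ' : SymL2 k →L[ℂ] SymL2 k} (h : IsDensityMatrix u μ k γ) (h' : IsDensityMatrix u μ k γ') :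
    γ' = γ := by
  refine clm_ext_basis (symBasis u k) fun m m' => ?_
  refine (inner_symBasis_left m _).trans (Eq.trans ?_ (inner_symBasis_left m _).symm)
  rw [symBasis_apply, map_smul, map_smul]
  have e := fun γ : SymL2 k →L[ℂ] SymL2 k => inner_smul_right (𝕜 := ℂ)
    (symTensor fun i => u (m.1 i)) (γ (symTensor fun i => u (m'.1 i)))
    ((‖symTensor fun i => u (m'.1 i)‖⁻¹ : ℝ) : ℂ)
  have key := ((h' (t₀ - 1) (sub_one_lt _) (fun i => u (m.1 i)) (fun i => u (m'.1 i))
    (fun i => basis_mem_sobolevLike u lam _ _) fun i => basis_mem_sobolevLike u lam _ _).2).symm.trans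
    (h (t₀ - 1) (sub_one_lt _) (fun i => u (m.1 i)) (fun i => u (m'.1 i))
    (fun i => basis_mem_sobolevLike u lam _ _) fun i => basis_mem_sobolevLike u lam _ _).2
  exact congrArg _ ((e γ').trans ((congrArg _ key).trans (e γ).symm))

theorem IsFreeGibbs.isDensityMatrix {t₀ : ℝ} (hlam : ∀ n, 0 < lam n)
    (hsum : ∀ t < t₀, Summable fun n => lam n ^ (t - 1))
    {μ : Measure (SobolevInter lam t₀)} (hμ : IsFreeGibbs μ) {R : L2R →L[ℂ] L2R}
    (hR : ∀ f n, ⟪u n, R f⟫_ℂ = ((lam n)⁻¹ : ℝ) * ⟪u n, f⟫_ℂ) {T : SymL2 k →L[ℂ] SymL2 k}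
    (hT : IsTensorPower R k T) : IsDensityMatrix u μ k ((k.factorial : ℂ) • T) := by
  intro t ht φ ψ hφ hψ
  obtain ⟨h1, h2⟩ := hμ.integral_symPairing hlam hsum hR ht hφ hψ
  refine ⟨h1, h2.trans ?_⟩
  rw [← inner_symTensor φ fun i => R (ψ i), ← hT]
  exact (inner_smul_right (𝕜 := ℂ) (symTensor φ) (T (symTensor ψ)) (k.factorial : ℂ)).symm

theorem isSchatten_tensorPower (hlam : ∀ n, 0 < lam n) {q : ℝ} (hq : 0 ≤ q)
    (hsum : ∀ r : ℝ, q < r → Summable fun n => lam n ^ (-r)) {T : SymL2 k →L[ℂ] SymL2 k}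
    (hT : ∀ Φ m, ⟪symBasis u k m, T Φ⟫_ℂ =
      ((∏ i, (lam (m.1 i))⁻¹ : ℝ) : ℂ) * ⟪symBasis u k m, Φ⟫_ℂ) {p : ℝ≥0∞}
    (hp : ENNReal.ofReal q < p) : IsSchatten p ((k.factorial : ℂ) • T) := by
  have hinv : ∀ n, 0 ≤ (lam n)⁻¹ := fun n => (inv_pos.2 (hlam n)).le
  refine isSchatten_of_diagonal (symBasis u k)
    (a := fun m => k.factorial * ∏ i, (lam (m.1 i))⁻¹) (fun m => ?_) (fun Φ m => ?_) hq
    (fun r hr => ?_) hp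
  · exact mul_nonneg (Nat.cast_nonneg _) (Finset.prod_nonneg fun i _ => hinv _)
  · have h := inner_smul_right (𝕜 := ℂ) (symBasis u k m) (T Φ) (k.factorial : ℂ)
    refine h.trans ((congrArg _ (hT Φ m)).trans ?_)
    rw [← mul_assoc, Complex.ofReal_mul, Complex.ofReal_natCast]
  · have h := ((summable_prod_comp (k := k)
      (fun n => Real.rpow_nonneg (hlam n).le (-r)) (hsum r hr)).comp_injective
      (Subtype.val_injective (p := Monotone))).mul_left ((k.factorial : ℝ) ^ r)
    refine h.congr fun m => ?_
    rw [Real.mul_rpow (Nat.cast_nonneg _) (Finset.prod_nonneg fun i _ => hinv _),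
      ← Real.finsetProd_rpow _ _ fun i _ => hinv _]
    refine congrArg _ (Finset.prod_congr rfl fun i _ => ?_)
    rw [Real.rpow_neg (hlam _).le, Real.inv_rpow (hlam _).le]

end TensorPower

end

end FreeGibbs

/-! ### The spectral, probabilistic and bosonic parts combined. -/

theorem mainTheorem2 (V : ℝ → ℝ) (s C : ℝ) (hs : 1 < s) (hC : 0 < C)
    (hVloc : MeasureTheory.LocallyIntegrable V MeasureTheory.volume)
    (hV : ∀ᵐ x : ℝ, C⁻¹ * |x| ^ s ≤ V x) :
    (∃ (u : HilbertBasis ℕ ℂ FreeGibbs.L2R) (lam : ℕ → ℝ),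
      FreeGibbs.IsSpectralDecomposition V u lam) ∧
    ∀ (u : HilbertBasis ℕ ℂ FreeGibbs.L2R) (lam : ℕ → ℝ),
      FreeGibbs.IsSpectralDecomposition V u lam →
      (∀ n, 0 < lam n) ∧
      ∃ μ₀ : MeasureTheory.Measure (FreeGibbs.SobolevInter lam (1 / 2 - 1 / s)),
        FreeGibbs.IsFreeGibbs μ₀ ∧
        (∀ ν : MeasureTheory.Measure (FreeGibbs.SobolevInter lam (1 / 2 - 1 / s)),
          FreeGibbs.IsFreeGibbs ν → ν = μ₀) ∧
        FreeGibbs.IsCenteredGaussian μ₀ ∧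
        ∃ R : FreeGibbs.L2R →L[ℂ] FreeGibbs.L2R, FreeGibbs.IsInverse V R ∧
          ∀ k : ℕ, ∃ γ T : FreeGibbs.SymL2 k →L[ℂ] FreeGibbs.SymL2 k,
            FreeGibbs.IsDensityMatrix u μ₀ k γ ∧
            (∀ γ' : FreeGibbs.SymL2 k →L[ℂ] FreeGibbs.SymL2 k,
              FreeGibbs.IsDensityMatrix u μ₀ k γ' → γ' = γ) ∧
            FreeGibbs.IsTensorPower R k T ∧
            γ = (k.factorial : ℂ) • T ∧
            ∀ p : ENNReal, ENNReal.ofReal (1 / s + 1 / 2) < p → FreeGibbs.IsSchatten p γ := by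
  refine ⟨FreeGibbs.exists_isSpectralDecomposition hs hC hVloc hV, fun u lam h => ?_⟩
  have hlam := h.lam_pos hC hV
  have hs0 : 0 < 1 / s := by positivity
  have hq : 0 ≤ 1 / s + 1 / 2 := by positivity
  obtain ⟨A, hA, hcard⟩ := h.card_le hs hC hV
  have hsum' : ∀ r : ℝ, 1 / s + 1 / 2 < r → Summable fun n => lam n ^ (-r) := fun r hr =>
    FreeGibbs.summable_rpow_neg_of_card_le hA hq hlam hcard hr
  -- The threshold `t < 1/2 - 1/s` is the condition `1 - t > 1/s + 1/2` on the exponent of the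
  -- eigenvalue sum.
  have hsum : ∀ t < 1 / 2 - 1 / s, Summable fun n => lam n ^ (t - 1) := fun t ht => by
    simpa using hsum' (1 - t) (by linarith)
  -- Any exponent below `-(1/s + 1/2)` would do here.
  obtain ⟨δ, hδ0, hδ⟩ := FreeGibbs.exists_lower_bound hlam (q := -(1 / s + 1 / 2 + 1))
    (by linarith) (hsum' _ (by linarith))
  have hinv : ∀ n, 0 ≤ (lam n)⁻¹ := fun n => (inv_pos.2 (hlam n)).le
  have hinv' : ∀ n, (lam n)⁻¹ ≤ δ⁻¹ := fun n => inv_anti₀ hδ0 (hδ n)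
  obtain ⟨μ₀, hμ, hμu⟩ := FreeGibbs.exists_isFreeGibbs hlam hδ0 hδ hsum
  obtain ⟨R, hR⟩ := FreeGibbs.exists_diagonal_operator u (fun n => (lam n)⁻¹) (B := δ⁻¹)
    fun n => by rw [abs_of_nonneg (hinv n)]; exact hinv' n
  refine ⟨hlam, μ₀, hμ, hμu, hμ.isCenteredGaussian hlam hsum, R, h.isInverse hlam hR, fun k => ?_⟩
  obtain ⟨T, hT⟩ := FreeGibbs.exists_diagonal_operator (FreeGibbs.symBasis u k)
    (fun m => ∏ i, (lam (m.1 i))⁻¹) (B := δ⁻¹ ^ k) fun m => by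
      rw [abs_of_nonneg (Finset.prod_nonneg fun i _ => hinv _)]
      simpa using Finset.prod_le_prod (s := Finset.univ) (fun i _ => hinv (m.1 i))
        fun i _ => hinv' (m.1 i)
  have hTR := FreeGibbs.isTensorPower_of_diagonal hR hT
  have hγ := hμ.isDensityMatrix hlam hsum hR hTR
  exact ⟨_, T, hγ, fun γ' h' => hγ.unique h', hTR, rfl, fun p hp =>
    FreeGibbs.isSchatten_tensorPower hlam hq hsum' hT hp⟩
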